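/- **Setting.** Let $\Omega\subset\mathbb R^2$ be a bounded domain whose boundary is a smooth simple closed curve of length $\ell$, parametrized by arclength $\theta\mapsto c(\theta)$ with positive orientation; let $\nu$ be the unit outer normal and $k$ the curvature ($\nu'=k\,c'$). Let $V$ be a positive smooth function on $\overline\Omega$, write $V(t,\theta)=V(c(\theta)-t\nu(\theta))$, $\beta=V(0,\cdot)^{1/2}$, $\beta_1=V_t(0,\cdot)$, and assume $\mathcal H:=k-\frac{\beta_1}{2\beta^2}>0$ on $\partial\Omega$. Let $N\ge1$, $H(x)=\tanh(x/\sqrt2)$ and $\gamma_0=\int_{\mathbb R}(H')^2$. **Parameters.** Let $\epsilon_0,\delta_0,\tilde\delta>0$. For $0<\epsilon<\epsilon_0$ and $1\le j\le N$ let functions $\bar f_j,\check f_j,\mathfrak D_j$ of $\theta$ and $\chi_j$ of $(s,\theta)$ be given (all depend on $\epsilon$); indices $0$ are read by $f_0=-f_1$, and likewise for $\bar f,\check f$ and the vectors below. Put $$\dot f_j=\tfrac1{2\sqrt2\beta}\ln\tfrac1{N\epsilon}+\tfrac1{\sqrt2\beta}\ln\tfrac{(N-j)!}{(N-1)!\,\epsilon^{j-1}},\qquad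 f_j=\dot f_j+\bar f_j+\check f_j,$$ $$\gamma_{1,j}=\int_{\mathbb R}\chi_j\,(H'(x))^2e^{-\sqrt2x}\,dx,\qquad \gamma_{2,j}=\int_{\mathbb R}\chi_j\,(H'(x))^2e^{\sqrt2x}\,dx,\qquad x=\beta(s-f_j),$$ $$\mathbf k_j=(N-j+1)\,e^{-\sqrt2\beta(\bar f_j-\bar f_{j-1})}\,e^{-\sqrt2\beta(\check f_j-\check f_{j-1})}\ (1\le j\le N),\qquad \mathbf k_{N+1}=0 .$$ Assume, with a constant $K$ independent of $\epsilon$: 1. $0\le\chi_j\le1$, $\chi_j$ is measurable in $s$, $\chi_j=1$ if $0<s<\delta_0/\epsilon$ and $\frac{f_{j-1}+f_j}2\le s\le\frac{f_j+f_{j+1}}2$, and $\chi_j=0$ unless $\frac{f_{j-1}+f_j}2-\tilde\delta\le s\le\frac{f_j+f_{j+1}}2+\tilde\delta$ (where $f_{N+1}=+\infty$). 2. $|\bar f_j|\le K$ and, for $j=1,\dots,N$, $$\tfrac{2\sqrt2}3k-\tfrac{\sqrt2}3\tfrac{\beta_1}{\beta^2}=6\sqrt2\,\beta^2\Big[(N-j+1)\gamma_{1,j}e^{-\sqrt2\beta(\bar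 f_j-\bar f_{j-1})}-(N-j)\gamma_{2,j}e^{-\sqrt2\beta(\bar f_{j+1}-\bar f_j)}\Big].$$ 3. $|\check f_j|\le K\sqrt\epsilon$. 4. $\gamma_{1,j},\gamma_{2,j},\check f_j,\mathfrak D_j$ are $\ell$-periodic and $C^2$ in $\theta$, and they and their first two derivatives are bounded by $K$; moreover $\gamma_{1,j},\gamma_{2,j},\check f_j$ are Lipschitz in $\sqrt\epsilon$ with constant $K$, uniformly in $\theta$. Put $\mathfrak c_n=12\beta^2\gamma_{1,n}\mathbf k_n$, $\mathfrak d_n=12\beta^2\gamma_{2,n}\mathbf k_{n+1}$, and let $\mathbf B$ be the tridiagonal $N\times N$ matrix with $(\mathbf Bv)_n=\mathfrak c_n(v_n-v_{n-1})-\mathfrak d_n(v_{n+1}-v_n)$, $v_0=-v_1$. For each $\epsilon\in(0,\epsilon_0)$ let $\mathbf P(\theta)$ be an invertible matrix, $C^2$ in $\theta$, with columns of Euclidean length one and $\mathbf P^{-1}\mathbf B\mathbf P=\mathrm{diag}(\rho_1^\epsilon,\dots,\rho_N^\epsilon)$, $\rho^\epsilon_1\ge\dots\ge\rho^\epsilon_N$.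 Define $E(t)=e^{-\sqrt2\beta t}-1+\sqrt2\beta t$ and $$\mathcal J_n(v)=-6\sqrt2\,\beta\gamma_{1,n}\mathbf k_nE(v_n-v_{n-1})+6\sqrt2\,\beta\gamma_{2,n}\mathbf k_{n+1}E(v_{n+1}-v_n),\qquad \tilde{\mathcal J}(y)=\mathbf P^{-1}\mathcal J(\mathbf Py),$$ $$\mathbf W(y)=\mathbf P^{-1}\mathbf P''y+2\mathbf P^{-1}\mathbf P'y',\qquad \mathfrak C_n=\frac{(\mathbf P^{-1}\mathfrak D)_n}{\rho_n^\epsilon}.$$ **Claim.** Let $0<\sigma<1$. There are a constant $C>0$ and a sequence $\epsilon_l\in(0,\epsilon_0)$ with $\epsilon_l\to0$ such that for every $l$ and every $\mathbf h\in L^2((0,\ell);\mathbb R^N)$ with $\|\mathbf h\|_{L^2(0,\ell)}\le\epsilon_l^{1+\sigma}$ the problem (with $\epsilon=\epsilon_l$) $$-\epsilon\gamma_0\tilde u''-\mathrm{diag}(\rho^\epsilon_1,\dots,\rho^\epsilon_N)\tilde u=\tilde{\mathcal J}\big(\tilde u+\epsilon|\ln\epsilon|\mathfrak C\big)+\epsilon\gamma_0\mathbf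 W\big(\tilde u+\epsilon|\ln\epsilon|\mathfrak C\big)+\epsilon^2|\ln\epsilon|\gamma_0\mathfrak C''+\mathbf h\quad\text{a.e. in }(0,\ell),$$ $$\tilde u(0)=\tilde u(\ell),\qquad \tilde u'(0)=\tilde u'(\ell),$$ has a solution $\tilde u\in H^2((0,\ell);\mathbb R^N)$ with $$\epsilon_l\|\tilde u''\|_{L^2(0,\ell)}+\sqrt{\epsilon_l}\,\|\tilde u'\|_{L^2(0,\ell)}+\|\tilde u\|_{L^\infty(0,\ell)}\le C\epsilon_l^{-1/2}\|\mathbf h\|_{L^2(0,\ell)}+\epsilon_l^{1/2+\sigma}.$$ -/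

import Mathlib

open MeasureTheory Set Filter Topology
open scoped ContDiff

noncomputable section

namespace BoundaryLayers

/-- The Euclidean plane. -/
abbrev Plane : Type := EuclideanSpace ℝ (Fin 2)

/-- A bounded planar domain whose boundary is a smooth simple closed curve of length `ℓ`,
parametrized by arclength by `c` with positive orientation, together with a positive smooth
function `V` on the closure of the domain. -/
structure Setting where
  Ω : Set Plane
  ℓ : ℝ
  c : ℝ → Plane
  V : Plane → ℝ
  isOpen_Ω : IsOpen Ω
  isConnected_Ω : IsConnected Ω
  isBounded_Ω : Bornology.IsBounded Ω
  ℓ_pos : 0 < ℓ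
  c_smooth : ContDiff ℝ ∞ c
  c_periodic : Function.Periodic c ℓ
  c_injOn : InjOn c (Ico 0 ℓ)
  c_arclength : ∀ θ, ‖deriv c θ‖ = 1
  frontier_eq : frontier Ω = range c
  /-- The tangent turned clockwise by a right angle points out of `Ω`. -/
  c_oriented : ∀ θ, ∀ᶠ t in 𝓝[>] (0 : ℝ),
    c θ - t • (!₂[deriv c θ 1, -(deriv c θ 0)] : Plane) ∈ Ω ∧
    c θ + t • (!₂[deriv c θ 1, -(deriv c θ 0)] : Plane) ∉ closure Ω
  V_smooth : ContDiffOn ℝ ∞ V (closure Ω)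
  V_pos : ∀ y ∈ closure Ω, 0 < V y

namespace Setting

variable (S : Setting)

/-- Unit outer normal. -/
def ν (θ : ℝ) : Plane := !₂[deriv S.c θ 1, -(deriv S.c θ 0)]

/-- Curvature of the boundary: `ν' = k c'`. -/
def k (θ : ℝ) : ℝ := inner ℝ (deriv S.ν θ) (deriv S.c θ)

/-- `V` in the Fermi coordinates `y = c θ - t ν θ`. -/
def Vloc (t θ : ℝ) : ℝ := S.V (S.c θ - t • S.ν θ)

/-- `β θ = V(0, θ) ^ (1/2)`. -/
def β (θ : ℝ) : ℝ := Real.sqrt (S.Vloc 0 θ)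

/-- `β₁ θ = V_t(0, θ)`, the derivative from inside the domain. -/
def β₁ (θ : ℝ) : ℝ := derivWithin (fun t => S.Vloc t θ) (Ici 0) 0

/-- Generalized mean curvature of the boundary. -/
def meanCurv (θ : ℝ) : ℝ := S.k θ - S.β₁ θ / (2 * S.Vloc 0 θ)

end Setting

/-- The heteroclinic solution of `H'' + H - H³ = 0`. -/
def H (x : ℝ) : ℝ := Real.tanh (x / Real.sqrt 2)

/-- `γ₀ = ∫ (H')²`. -/
def γ₀ : ℝ := ∫ x, (deriv H x) ^ 2

/-- Extension of a list `f 1, f 2, …` to the index `0` by `f 0 = - f 1`. -/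
def reflect (f : ℕ → ℝ) (j : ℕ) : ℝ := if j = 0 then -f 1 else f j

/-- The parameters of the construction. The first argument is `ε`, the index `j` runs through
`1, …, N`, and `θ` is arclength on the boundary; `χ ε j s θ` is the cut-off function of the `j`-th
layer, as a function of the stretched normal variable `s` and of `θ`. -/
structure Params where
  fbar : ℝ → ℕ → ℝ → ℝ
  fcheck : ℝ → ℕ → ℝ → ℝ
  χ : ℝ → ℕ → ℝ → ℝ → ℝ
  D : ℝ → ℕ → ℝ → ℝ

section Coefficients

variable (S : Setting) (N : ℕ) (p : Params)

/-- The logarithmic leading part of the position of the `j`-th layer. -/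
def fdot (ε : ℝ) (j : ℕ) (θ : ℝ) : ℝ :=
  1 / (2 * Real.sqrt 2 * S.β θ) * Real.log (1 / (N * ε))
    + 1 / (Real.sqrt 2 * S.β θ)
      * Real.log (((N - j).factorial : ℝ) / (((N - 1).factorial : ℝ) * ε ^ (j - 1)))

/-- Position of the `j`-th layer. -/
def pos (ε : ℝ) (j : ℕ) (θ : ℝ) : ℝ := fdot S N ε j θ + p.fbar ε j θ + p.fcheck ε j θ

/-- The midpoint `(f_{j-1} + f_j) / 2`, with `f_0 = -f_1`. -/
def mid (ε : ℝ) (j : ℕ) (θ : ℝ) : ℝ :=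
  (reflect (fun i => pos S N p ε i θ) (j - 1) + pos S N p ε j θ) / 2

/-- `γ_{1,j} = ∫ χ_j (H')² e^{-√2 x} dx`, where `x = β (s - f_j)`. -/
def γ₁ (ε : ℝ) (j : ℕ) (θ : ℝ) : ℝ :=
  ∫ x, p.χ ε j (pos S N p ε j θ + x / S.β θ) θ * (deriv H x) ^ 2 * Real.exp (-(Real.sqrt 2 * x))

/-- `γ_{2,j} = ∫ χ_j (H')² e^{√2 x} dx`, where `x = β (s - f_j)`. -/
def γ₂ (ε : ℝ) (j : ℕ) (θ : ℝ) : ℝ :=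
  ∫ x, p.χ ε j (pos S N p ε j θ + x / S.β θ) θ * (deriv H x) ^ 2 * Real.exp (Real.sqrt 2 * x)

/-- `d_j` for `1 ≤ j ≤ N`, and `d_{N+1} = 0`. -/
def dCoef (ε : ℝ) (j : ℕ) (θ : ℝ) : ℝ :=
  if j ≤ N then
    ((N : ℝ) - j + 1) * Real.exp (-(Real.sqrt 2 * S.β θ *
      (p.fbar ε j θ - reflect (fun i => p.fbar ε i θ) (j - 1))))
  else 0

/-- `k_j = d_j exp (-√2 β (fcheck_j - fcheck_{j-1}))` for `1 ≤ j ≤ N`, and `k_{N+1} = 0`. -/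
def kCoef (ε : ℝ) (j : ℕ) (θ : ℝ) : ℝ :=
  if j ≤ N then
    dCoef S N p ε j θ * Real.exp (-(Real.sqrt 2 * S.β θ *
      (p.fcheck ε j θ - reflect (fun i => p.fcheck ε i θ) (j - 1))))
  else 0

def cc (ε : ℝ) (n : ℕ) (θ : ℝ) : ℝ := 12 * S.β θ ^ 2 * γ₁ S N p ε n θ * kCoef S N p ε n θ

def dd (ε : ℝ) (n : ℕ) (θ : ℝ) : ℝ := 12 * S.β θ ^ 2 * γ₂ S N p ε n θ * kCoef S N p ε (n + 1) θ

/-- The tridiagonal matrix `B` of the linearized system; the row `i : Fin N` belongs to the layer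
`n = i + 1`, and `dd` vanishes for `n = N`. -/
def B (ε θ : ℝ) : Matrix (Fin N) (Fin N) ℝ :=
  Matrix.of fun i j =>
    if j = i then
      (if i.val = 0 then 2 else 1) * cc S N p ε (i + 1) θ + dd S N p ε (i + 1) θ
    else if j.val + 1 = i.val then -cc S N p ε (i + 1) θ
    else if i.val + 1 = j.val then -dd S N p ε (i + 1) θ
    else 0

variable {N}

/-- The components of a vector `v = (v_1, …, v_N)`, indexed from `1`, with `v_0 = -v_1`.
(The value at `N + 1` is a dummy: it is only ever multiplied by `k_{N+1} = 0`.) -/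
def comp (v : Fin N → ℝ) (j : ℕ) : ℝ :=
  reflect (fun i => if h : i - 1 < N then v ⟨i - 1, h⟩ else 0) j

/-- The quadratic remainder `e^{-√2 β t} - 1 + √2 β t`. -/
def expRem (θ t : ℝ) : ℝ :=
  Real.exp (-(Real.sqrt 2 * S.β θ * t)) - 1 + Real.sqrt 2 * S.β θ * t

/-- The nonlinearity `𝒥` evaluated at the vector `v` at the point `θ`. -/
def J (ε θ : ℝ) (v : Fin N → ℝ) : Fin N → ℝ := fun i =>
  -(6 * Real.sqrt 2 * S.β θ * γ₁ S N p ε (i + 1) θ * kCoef S N p ε (i + 1) θ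
      * expRem S θ (comp v (i + 1) - comp v i))
    + 6 * Real.sqrt 2 * S.β θ * γ₂ S N p ε (i + 1) θ * kCoef S N p ε (i + 2) θ
      * expRem S θ (comp v (i + 2) - comp v (i + 1))

end Coefficients

/-- Bounded in `C²(ℝ/ℓℤ)` uniformly in `ε`. -/
def UniformC2 (ℓ ε₀ K : ℝ) (g : ℝ → ℝ → ℝ) : Prop :=
  ∀ ε ∈ Ioo 0 ε₀, ContDiff ℝ 2 (g ε) ∧ Function.Periodic (g ε) ℓ ∧
    ∀ m ≤ 2, ∀ θ, |iteratedDeriv m (g ε) θ| ≤ K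

/-- Lipschitz in `√ε`, uniformly in `θ`. -/
def LipschitzInSqrt (ε₀ K : ℝ) (g : ℝ → ℝ → ℝ) : Prop :=
  ∀ ε ∈ Ioo 0 ε₀, ∀ ε' ∈ Ioo 0 ε₀, ∀ θ, |g ε θ - g ε' θ| ≤ K * |Real.sqrt ε - Real.sqrt ε'|

/-- The requirements on the parameters, for `0 < ε < ε₀`. -/
structure Params.Admissible (S : Setting) (N : ℕ) (p : Params) (ε₀ δ₀ δ K : ℝ) : Prop where
  χ_measurable : ∀ ε ∈ Ioo 0 ε₀, ∀ j ∈ Finset.Icc 1 N, ∀ θ, Measurable fun s => p.χ ε j s θ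
  χ_mem : ∀ ε ∈ Ioo 0 ε₀, ∀ j ∈ Finset.Icc 1 N, ∀ s θ, p.χ ε j s θ ∈ Icc (0 : ℝ) 1
  /-- `χ_j = 1` between the midpoints to the two neighbouring layers. -/
  χ_eq_one : ∀ ε ∈ Ioo 0 ε₀, ∀ j ∈ Finset.Icc 1 N, ∀ s θ, 0 < s → s < δ₀ / ε →
    mid S N p ε j θ ≤ s → (j < N → s ≤ mid S N p ε (j + 1) θ) → p.χ ε j s θ = 1
  /-- `χ_j = 0` outside a slightly larger set. -/
  χ_support : ∀ ε ∈ Ioo 0 ε₀, ∀ j ∈ Finset.Icc 1 N, ∀ s θ, p.χ ε j s θ ≠ 0 →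
    mid S N p ε j θ - δ ≤ s ∧ (j < N → s ≤ mid S N p ε (j + 1) θ + δ)
  γ₁_C2 : ∀ j ∈ Finset.Icc 1 N, UniformC2 S.ℓ ε₀ K fun ε => γ₁ S N p ε j
  γ₂_C2 : ∀ j ∈ Finset.Icc 1 N, UniformC2 S.ℓ ε₀ K fun ε => γ₂ S N p ε j
  γ₁_lip : ∀ j ∈ Finset.Icc 1 N, LipschitzInSqrt ε₀ K fun ε => γ₁ S N p ε j
  γ₂_lip : ∀ j ∈ Finset.Icc 1 N, LipschitzInSqrt ε₀ K fun ε => γ₂ S N p ε j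
  /-- The algebraic system that determines `fbar`. -/
  fbar_eq : ∀ ε ∈ Ioo 0 ε₀, ∀ j ∈ Finset.Icc 1 N, ∀ θ,
    2 * Real.sqrt 2 / 3 * S.k θ - Real.sqrt 2 / 3 * (S.β₁ θ / S.β θ ^ 2) =
      6 * Real.sqrt 2 * S.β θ ^ 2 *
        (((N : ℝ) - j + 1) * γ₁ S N p ε j θ * Real.exp (-(Real.sqrt 2 * S.β θ *
            (p.fbar ε j θ - reflect (fun i => p.fbar ε i θ) (j - 1))))
          - ((N : ℝ) - j) * γ₂ S N p ε j θ * Real.exp (-(Real.sqrt 2 * S.β θ *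
            (p.fbar ε (j + 1) θ - p.fbar ε j θ))))
  fbar_bound : ∀ ε ∈ Ioo 0 ε₀, ∀ j ∈ Finset.Icc 1 N, ∀ θ, |p.fbar ε j θ| ≤ K
  fcheck_bound : ∀ ε ∈ Ioo 0 ε₀, ∀ j ∈ Finset.Icc 1 N, ∀ θ, |p.fcheck ε j θ| ≤ K * Real.sqrt ε
  fcheck_C2 : ∀ j ∈ Finset.Icc 1 N, UniformC2 S.ℓ ε₀ K fun ε => p.fcheck ε j
  fcheck_lip : ∀ j ∈ Finset.Icc 1 N, LipschitzInSqrt ε₀ K fun ε => p.fcheck ε j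
  D_C2 : ∀ j ∈ Finset.Icc 1 N, UniformC2 S.ℓ ε₀ K fun ε => p.D ε j

/-- The columns of `P θ` are unit eigenvectors of `B θ` forming a basis, for the eigenvalues
`ρ θ 0 ≥ ρ θ 1 ≥ …`, and they are twice continuously differentiable in `θ`. -/
structure IsEigenframe (S : Setting) (N : ℕ) (p : Params) (ε : ℝ)
    (P : ℝ → Matrix (Fin N) (Fin N) ℝ) (ρ : ℝ → Fin N → ℝ) : Prop where
  contDiff : ∀ i j, ContDiff ℝ 2 fun θ => P θ i j
  unit_col : ∀ θ j, ∑ i, P θ i j ^ 2 = 1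
  isUnit : ∀ θ, IsUnit (P θ)
  eigen : ∀ θ, B S N p ε θ * P θ = P θ * Matrix.diagonal (ρ θ)
  antitone : ∀ θ, Antitone (ρ θ)

section System

variable {N : ℕ}

/-- Entrywise derivative of order `m` of a matrix function. -/
def matDeriv (m : ℕ) (P : ℝ → Matrix (Fin N) (Fin N) ℝ) (θ : ℝ) : Matrix (Fin N) (Fin N) ℝ :=
  Matrix.of fun i j => iteratedDeriv m (fun t => P t i j) θ

/-- `ℭ = (P⁻¹ 𝔇)_n / ρ_n`. -/
def frakC (p : Params) (ε : ℝ) (P : ℝ → Matrix (Fin N) (Fin N) ℝ) (ρ : ℝ → Fin N → ℝ)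
    (i : Fin N) (θ : ℝ) : ℝ :=
  ((P θ)⁻¹.mulVec fun j => p.D ε (j + 1) θ) i / ρ θ i

/-- `P⁻¹ 𝒥(P y)`. -/
def Jtilde (S : Setting) (p : Params) (ε : ℝ) (P : ℝ → Matrix (Fin N) (Fin N) ℝ)
    (θ : ℝ) (y : Fin N → ℝ) : Fin N → ℝ :=
  (P θ)⁻¹.mulVec (J S p ε θ ((P θ).mulVec y))

/-- `W(y) = P⁻¹ P'' y + 2 P⁻¹ P' y'`, so that `P⁻¹ (P y)'' = y'' + W(y)`; `y'` is the third
vector argument. -/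
def W (P : ℝ → Matrix (Fin N) (Fin N) ℝ) (θ : ℝ) (y y' : Fin N → ℝ) : Fin N → ℝ :=
  (P θ)⁻¹.mulVec ((matDeriv 2 P θ).mulVec y) + (2 : ℝ) • (P θ)⁻¹.mulVec ((matDeriv 1 P θ).mulVec y')

/-- `u ∈ H²(0, ℓ)` with first and second derivatives `u'` and `u''`: the function is represented
by its continuously differentiable version on `[0, ℓ]`, and `u''` is square integrable. -/
structure IsH2 (ℓ : ℝ) (u u' u'' : ℝ → EuclideanSpace ℝ (Fin N)) : Prop where
  memLp : MemLp u'' 2 (volume.restrict (Ioo 0 ℓ))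
  deriv_eq : ∀ θ ∈ Icc 0 ℓ, u' θ = u' 0 + ∫ t in (0 : ℝ)..θ, u'' t
  eq : ∀ θ ∈ Icc 0 ℓ, u θ = u 0 + ∫ t in (0 : ℝ)..θ, u' t

/-- `L^q(0, ℓ)` norm of a vector function. -/
def lpNorm (q : ENNReal) (ℓ : ℝ) (g : ℝ → EuclideanSpace ℝ (Fin N)) : ℝ :=
  (eLpNorm g q (volume.restrict (Ioo 0 ℓ))).toReal

/-- `u`, with derivatives `u'`, `u''`, is an `H²` solution of the nonlinear periodic problem with
right-hand side `h`. -/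
structure IsSolution (S : Setting) (p : Params) (ε : ℝ)
    (P : ℝ → Matrix (Fin N) (Fin N) ℝ) (ρ : ℝ → Fin N → ℝ)
    (h u u' u'' : ℝ → EuclideanSpace ℝ (Fin N)) : Prop where
  isH2 : IsH2 S.ℓ u u' u''
  equation : ∀ᵐ θ ∂(volume.restrict (Ioo 0 S.ℓ)), ∀ i,
    -(ε * γ₀ * u'' θ i) - ρ θ i * u θ i =
      Jtilde S p ε P θ (fun j => u θ j + ε * |Real.log ε| * frakC p ε P ρ j θ) i
      + ε * γ₀ * W P θ (fun j => u θ j + ε * |Real.log ε| * frakC p ε P ρ j θ)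
          (fun j => u' θ j + ε * |Real.log ε| * deriv (frakC p ε P ρ j) θ) i
      + ε ^ 2 * |Real.log ε| * γ₀ * iteratedDeriv 2 (frakC p ε P ρ i) θ
      + h θ i
  periodic : u 0 = u S.ℓ
  periodic_deriv : u' 0 = u' S.ℓ

end System

end BoundaryLayers

end

noncomputable section

namespace BoundaryLayers

/-! ### Product rule for primitives of integrable functions -/

section ProductRule

/-! Divided by `-γ₀`, the problem reads ε (u'' + 2 P⁻¹P' u') + diag(ρ/γ₀) u = F(θ, u) - h/γ₀, where
the part of `W` that contains u' has been moved to the left. All ρ_n are positive, so the n-th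
component oscillates with the fast frequency ϖ_n/√ε, where ϖ_n = √(ρ_n/γ₀). The periodic problem can
be solved with good bounds only away from resonances, which is why a sequence of ε appears.

Linear core. Put s = √ε and z_n = ϖ_n u_n - i s u_n'. Then z_n' = (iϖ_n/s + r_n) z_n + Σ_m (a_nm z_m
+ b_nm conj z_m) + data/s. Each decoupled scalar equation is inverted periodically with a bound
independent of s, as long as |sin ∫ϖ_n/s| stays above a constant. The coupling is of order one and
not small, but it does not resonate: relative to the n-th oscillation, z_m and conj z_m carry the
frequencies (ϖ_m - ϖ_n)/s and -(ϖ_m + ϖ_n)/s. Integration by parts (`norm_integral_oscillating_le`)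
therefore shows that the operator "couple, then invert" has a square of size O(s)
(`norm_sol_coupling_sol_le`). A contraction argument for operators with small square
(`exists_fixedPoint_of_small_square`) absorbs the coupling and the nonlinearity together.

Spectrum. The argument needs frequency gaps and C² bounds for the frame that are uniform in ε. The
matrix is tridiagonal and is symmetrized by positive weights; an eigenvector is controlled by its
first component. This gives a quantitative gap (`IsFrame.exists_gap`), a positive lower bound for ρ,
an explicit inverse of P, and, by a bootstrap on P⁻¹P', the C² bounds (`FrameFamily.uc`). The
ordered eigenvalues are Lipschitz in the entries (`IsFrame.exists_lipschitz`), hence Lipschitz in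
√ε. The matrix entries are bounded below because the curvature assumption and the algebraic system
force γ₁ away from zero, while γ₂ is bounded below by integrating over a window around the layer.

Choice of ε. In the variable 1/√ε each phase grows at a definite rate, so among N + 1 nearby equally
spaced values at least one is good for all N frequencies (`exists_nonresonant`).

Sizes. The solver loses a factor ε^(-1/2). Since the nonlinearity is quadratic, the shift by ε|ln
ε|ℭ produces errors (ε|ln ε|)² and ε²|ln ε|, which are below ε^(1+σ) because σ < 1. On a ball of
radius about ε^(1/2+σ) the Lipschitz constant of F is of order ε^(1/2+σ) + ε|ln ε| + ε, negligible
against √ε because σ > 0. Finally u'' is estimated from the equation itself. -/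

theorem real_mul_primitive {A A' g : ℝ → ℝ} (hA : ∀ x, HasDerivAt A (A' x) x)
    (hA' : Continuous A') {θ : ℝ} (hg : IntervalIntegrable g volume 0 θ) :
    A θ * (∫ t in (0 : ℝ)..θ, g t)
      = ∫ t in (0 : ℝ)..θ, (A' t * (∫ τ in (0 : ℝ)..t, g τ) + A t * g t) := by
  have hd : deriv A = A' := funext fun x => (hA x).deriv
  have hAC : ContDiff ℝ 1 A := by
    rw [contDiff_one_iff_deriv]
    exact ⟨fun x => (hA x).differentiableAt, hd ▸ hA'⟩
  have h1 := hAC.contDiffOn (s := uIcc 0 θ) |>.absolutelyContinuousOnInterval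
  have h2 := hg.absolutelyContinuousOnInterval_intervalIntegral (c := 0) (by simp)
  -- Both factors are absolutely continuous, so integration by parts is legitimate although the
  -- derivative of the primitive is known to be `g` only almost everywhere.
  have h3 := h1.integral_deriv_mul_eq_sub h2
  simp only [intervalIntegral.integral_same, mul_zero, sub_zero] at h3
  rw [← h3]
  apply intervalIntegral.integral_congr_ae
  filter_upwards [hg.ae_hasDerivAt_integral] with x hx hx'
  rw [(hx (uIoc_subset_uIcc hx') 0 (by simp)).deriv, hd]

/-- A real-linear functional `T` commutes with the real factors and the integrals, so the identity
reduces to the real product rule; the functionals Re and Im separate points. -/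
theorem real_smul_primitive {A A' : ℝ → ℝ} {g : ℝ → ℂ} (hA : ∀ x, HasDerivAt A (A' x) x)
    (hA' : Continuous A') {θ : ℝ} (hg : IntervalIntegrable g volume 0 θ) :
    (A θ : ℂ) * (∫ t in (0 : ℝ)..θ, g t)
      = ∫ t in (0 : ℝ)..θ, ((A' t : ℂ) * (∫ τ in (0 : ℝ)..t, g τ) + A t * g t) := by
  have hAc : Continuous A := continuous_iff_continuousAt.2 fun x => (hA x).continuousAt
  have hsub : ∀ t ∈ uIcc 0 θ, IntervalIntegrable g volume 0 t := fun t ht =>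
    hg.mono_set (uIcc_subset_uIcc left_mem_uIcc ht)
  have hprim : ContinuousOn (fun t => ∫ τ in (0 : ℝ)..t, g τ) (uIcc 0 θ) :=
    intervalIntegral.continuousOn_primitive_interval'
      hg left_mem_uIcc
  have hinteg : IntervalIntegrable
      (fun t => (A' t : ℂ) * (∫ τ in (0 : ℝ)..t, g τ) + A t * g t) volume 0 θ := by
    refine IntervalIntegrable.add ?_ ?_
    · exact (((Complex.continuous_ofReal.comp hA').continuousOn).mul hprim).intervalIntegrable
    · exact hg.continuousOn_mul (Complex.continuous_ofReal.comp hAc).continuousOn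
  have key : ∀ T : ℂ →L[ℝ] ℝ,
      T ((A θ : ℂ) * (∫ t in (0 : ℝ)..θ, g t)) = T (∫ t in (0 : ℝ)..θ,
        ((A' t : ℂ) * (∫ τ in (0 : ℝ)..t, g τ) + A t * g t)) := by
    intro T
    have hT : ∀ (a : ℝ) (w : ℂ), T ((a : ℂ) * w) = a * T w := fun a w => by
      rw [← Complex.real_smul, map_smul, smul_eq_mul]
    have hTg : IntervalIntegrable (fun t => T (g t)) volume 0 θ :=
      ⟨T.integrable_comp hg.1, T.integrable_comp hg.2⟩
    rw [hT, ← T.intervalIntegral_comp_comm hg, ← T.intervalIntegral_comp_comm hinteg,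
      real_mul_primitive hA hA' hTg]
    apply intervalIntegral.integral_congr
    intro t ht
    simp only [map_add, hT]
    rw [T.intervalIntegral_comp_comm (hsub t ht)]
  exact Complex.ext (key Complex.reCLM) (key Complex.imCLM)

/-- Product rule for a `C¹` function and a primitive of an integrable function. -/
theorem mul_primitive {A A' g : ℝ → ℂ} (hA : ∀ x, HasDerivAt A (A' x) x)
    (hA' : Continuous A') {θ : ℝ} (hg : IntervalIntegrable g volume 0 θ) :
    A θ * (∫ t in (0 : ℝ)..θ, g t)
      = ∫ t in (0 : ℝ)..θ, (A' t * (∫ τ in (0 : ℝ)..t, g τ) + A t * g t) := by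
  have hAc : Continuous A := continuous_iff_continuousAt.2 fun x => (hA x).continuousAt
  have hr := real_smul_primitive (fun x => (Complex.reCLM.hasFDerivAt.comp_hasDerivAt x (hA x)))
    (Complex.continuous_re.comp hA') hg
  have hi := real_smul_primitive (fun x => (Complex.imCLM.hasFDerivAt.comp_hasDerivAt x (hA x)))
    (Complex.continuous_im.comp hA') hg
  have hprim : ContinuousOn (fun t => ∫ τ in (0 : ℝ)..t, g τ) (uIcc 0 θ) :=
    intervalIntegral.continuousOn_primitive_interval' hg left_mem_uIcc
  have hinteg : ∀ {a a' : ℝ → ℝ}, Continuous a → Continuous a' → IntervalIntegrable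
      (fun t => (a' t : ℂ) * (∫ τ in (0 : ℝ)..t, g τ) + a t * g t) volume 0 θ := by
    intro a a' ha ha'
    refine IntervalIntegrable.add ?_ ?_
    · exact (((Complex.continuous_ofReal.comp ha').continuousOn).mul hprim).intervalIntegrable
    · exact hg.continuousOn_mul (Complex.continuous_ofReal.comp ha).continuousOn
  have h1 : A θ * (∫ t in (0 : ℝ)..θ, g t) = ((A θ).re : ℂ) * (∫ t in (0 : ℝ)..θ, g t)
      + Complex.I * (((A θ).im : ℂ) * (∫ t in (0 : ℝ)..θ, g t)) := by
    conv_lhs => rw [← Complex.re_add_im (A θ)]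
    ring
  rw [h1]
  have i1 := hinteg (Complex.continuous_re.comp hAc) (Complex.continuous_re.comp hA')
  have i2 := (hinteg (Complex.continuous_im.comp hAc) (Complex.continuous_im.comp hA')).const_mul
    Complex.I
  simp only [Function.comp_def, Complex.reCLM_apply, Complex.imCLM_apply] at hr hi i1 i2
  rw [hr, hi, ← intervalIntegral.integral_const_mul, ← intervalIntegral.integral_add i1 i2]
  apply intervalIntegral.integral_congr
  intro t _
  simp only
  conv_rhs => rw [← Complex.re_add_im (A t), ← Complex.re_add_im (A' t)]
  ring

end ProductRule

/-! ### Contraction for a linear part with small square -/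

section FixedPoint

/-- If `K` is linear with small square and `Φ` is a small Lipschitz perturbation, then
`x = K x + Φ x` is solvable. -/
theorem exists_fixedPoint_of_small_square {E : Type*} [NormedAddCommGroup E] [CompleteSpace E]
    (K Φ : E → E) {c A q R : ℝ} (hc : 0 ≤ c) (hA : 0 ≤ A)
    (hKsub : ∀ x y, K (x - y) = K x - K y) (hK : ∀ x, ‖K x‖ ≤ c * ‖x‖)
    (hKK : ∀ x, ‖K (K x)‖ ≤ 1 / 4 * ‖x‖) (hΦ0 : ‖Φ 0‖ ≤ A)
    (hΦ : ∀ x y, ‖x‖ ≤ R → ‖y‖ ≤ R → ‖Φ x - Φ y‖ ≤ q * ‖x - y‖)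
    (hq : (1 + c) * q ≤ 1 / 4) (hR : 2 * (1 + c) * A ≤ R) :
    ∃ x, ‖x‖ ≤ 2 * (1 + c) * A ∧ x = K x + Φ x := by
  set ρ := 2 * (1 + c) * A with hρ
  have hρ0 : 0 ≤ ρ := by positivity
  have hK0 : K 0 = 0 := by simpa using hKsub 0 0
  have hKadd : ∀ x y, K (x + y) = K x + K y := fun x y => by
    have h1 := hKsub (x + y) y
    rw [add_sub_cancel_right] at h1
    rw [h1]; abel
  -- Inserting x = K x + Φ x once into its own linear term replaces K, which is merely bounded, by
  -- its small square. The modified equation is a contraction.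
  let Ψ : E → E := fun x => K (K x) + K (Φ x) + Φ x
  have hlip : ∀ x ∈ Metric.closedBall (0 : E) ρ, ∀ y ∈ Metric.closedBall (0 : E) ρ,
      ‖Ψ x - Ψ y‖ ≤ 1 / 2 * ‖x - y‖ := by
    intro x hx y hy
    rw [mem_closedBall_zero_iff] at hx hy
    have e : Ψ x - Ψ y = K (K (x - y)) + K (Φ x - Φ y) + (Φ x - Φ y) := by
      simp only [Ψ, hKsub]; abel
    have h1 := hΦ x y (hx.trans hR) (hy.trans hR)
    calc ‖Ψ x - Ψ y‖ ≤ ‖K (K (x - y))‖ + ‖K (Φ x - Φ y)‖ + ‖Φ x - Φ y‖ := by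
          rw [e]; exact norm_add₃_le
      _ ≤ 1 / 4 * ‖x - y‖ + c * ‖Φ x - Φ y‖ + ‖Φ x - Φ y‖ := by
          gcongr
          · exact hKK _
          · exact hK _
      _ = 1 / 4 * ‖x - y‖ + (1 + c) * ‖Φ x - Φ y‖ := by ring
      _ ≤ 1 / 4 * ‖x - y‖ + (1 + c) * (q * ‖x - y‖) := by gcongr
      _ = 1 / 4 * ‖x - y‖ + ((1 + c) * q) * ‖x - y‖ := by ring
      _ ≤ 1 / 4 * ‖x - y‖ + (1 / 4) * ‖x - y‖ := by gcongr
      _ = 1 / 2 * ‖x - y‖ := by ring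
  have hΨ0 : ‖Ψ 0‖ ≤ ρ / 2 := by
    have e : Ψ 0 = K (Φ 0) + Φ 0 := by simp [Ψ, hK0]
    rw [e]
    calc _ ≤ ‖K (Φ 0)‖ + ‖Φ 0‖ := norm_add_le _ _
      _ ≤ c * ‖Φ 0‖ + ‖Φ 0‖ := by gcongr; exact hK _
      _ = (1 + c) * ‖Φ 0‖ := by ring
      _ ≤ (1 + c) * A := by gcongr
      _ = ρ / 2 := by rw [hρ]; ring
  have hmaps : MapsTo Ψ (Metric.closedBall 0 ρ) (Metric.closedBall 0 ρ) := by
    intro x hx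
    have h1 := hlip x hx 0 (by simpa using hρ0)
    rw [mem_closedBall_zero_iff] at hx ⊢
    rw [sub_zero] at h1
    have h2 : ‖Ψ x‖ ≤ ‖Ψ x - Ψ 0‖ + ‖Ψ 0‖ := by
      simpa using norm_add_le (Ψ x - Ψ 0) (Ψ 0)
    linarith
  have hcontr : ContractingWith (1 / 2 : NNReal) (hmaps.restrict Ψ _ _) := by
    refine ⟨by norm_num [← NNReal.coe_lt_coe], LipschitzWith.of_dist_le_mul ?_⟩
    rintro ⟨x, hx⟩ ⟨y, hy⟩
    rw [Subtype.dist_eq, Subtype.dist_eq, dist_eq_norm, dist_eq_norm]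
    simpa using hlip x hx y hy
  obtain ⟨x, hx, hfix, -⟩ := hcontr.exists_fixedPoint'
    (Metric.isClosed_closedBall.isComplete) hmaps (x := 0) (by simpa using hρ0) (edist_ne_top _ _)
  have hxρ : ‖x‖ ≤ ρ := by simpa using hx
  refine ⟨x, hxρ, ?_⟩
  have hfix' : K (K x) + K (Φ x) + Φ x = x := hfix
  -- Back to the original equation: the fixed point of Ψ satisfies x = K w + Φ x, so w - x = K (x -
  -- w). Applying this twice makes w - x a fixed point of K², hence zero.
  set w := K x + Φ x with hw
  have h1 : x = K w + Φ x := by rw [hw, hKadd]; exact hfix'.symm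
  have h2 : w - x = K (x - w) := by
    have e : w - x = (K x + Φ x) - (K w + Φ x) := congrArg₂ (· - ·) hw h1
    rw [hKsub, e]; abel
  have h3 : x - w = K (w - x) := by
    have e : K (w - x) = -K (x - w) := by rw [hKsub, hKsub]; abel
    rw [e, ← h2]; abel
  have h4 : w - x = K (K (w - x)) := by rw [← h3]; exact h2
  have h5 := hKK (w - x)
  rw [← h4] at h5
  have h6 : ‖w - x‖ = 0 := by
    have := norm_nonneg (w - x); linarith
  exact (sub_eq_zero.1 (norm_eq_zero.1 h6)).symm

end FixedPoint

/-! ### Periodic solutions of scalar linear equations -/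

section ScalarPeriodic

/-- The primitive of `p` that vanishes at `0`. -/
def phase (p : ℝ → ℂ) (θ : ℝ) : ℂ := ∫ t in (0 : ℝ)..θ, p t

theorem phase_hasDerivAt {p : ℝ → ℂ} (hp : Continuous p) (θ : ℝ) :
    HasDerivAt (phase p) (p θ) θ :=
  intervalIntegral.integral_hasDerivAt_right (hp.intervalIntegrable _ _)
    (hp.stronglyMeasurableAtFilter _ _) hp.continuousAt

theorem phase_continuous {p : ℝ → ℂ} (hp : Continuous p) : Continuous (phase p) :=
  continuous_iff_continuousAt.2 fun θ => (phase_hasDerivAt hp θ).continuousAt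

theorem phase_zero (p : ℝ → ℂ) : phase p 0 = 0 := by simp [phase]

theorem phase_re {p : ℝ → ℂ} (hp : Continuous p) (θ : ℝ) :
    (phase p θ).re = ∫ t in (0 : ℝ)..θ, (p t).re :=
  (Complex.reCLM.intervalIntegral_comp_comm (hp.intervalIntegrable 0 θ)).symm

theorem phase_im {p : ℝ → ℂ} (hp : Continuous p) (θ : ℝ) :
    (phase p θ).im = ∫ t in (0 : ℝ)..θ, (p t).im :=
  (Complex.imCLM.intervalIntegral_comp_comm (hp.intervalIntegrable 0 θ)).symm

theorem abs_phase_re_le {p : ℝ → ℂ} (hp : Continuous p) {ℓ Λ : ℝ} (hΛ : ∀ θ, |(p θ).re| ≤ Λ)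
    {θ : ℝ} (hθ : θ ∈ Icc 0 ℓ) : |(phase p θ).re| ≤ Λ * ℓ := by
  rw [phase_re hp]
  have h1 := intervalIntegral.norm_integral_le_of_norm_le_const (a := 0) (b := θ) (C := Λ)
    (f := fun t => (p t).re) (fun t _ => by simpa using hΛ t)
  have hΛ0 : 0 ≤ Λ := (abs_nonneg _).trans (hΛ 0)
  rw [Real.norm_eq_abs, sub_zero, abs_of_nonneg hθ.1] at h1
  exact h1.trans (by gcongr; exact hθ.2)

theorem norm_exp_phase_le {p : ℝ → ℂ} (hp : Continuous p) {ℓ Λ : ℝ} (hΛ : ∀ θ, |(p θ).re| ≤ Λ)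
    {θ : ℝ} (hθ : θ ∈ Icc 0 ℓ) : ‖Complex.exp (phase p θ)‖ ≤ Real.exp (Λ * ℓ) := by
  rw [Complex.norm_exp]
  exact Real.exp_le_exp.2 ((le_abs_self _).trans (abs_phase_re_le hp hΛ hθ))

theorem norm_exp_neg_phase_le {p : ℝ → ℂ} (hp : Continuous p) {ℓ Λ : ℝ}
    (hΛ : ∀ θ, |(p θ).re| ≤ Λ) {θ : ℝ} (hθ : θ ∈ Icc 0 ℓ) :
    ‖Complex.exp (-phase p θ)‖ ≤ Real.exp (Λ * ℓ) := by
  rw [Complex.norm_exp, Complex.neg_re]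
  exact Real.exp_le_exp.2 ((neg_le_abs _).trans (abs_phase_re_le hp hΛ hθ))

/-- This converts non-resonance of the total phase into a lower bound for the monodromy minus one,
whatever the real part (the damping) is. -/
theorem abs_sin_im_le_norm_exp_sub_one (w : ℂ) : |Real.sin w.im| ≤ ‖Complex.exp w - 1‖ := by
  have h : ‖Complex.exp w - 1‖ ^ 2
      = (Real.exp w.re - Real.cos w.im) ^ 2 + Real.sin w.im ^ 2 := by
    rw [← Complex.normSq_eq_norm_sq, Complex.normSq_apply, Complex.sub_re, Complex.sub_im,
      Complex.exp_re, Complex.exp_im, Complex.one_re, Complex.one_im]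
    linear_combination (Real.exp w.re ^ 2 - 1) * Real.sin_sq_add_cos_sq w.im
  refine abs_le_of_sq_le_sq ?_ (norm_nonneg _)
  rw [h]; nlinarith [sq_nonneg (Real.exp w.re - Real.cos w.im)]

/-- The periodic solution of `y' = p y + g` on `[0, ℓ]`. -/
def perSol (ℓ : ℝ) (p g : ℝ → ℂ) (θ : ℝ) : ℂ :=
  Complex.exp (phase p θ) *
    ((Complex.exp (-phase p ℓ) - 1)⁻¹ * (∫ t in (0 : ℝ)..ℓ, Complex.exp (-phase p t) * g t)
      + ∫ t in (0 : ℝ)..θ, Complex.exp (-phase p t) * g t)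

variable {ℓ : ℝ} {p g : ℝ → ℂ}

theorem exp_neg_phase_continuous (hp : Continuous p) :
    Continuous fun t => Complex.exp (-phase p t) :=
  Complex.continuous_exp.comp (phase_continuous hp).neg

theorem intervalIntegrable_exp_mul (hp : Continuous p) {a b : ℝ}
    (hg : IntervalIntegrable g volume a b) :
    IntervalIntegrable (fun t => Complex.exp (-phase p t) * g t) volume a b :=
  hg.continuousOn_mul (exp_neg_phase_continuous hp).continuousOn

theorem perSol_continuousOn (hℓ : 0 ≤ ℓ) (hp : Continuous p)
    (hg : IntervalIntegrable g volume 0 ℓ) : ContinuousOn (perSol ℓ p g) (Icc 0 ℓ) := by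
  have h := intervalIntegral.continuousOn_primitive_interval'
    (intervalIntegrable_exp_mul hp hg) left_mem_uIcc
  rw [uIcc_of_le hℓ] at h
  exact (Complex.continuous_exp.comp (phase_continuous hp)).continuousOn.mul
    (continuousOn_const.add h)

theorem perSol_periodic (h1 : Complex.exp (-phase p ℓ) - 1 ≠ 0) :
    perSol ℓ p g 0 = perSol ℓ p g ℓ := by
  simp only [perSol, phase_zero, Complex.exp_zero, intervalIntegral.integral_same, add_zero,
    one_mul]
  have h2 : Complex.exp (phase p ℓ) * Complex.exp (-phase p ℓ) = 1 := by
    rw [← Complex.exp_add]; simp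
  set I := ∫ t in (0 : ℝ)..ℓ, Complex.exp (-phase p t) * g t
  have h3 : (Complex.exp (-phase p ℓ) - 1)⁻¹ * I + I
      = Complex.exp (-phase p ℓ) * ((Complex.exp (-phase p ℓ) - 1)⁻¹ * I) := by
    have : (Complex.exp (-phase p ℓ) - 1) * (Complex.exp (-phase p ℓ) - 1)⁻¹ = 1 :=
      mul_inv_cancel₀ h1
    linear_combination -I * this
  rw [h3, ← mul_assoc, h2, one_mul]

/-- For merely integrable forcing the differential equation is available only in integrated form.
The homogeneous part is an ordinary primitive; the remaining part is the product rule for e^phase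
times a primitive. -/
theorem perSol_eq_integral (hp : Continuous p) (hg : IntervalIntegrable g volume 0 ℓ)
    {θ : ℝ} (hθ : θ ∈ Icc 0 ℓ) :
    perSol ℓ p g θ = perSol ℓ p g 0 + ∫ t in (0 : ℝ)..θ, (p t * perSol ℓ p g t + g t) := by
  have hgθ : IntervalIntegrable g volume 0 θ := hg.mono_set
    (uIcc_subset_uIcc left_mem_uIcc (by rwa [uIcc_of_le (hθ.1.trans hθ.2)]))
  have hE : ∀ x, HasDerivAt (fun t => Complex.exp (phase p t))
      (Complex.exp (phase p x) * p x) x := fun x => (phase_hasDerivAt hp x).cexp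
  have hEc : Continuous fun t => Complex.exp (phase p t) :=
    Complex.continuous_exp.comp (phase_continuous hp)
  have hE' : Continuous fun x => Complex.exp (phase p x) * p x := hEc.mul hp
  have hq := intervalIntegrable_exp_mul hp hgθ
  have h1 := mul_primitive hE hE' hq
  set κ := (Complex.exp (-phase p ℓ) - 1)⁻¹ * (∫ t in (0 : ℝ)..ℓ, Complex.exp (-phase p t) * g t)
    with hκ
  have h2 : Complex.exp (phase p θ) - 1 = ∫ t in (0 : ℝ)..θ, Complex.exp (phase p t) * p t := by
    rw [intervalIntegral.integral_eq_sub_of_hasDerivAt (fun x _ => hE x)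
      (hE'.intervalIntegrable _ _)]
    simp [phase_zero]
  have hprim : ContinuousOn (fun t => ∫ τ in (0 : ℝ)..t, Complex.exp (-phase p τ) * g τ)
      (uIcc 0 θ) := intervalIntegral.continuousOn_primitive_interval' hq left_mem_uIcc
  have h0 : perSol ℓ p g 0 = κ := by simp [perSol, phase_zero, hκ]
  have hθe : perSol ℓ p g θ = κ + (κ * (Complex.exp (phase p θ) - 1)
      + Complex.exp (phase p θ) * ∫ t in (0 : ℝ)..θ, Complex.exp (-phase p t) * g t) := by
    simp only [perSol, ← hκ]; ring
  rw [h0, hθe, h1, h2, ← intervalIntegral.integral_const_mul, ← intervalIntegral.integral_add]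
  · congr 1
    apply intervalIntegral.integral_congr
    intro t _
    have h3 : Complex.exp (phase p t) * Complex.exp (-phase p t) = 1 := by
      rw [← Complex.exp_add]; simp
    simp only [perSol, ← hκ]
    linear_combination g t * h3
  · exact (continuous_const.mul hE').intervalIntegrable _ _
  · exact (hE'.continuousOn.mul hprim).intervalIntegrable.add (hq.continuousOn_mul hEc.continuousOn)

theorem perSol_hasDerivAt (hp : Continuous p) (hg : Continuous g) (θ : ℝ) :
    HasDerivAt (perSol ℓ p g) (p θ * perSol ℓ p g θ + g θ) θ := by
  have hq : Continuous fun t => Complex.exp (-phase p t) * g t :=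
    (exp_neg_phase_continuous hp).mul hg
  have h1 : HasDerivAt (fun x => ∫ t in (0 : ℝ)..x, Complex.exp (-phase p t) * g t)
      (Complex.exp (-phase p θ) * g θ) θ :=
    intervalIntegral.integral_hasDerivAt_right (hq.intervalIntegrable _ _)
      (hq.stronglyMeasurableAtFilter _ _) hq.continuousAt
  have h2 := (phase_hasDerivAt hp θ).cexp.mul (h1.const_add ((Complex.exp (-phase p ℓ) - 1)⁻¹ *
    (∫ t in (0 : ℝ)..ℓ, Complex.exp (-phase p t) * g t)))
  convert! h2 using 1
  have h3 : Complex.exp (phase p θ) * Complex.exp (-phase p θ) = 1 := by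
    rw [← Complex.exp_add]; simp
  simp only [perSol]
  linear_combination -g θ * h3

/-- The bound uses the primitive of e^(-phase) g and not the size of g, so that cancellation in
oscillatory integrals is not lost. The fast imaginary part of `p` enters only through the
non-resonance constant `c`. -/
theorem norm_perSol_le (hp : Continuous p) {Λ c A : ℝ} (hΛ : ∀ θ, |(p θ).re| ≤ Λ) (hc : 0 < c)
    (hres : c ≤ |Real.sin (∫ t in (0 : ℝ)..ℓ, (p t).im)|)
    (hA : ∀ θ ∈ Icc 0 ℓ, ‖∫ t in (0 : ℝ)..θ, Complex.exp (-phase p t) * g t‖ ≤ A)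
    {θ : ℝ} (hθ : θ ∈ Icc 0 ℓ) :
    ‖perSol ℓ p g θ‖ ≤ Real.exp (Λ * ℓ) * (c⁻¹ + 1) * A := by
  have h1 : c ≤ ‖Complex.exp (-phase p ℓ) - 1‖ := by
    refine hres.trans ?_
    have := abs_sin_im_le_norm_exp_sub_one (-phase p ℓ)
    rwa [Complex.neg_im, Real.sin_neg, abs_neg, phase_im hp] at this
  have hA0 : 0 ≤ A := (norm_nonneg _).trans (hA θ hθ)
  rw [perSol, norm_mul]
  calc _ ≤ Real.exp (Λ * ℓ) * (c⁻¹ * A + A) := by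
        gcongr
        · exact norm_exp_phase_le hp hΛ hθ
        · refine (norm_add_le _ _).trans (add_le_add ?_ (hA θ hθ))
          rw [norm_mul, norm_inv]
          gcongr
          exact hA ℓ ⟨hθ.1.trans hθ.2, le_rfl⟩
    _ = _ := by ring

theorem norm_integral_exp_mul_le (hp : Continuous p) {Λ : ℝ} (hΛ : ∀ θ, |(p θ).re| ≤ Λ)
    (hg : IntervalIntegrable g volume 0 ℓ) {θ : ℝ} (hθ : θ ∈ Icc 0 ℓ) :
    ‖∫ t in (0 : ℝ)..θ, Complex.exp (-phase p t) * g t‖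
      ≤ Real.exp (Λ * ℓ) * ∫ t in (0 : ℝ)..ℓ, ‖g t‖ := by
  have hgθ : IntervalIntegrable g volume 0 θ := hg.mono_set
    (uIcc_subset_uIcc left_mem_uIcc (by rwa [uIcc_of_le (hθ.1.trans hθ.2)]))
  calc _ ≤ ∫ t in (0 : ℝ)..θ, ‖Complex.exp (-phase p t) * g t‖ :=
        intervalIntegral.norm_integral_le_integral_norm hθ.1
    _ ≤ ∫ t in (0 : ℝ)..θ, Real.exp (Λ * ℓ) * ‖g t‖ := by
        refine intervalIntegral.integral_mono_on hθ.1 (intervalIntegrable_exp_mul hp hgθ).norm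
          (hgθ.norm.const_mul _) fun t ht => ?_
        rw [norm_mul]
        gcongr
        exact norm_exp_neg_phase_le hp hΛ ⟨ht.1, ht.2.trans hθ.2⟩
    _ = Real.exp (Λ * ℓ) * ∫ t in (0 : ℝ)..θ, ‖g t‖ := intervalIntegral.integral_const_mul _ _
    _ ≤ _ := by
        gcongr
        exact intervalIntegral.integral_mono_interval le_rfl hθ.1 hθ.2
          (Eventually.of_forall fun t => norm_nonneg _) hg.norm

/-- Integration by parts against an oscillating function: if `Y' = (i κ / s + r) Y + F`, then the
primitive of `q κ Y` is of order `s`. -/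
theorem norm_integral_oscillating_le {s Λ A F₁ : ℝ} (hs : 0 < s)
    {κ r q q' : ℝ → ℝ} {Y F : ℝ → ℂ} (hκ : Continuous κ) (hr : Continuous r) (hF : Continuous F)
    (hY : ∀ θ, HasDerivAt Y ((Complex.I * (κ θ / s : ℝ) + r θ) * Y θ + F θ) θ)
    (hq : ∀ θ, HasDerivAt q (q' θ) θ) (hq' : Continuous q')
    (hqΛ : ∀ θ, |q θ| ≤ Λ) (hqΛ' : ∀ θ, |q' θ| ≤ Λ) (hrΛ : ∀ θ, |r θ| ≤ Λ)
    (hYA : ∀ θ ∈ Icc 0 ℓ, ‖Y θ‖ ≤ A) (hF₁ : ∀ θ ∈ Icc 0 ℓ, ‖F θ‖ ≤ F₁)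
    {θ : ℝ} (hθ : θ ∈ Icc 0 ℓ) :
    ‖∫ t in (0 : ℝ)..θ, ((q t * κ t : ℝ) : ℂ) * Y t‖
      ≤ s * (Λ * (2 * A + ℓ * (A + Λ * A + F₁))) := by
  have hYc : Continuous Y := continuous_iff_continuousAt.2 fun x => (hY x).continuousAt
  have hqc : Continuous q := continuous_iff_continuousAt.2 fun x => (hq x).continuousAt
  have hℓ : 0 ≤ ℓ := hθ.1.trans hθ.2
  have hΛ0 : 0 ≤ Λ := (abs_nonneg _).trans (hrΛ 0)
  have hA0 : 0 ≤ A := (norm_nonneg _).trans (hYA θ hθ)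
  have hF0 : 0 ≤ F₁ := (norm_nonneg _).trans (hF₁ θ hθ)
  -- `rest` is the derivative of q Y with its only large term, i (κ/s) q Y, removed.
  let rest : ℝ → ℂ := fun t => (q' t : ℂ) * Y t + (q t : ℂ) * ((r t : ℂ) * Y t + F t)
  have hrest : Continuous rest := by
    simp only [rest]
    fun_prop
  have hqY : ∀ x, HasDerivAt (fun t => (q t : ℂ) * Y t)
      ((q' x : ℂ) * Y x + (q x : ℂ) * ((Complex.I * (κ x / s : ℝ) + r x) * Y x + F x)) x :=
    fun x => (hq x).ofReal_comp.mul (hY x)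
  -- The identity (q Y)' = i (κ/s) q Y + rest is solved for q κ Y, without dividing by κ. The
  -- integrand is thus s times an exact derivative plus a bounded term. The boundary terms are kept,
  -- so no periodicity of q is needed.
  have hsplit : ∀ t, ((q t * κ t : ℝ) : ℂ) * Y t = -Complex.I * s *
      (((q' t : ℂ) * Y t + (q t : ℂ) * ((Complex.I * (κ t / s : ℝ) + r t) * Y t + F t))
        - rest t) := by
    intro t
    have hs' : (s : ℂ) ≠ 0 := by exact_mod_cast hs.ne'
    simp only [rest]
    push_cast
    field_simp
    linear_combination ((q t : ℂ) * κ t * Y t) * Complex.I_sq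
  have hderc : Continuous fun x => (q' x : ℂ) * Y x +
      (q x : ℂ) * ((Complex.I * (κ x / s : ℝ) + r x) * Y x + F x) := by fun_prop
  have hinteg : ∫ t in (0 : ℝ)..θ, ((q t * κ t : ℝ) : ℂ) * Y t = -Complex.I * s *
      (((q θ : ℂ) * Y θ - (q 0 : ℂ) * Y 0) - ∫ t in (0 : ℝ)..θ, rest t) := by
    simp_rw [hsplit]
    rw [intervalIntegral.integral_const_mul, intervalIntegral.integral_sub
      (hderc.intervalIntegrable _ _) (hrest.intervalIntegrable _ _),
      intervalIntegral.integral_eq_sub_of_hasDerivAt (fun x _ => hqY x)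
        (hderc.intervalIntegrable _ _)]
  have hb : ∀ t ∈ Icc 0 ℓ, ‖(q t : ℂ) * Y t‖ ≤ Λ * A := fun t ht => by
    rw [norm_mul, Complex.norm_real, Real.norm_eq_abs]
    exact mul_le_mul (hqΛ t) (hYA t ht) (norm_nonneg _) hΛ0
  have hrestb : ∀ t ∈ Icc 0 ℓ, ‖rest t‖ ≤ Λ * (A + Λ * A + F₁) := fun t ht => by
    have e1 : ‖(q' t : ℂ) * Y t‖ ≤ Λ * A := by
      rw [norm_mul, Complex.norm_real, Real.norm_eq_abs]
      exact mul_le_mul (hqΛ' t) (hYA t ht) (norm_nonneg _) hΛ0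
    have e2 : ‖(r t : ℂ) * Y t + F t‖ ≤ Λ * A + F₁ := by
      refine (norm_add_le _ _).trans (add_le_add ?_ (hF₁ t ht))
      rw [norm_mul, Complex.norm_real, Real.norm_eq_abs]
      exact mul_le_mul (hrΛ t) (hYA t ht) (norm_nonneg _) hΛ0
    have e3 : ‖(q t : ℂ) * ((r t : ℂ) * Y t + F t)‖ ≤ Λ * (Λ * A + F₁) := by
      rw [norm_mul, Complex.norm_real, Real.norm_eq_abs]
      exact mul_le_mul (hqΛ t) e2 (norm_nonneg _) hΛ0
    calc _ ≤ Λ * A + Λ * (Λ * A + F₁) := (norm_add_le _ _).trans (add_le_add e1 e3)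
      _ = _ := by ring
  have hrI : ‖∫ t in (0 : ℝ)..θ, rest t‖ ≤ ℓ * (Λ * (A + Λ * A + F₁)) := by
    have h1 := intervalIntegral.norm_integral_le_of_norm_le_const (a := 0) (b := θ)
      (f := rest) (C := Λ * (A + Λ * A + F₁)) (fun t ht => by
        rw [uIoc_of_le hθ.1] at ht
        exact hrestb t ⟨ht.1.le, ht.2.trans hθ.2⟩)
    rw [sub_zero, abs_of_nonneg hθ.1] at h1
    refine h1.trans ?_
    rw [mul_comm]
    gcongr
    exact hθ.2
  rw [hinteg, norm_mul, norm_mul, norm_neg, Complex.norm_I, one_mul, Complex.norm_real,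
    Real.norm_eq_abs, abs_of_pos hs]
  gcongr
  calc _ ≤ (‖(q θ : ℂ) * Y θ‖ + ‖(q 0 : ℂ) * Y 0‖) + ‖∫ t in (0 : ℝ)..θ, rest t‖ :=
        (norm_sub_le _ _).trans (add_le_add (norm_sub_le _ _) le_rfl)
    _ ≤ (Λ * A + Λ * A) + ℓ * (Λ * (A + Λ * A + F₁)) := by
        gcongr
        · exact hb θ hθ
        · exact hb 0 ⟨le_rfl, hℓ⟩
    _ = _ := by ring

end ScalarPeriodic

/-! ### Rapidly oscillating first order systems -/

section OscillatingSystem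

open scoped ComplexConjugate

theorem perSol_congr {ℓ : ℝ} {p g g' : ℝ → ℂ} (h : ∀ t ∈ Icc 0 ℓ, g t = g' t) {θ : ℝ}
    (hθ : θ ∈ Icc 0 ℓ) : perSol ℓ p g θ = perSol ℓ p g' θ := by
  have key : ∀ x ∈ Icc 0 ℓ, (∫ t in (0 : ℝ)..x, Complex.exp (-phase p t) * g t)
      = ∫ t in (0 : ℝ)..x, Complex.exp (-phase p t) * g' t := fun x hx => by
    apply intervalIntegral.integral_congr
    intro t ht
    rw [uIcc_of_le hx.1] at ht
    simp only [h t ⟨ht.1, ht.2.trans hx.2⟩]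
  rw [perSol, perSol, key θ hθ, key ℓ ⟨hθ.1.trans hθ.2, le_rfl⟩]

theorem perSol_sub {ℓ : ℝ} {p g g' : ℝ → ℂ} (hp : Continuous p)
    (hg : IntervalIntegrable g volume 0 ℓ) (hg' : IntervalIntegrable g' volume 0 ℓ) {θ : ℝ}
    (hθ : θ ∈ Icc 0 ℓ) :
    perSol ℓ p (fun t => g t - g' t) θ = perSol ℓ p g θ - perSol ℓ p g' θ := by
  have key : ∀ x ∈ Icc 0 ℓ, (∫ t in (0 : ℝ)..x, Complex.exp (-phase p t) * (g t - g' t))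
      = (∫ t in (0 : ℝ)..x, Complex.exp (-phase p t) * g t)
        - ∫ t in (0 : ℝ)..x, Complex.exp (-phase p t) * g' t := fun x hx => by
    have hsub : uIcc 0 x ⊆ uIcc 0 ℓ :=
      uIcc_subset_uIcc left_mem_uIcc (by rwa [uIcc_of_le (hx.1.trans hx.2)])
    rw [← intervalIntegral.integral_sub (intervalIntegrable_exp_mul hp (hg.mono_set hsub))
      (intervalIntegrable_exp_mul hp (hg'.mono_set hsub))]
    simp only [mul_sub]
  rw [perSol, perSol, perSol, key θ hθ, key ℓ ⟨hθ.1.trans hθ.2, le_rfl⟩]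
  ring

theorem norm_perSol_le_integral {ℓ : ℝ} {p g : ℝ → ℂ} (hp : Continuous p) {Λ c : ℝ}
    (hΛ : ∀ θ, |(p θ).re| ≤ Λ) (hc : 0 < c)
    (hres : c ≤ |Real.sin (∫ t in (0 : ℝ)..ℓ, (p t).im)|)
    (hg : IntervalIntegrable g volume 0 ℓ) {θ : ℝ} (hθ : θ ∈ Icc 0 ℓ) :
    ‖perSol ℓ p g θ‖
      ≤ Real.exp (Λ * ℓ) * (c⁻¹ + 1) * (Real.exp (Λ * ℓ) * ∫ t in (0 : ℝ)..ℓ, ‖g t‖) :=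
  norm_perSol_le hp hΛ hc hres (fun _ hx => norm_integral_exp_mul_le hp hΛ hg hx) hθ

theorem intervalIntegral_norm_le_const {ℓ A : ℝ} {g : ℝ → ℂ} (hℓ : 0 ≤ ℓ)
    (hA : ∀ t ∈ Icc 0 ℓ, ‖g t‖ ≤ A) : ∫ t in (0 : ℝ)..ℓ, ‖g t‖ ≤ ℓ * A := by
  have h := intervalIntegral.norm_integral_le_of_norm_le_const (a := 0) (b := ℓ)
      (f := fun t => ‖g t‖) (C := A) (fun t ht => by
        rw [uIoc_of_le hℓ] at ht
        simpa using hA t ⟨ht.1.le, ht.2⟩)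
  rw [sub_zero, abs_of_nonneg hℓ, mul_comm] at h
  exact (Real.le_norm_self _).trans h

variable {ι : Type*}

/-- The non-resonant coupling of the components of `z`. -/
def coupling [Fintype ι] (a b : ι → ι → ℝ → ℝ) (z : ℝ → ι → ℂ) (n : ι) (t : ℝ) : ℂ :=
  ∑ m, ((a n m t : ℂ) * z t m + (b n m t : ℂ) * conj (z t m))

/-- The coefficient `i ϖ / s + r` of the diagonal part. -/
def drift (s : ℝ) (ϖ r : ℝ → ℝ) (t : ℝ) : ℂ := Complex.I * (ϖ t / s : ℝ) + r t

theorem drift_re (s : ℝ) (ϖ r : ℝ → ℝ) (t : ℝ) : (drift s ϖ r t).re = r t := by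
  simp [drift]

theorem drift_im (s : ℝ) (ϖ r : ℝ → ℝ) (t : ℝ) : (drift s ϖ r t).im = ϖ t / s := by
  simp [drift]

theorem drift_continuous {s : ℝ} {ϖ r : ℝ → ℝ} (hϖ : Continuous ϖ) (hr : Continuous r) :
    Continuous (drift s ϖ r) := by
  unfold drift
  fun_prop

/-- Quantitative assumptions on a rapidly oscillating first order system on `[0, ℓ]`: the coupling
coefficients are `C¹` multiples of the differences of the frequencies, and no frequency is
resonant. -/
structure IsOscillating (ℓ s Λ c : ℝ) (ϖ r : ι → ℝ → ℝ) (a b qa qa' qb qb' : ι → ι → ℝ → ℝ) :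
    Prop where
  ϖ_cont : ∀ n, Continuous (ϖ n)
  r_cont : ∀ n, Continuous (r n)
  r_le : ∀ n t, |r n t| ≤ Λ
  a_le : ∀ n m t, |a n m t| ≤ Λ
  b_le : ∀ n m t, |b n m t| ≤ Λ
  a_eq : ∀ n m t, a n m t = qa n m t * (ϖ m t - ϖ n t)
  b_eq : ∀ n m t, b n m t = qb n m t * (-ϖ m t - ϖ n t)
  qa_deriv : ∀ n m t, HasDerivAt (qa n m) (qa' n m t) t
  qb_deriv : ∀ n m t, HasDerivAt (qb n m) (qb' n m t) t
  qa'_cont : ∀ n m, Continuous (qa' n m)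
  qb'_cont : ∀ n m, Continuous (qb' n m)
  qa_le : ∀ n m t, |qa n m t| ≤ Λ
  qb_le : ∀ n m t, |qb n m t| ≤ Λ
  qa'_le : ∀ n m t, |qa' n m t| ≤ Λ
  qb'_le : ∀ n m t, |qb' n m t| ≤ Λ
  nonres : ∀ n, c ≤ |Real.sin (∫ t in (0 : ℝ)..ℓ, ϖ n t / s)|

namespace IsOscillating

variable {ℓ s Λ c : ℝ} {ϖ r : ι → ℝ → ℝ} {a b qa qa' qb qb' : ι → ι → ℝ → ℝ}

theorem a_cont (h : IsOscillating ℓ s Λ c ϖ r a b qa qa' qb qb') (n m : ι) :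
    Continuous (a n m) := by
  have h1 : Continuous (qa n m) :=
    continuous_iff_continuousAt.2 fun x => (h.qa_deriv n m x).continuousAt
  rw [funext (h.a_eq n m)]
  exact h1.mul ((h.ϖ_cont m).sub (h.ϖ_cont n))

theorem b_cont (h : IsOscillating ℓ s Λ c ϖ r a b qa qa' qb qb') (n m : ι) :
    Continuous (b n m) := by
  have h1 : Continuous (qb n m) :=
    continuous_iff_continuousAt.2 fun x => (h.qb_deriv n m x).continuousAt
  rw [funext (h.b_eq n m)]
  exact h1.mul ((h.ϖ_cont m).neg.sub (h.ϖ_cont n))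

theorem drift_cont (h : IsOscillating ℓ s Λ c ϖ r a b qa qa' qb qb') (n : ι) :
    Continuous (drift s (ϖ n) (r n)) := drift_continuous (h.ϖ_cont n) (h.r_cont n)

theorem drift_re_le (h : IsOscillating ℓ s Λ c ϖ r a b qa qa' qb qb') (n : ι) (t : ℝ) :
    |(drift s (ϖ n) (r n) t).re| ≤ Λ := by rw [drift_re]; exact h.r_le n t

theorem drift_nonres (h : IsOscillating ℓ s Λ c ϖ r a b qa qa' qb qb') (n : ι) :
    c ≤ |Real.sin (∫ t in (0 : ℝ)..ℓ, (drift s (ϖ n) (r n) t).im)| := by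
  simp only [drift_im]; exact h.nonres n

theorem norm_sol_le (h : IsOscillating ℓ s Λ c ϖ r a b qa qa' qb qb') (hc : 0 < c) (n : ι)
    {g : ℝ → ℂ} (hg : IntervalIntegrable g volume 0 ℓ) {θ : ℝ} (hθ : θ ∈ Icc 0 ℓ) :
    ‖perSol ℓ (drift s (ϖ n) (r n)) g θ‖
      ≤ Real.exp (Λ * ℓ) * (c⁻¹ + 1) * (Real.exp (Λ * ℓ) * ∫ t in (0 : ℝ)..ℓ, ‖g t‖) :=
  norm_perSol_le_integral (h.drift_cont n) (h.drift_re_le n) hc (h.drift_nonres n) hg hθ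

variable [Fintype ι]

theorem coupling_cont (h : IsOscillating ℓ s Λ c ϖ r a b qa qa' qb qb') {z : ℝ → ι → ℂ}
    (hz : Continuous z) (n : ι) : Continuous (coupling a b z n) := by
  have hz' : ∀ m, Continuous fun t => z t m := fun m => (continuous_apply m).comp hz
  unfold coupling
  refine continuous_finsetSum _ fun m _ => ?_
  exact ((Complex.continuous_ofReal.comp (h.a_cont n m)).mul (hz' m)).add
    ((Complex.continuous_ofReal.comp (h.b_cont n m)).mul (Complex.continuous_conj.comp (hz' m)))

theorem coupling_le (h : IsOscillating ℓ s Λ c ϖ r a b qa qa' qb qb') {z : ℝ → ι → ℂ} {Z : ℝ}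
    {t : ℝ} (hz : ‖z t‖ ≤ Z) (n : ι) :
    ‖coupling a b z n t‖ ≤ Fintype.card ι * (2 * Λ) * Z := by
  have hΛ0 : 0 ≤ Λ := (abs_nonneg _).trans (h.r_le n 0)
  unfold coupling
  calc _ ≤ ∑ m : ι, ‖(a n m t : ℂ) * z t m + (b n m t : ℂ) * conj (z t m)‖ := norm_sum_le _ _
    _ ≤ ∑ m : ι, 2 * Λ * Z := by
        refine Finset.sum_le_sum fun m _ => ?_
        have h1 : ‖z t m‖ ≤ Z := (norm_le_pi_norm _ m).trans hz
        refine (norm_add_le _ _).trans ?_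
        rw [norm_mul, norm_mul, Complex.norm_real, Complex.norm_real, RCLike.norm_conj,
          Real.norm_eq_abs, Real.norm_eq_abs]
        have e1 := mul_le_mul (h.a_le n m t) h1 (norm_nonneg _) hΛ0
        have e2 := mul_le_mul (h.b_le n m t) h1 (norm_nonneg _) hΛ0
        linarith
    _ = _ := by rw [Finset.sum_const, Finset.card_univ, nsmul_eq_mul]; ring

/-- The coupling acts on solutions of the decoupled system as an operator of order `s`. -/
theorem norm_sol_coupling_sol_le (h : IsOscillating ℓ s Λ c ϖ r a b qa qa' qb qb') (hs : 0 < s)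
    (hc : 0 < c) (hℓ : 0 ≤ ℓ) {f : ι → ℝ → ℂ} {F₁ : ℝ} (hf : ∀ m, Continuous (f m))
    (hF₁ : ∀ m, ∀ t ∈ Icc 0 ℓ, ‖f m t‖ ≤ F₁) (n : ι) {θ : ℝ} (hθ : θ ∈ Icc 0 ℓ) :
    ‖perSol ℓ (drift s (ϖ n) (r n))
        (coupling a b (fun t m => perSol ℓ (drift s (ϖ m) (r m)) (f m) t) n) θ‖
      ≤ s * (2 * (Real.exp (Λ * ℓ) * (c⁻¹ + 1)) * (Fintype.card ι) *
        (2 * Λ * (2 * (Real.exp (Λ * ℓ) * (Real.exp (Λ * ℓ) * (c⁻¹ + 1) * (Real.exp (Λ * ℓ) * ℓ)))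
          + ℓ * ((1 + 2 * Λ) *
            (Real.exp (Λ * ℓ) * (Real.exp (Λ * ℓ) * (c⁻¹ + 1) * (Real.exp (Λ * ℓ) * ℓ)))
              + Real.exp (Λ * ℓ))))) * F₁ := by
  have hΛ0 : 0 ≤ Λ := (abs_nonneg _).trans (h.r_le n 0)
  have hF0 : 0 ≤ F₁ := (norm_nonneg _).trans (hF₁ n θ hθ)
  set e := Real.exp (Λ * ℓ) with he
  have he0 : 0 < e := Real.exp_pos _
  set y : ι → ℝ → ℂ := fun m t => perSol ℓ (drift s (ϖ m) (r m)) (f m) t with hy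
  set A₀ := e * (c⁻¹ + 1) * (e * (ℓ * F₁)) with hA₀
  have hyle : ∀ m, ∀ t ∈ Icc 0 ℓ, ‖y m t‖ ≤ A₀ := fun m t ht => by
    refine (h.norm_sol_le hc m ((hf m).intervalIntegrable _ _) ht).trans ?_
    rw [hA₀, ← he]
    gcongr
    exact intervalIntegral_norm_le_const hℓ (hF₁ m)
  have hyd : ∀ m t, HasDerivAt (y m) (drift s (ϖ m) (r m) t * y m t + f m t) t := fun m t =>
    perSol_hasDerivAt (h.drift_cont m) (hf m) t
  have hyc : ∀ m, Continuous (y m) := fun m =>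
    continuous_iff_continuousAt.2 fun x => (hyd m x).continuousAt
  -- Multiplication by E subtracts the n-th drift: E y_m has frequency (ϖ_m - ϖ_n)/s and E conj(y_m)
  -- has frequency -(ϖ_m + ϖ_n)/s. These are exactly the factors built into `a_eq` and `b_eq`. The
  -- damping becomes r_m - r_n, which explains the bound 2Λ below.
  set E : ℝ → ℂ := fun t => Complex.exp (-phase (drift s (ϖ n) (r n)) t) with hE
  have hEd : ∀ t, HasDerivAt E (E t * (-drift s (ϖ n) (r n) t)) t := fun t =>
    (phase_hasDerivAt (h.drift_cont n) t).neg.cexp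
  have hEc : Continuous E := exp_neg_phase_continuous (h.drift_cont n)
  have hEle : ∀ t ∈ Icc 0 ℓ, ‖E t‖ ≤ e := fun t ht =>
    norm_exp_neg_phase_le (h.drift_cont n) (h.drift_re_le n) ht
  set Q := s * (2 * Λ * (2 * (e * A₀) + ℓ * (e * A₀ + 2 * Λ * (e * A₀) + e * F₁))) with hQ
  have hr2 : ∀ m t, |r m t - r n t| ≤ 2 * Λ := fun m t => by
    have := abs_sub (r m t) (r n t)
    linarith [h.r_le m t, h.r_le n t]
  have hΛ2 : Λ ≤ 2 * Λ := by linarith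
  have hEy : ∀ m, ∀ t ∈ Icc 0 ℓ, ‖E t * y m t‖ ≤ e * A₀ := fun m t ht => by
    rw [norm_mul]; exact mul_le_mul (hEle t ht) (hyle m t ht) (norm_nonneg _) he0.le
  have hEf : ∀ m, ∀ t ∈ Icc 0 ℓ, ‖E t * f m t‖ ≤ e * F₁ := fun m t ht => by
    rw [norm_mul]; exact mul_le_mul (hEle t ht) (hF₁ m t ht) (norm_nonneg _) he0.le
  have ha : ∀ m, ∀ x ∈ Icc 0 ℓ, ‖∫ t in (0 : ℝ)..x, (a n m t : ℂ) * (E t * y m t)‖ ≤ Q := by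
    intro m x hx
    have := norm_integral_oscillating_le (ℓ := ℓ) (Λ := 2 * Λ) (A := e * A₀) (F₁ := e * F₁) hs
      (κ := fun t => ϖ m t - ϖ n t) (r := fun t => r m t - r n t) (q := qa n m)
      (q' := qa' n m) (Y := fun t => E t * y m t) (F := fun t => E t * f m t)
      ((h.ϖ_cont m).sub (h.ϖ_cont n)) ((h.r_cont m).sub (h.r_cont n)) (hEc.mul (hf m))
      (fun t => by
        convert! (hEd t).mul (hyd m t) using 1
        simp only [drift]; push_cast; ring)
      (h.qa_deriv n m) (h.qa'_cont n m) (fun t => (h.qa_le n m t).trans hΛ2)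
      (fun t => (h.qa'_le n m t).trans hΛ2) (hr2 m) (hEy m) (hEf m) hx
    simp only [← h.a_eq] at this
    exact this
  have hb : ∀ m, ∀ x ∈ Icc 0 ℓ,
      ‖∫ t in (0 : ℝ)..x, (b n m t : ℂ) * (E t * conj (y m t))‖ ≤ Q := by
    intro m x hx
    have hcd : ∀ t, HasDerivAt (fun t => conj (y m t))
        (conj (drift s (ϖ m) (r m) t * y m t + f m t)) t := fun t => by
      have := (Complex.conjCLE.toContinuousLinearMap.hasFDerivAt).comp_hasDerivAt t (hyd m t)
      exact this
    have := norm_integral_oscillating_le (ℓ := ℓ) (Λ := 2 * Λ) (A := e * A₀) (F₁ := e * F₁) hs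
      (κ := fun t => -ϖ m t - ϖ n t) (r := fun t => r m t - r n t) (q := qb n m)
      (q' := qb' n m) (Y := fun t => E t * conj (y m t)) (F := fun t => E t * conj (f m t))
      ((h.ϖ_cont m).neg.sub (h.ϖ_cont n)) ((h.r_cont m).sub (h.r_cont n))
      (hEc.mul (Complex.continuous_conj.comp (hf m)))
      (fun t => by
        convert! (hEd t).mul (hcd t) using 1
        simp only [drift, map_add, map_mul, Complex.conj_I, Complex.conj_ofReal]
        push_cast; ring)
      (h.qb_deriv n m) (h.qb'_cont n m) (fun t => (h.qb_le n m t).trans hΛ2)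
      (fun t => (h.qb'_le n m t).trans hΛ2) (hr2 m)
      (fun t ht => by rw [norm_mul, RCLike.norm_conj, ← norm_mul]; exact hEy m t ht)
      (fun t ht => by rw [norm_mul, RCLike.norm_conj, ← norm_mul]; exact hEf m t ht) hx
    simp only [← h.b_eq] at this
    exact this
  have hai : ∀ m x, IntervalIntegrable (fun t => (a n m t : ℂ) * (E t * y m t)) volume 0 x :=
    fun m x => ((Complex.continuous_ofReal.comp (h.a_cont n m)).mul
      (hEc.mul (hyc m))).intervalIntegrable _ _
  have hbi : ∀ m x, IntervalIntegrable (fun t => (b n m t : ℂ) * (E t * conj (y m t)))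
      volume 0 x :=
    fun m x => ((Complex.continuous_ofReal.comp (h.b_cont n m)).mul
      (hEc.mul (Complex.continuous_conj.comp (hyc m)))).intervalIntegrable _ _
  have hA : ∀ x ∈ Icc 0 ℓ, ‖∫ t in (0 : ℝ)..x, Complex.exp (-phase (drift s (ϖ n) (r n)) t) *
      coupling a b (fun t m => y m t) n t‖ ≤ Fintype.card ι * (2 * Q) := by
    intro x hx
    have e1 : (∫ t in (0 : ℝ)..x, Complex.exp (-phase (drift s (ϖ n) (r n)) t) *
        coupling a b (fun t m => y m t) n t) = ∑ m, ((∫ t in (0 : ℝ)..x,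
          (a n m t : ℂ) * (E t * y m t)) + ∫ t in (0 : ℝ)..x,
          (b n m t : ℂ) * (E t * conj (y m t))) := by
      simp_rw [← intervalIntegral.integral_add (hai _ x) (hbi _ x)]
      rw [← intervalIntegral.integral_finsetSum fun m _ => (hai m x).add (hbi m x)]
      apply intervalIntegral.integral_congr
      intro t _
      simp only [coupling, hE, Finset.mul_sum]
      exact Finset.sum_congr rfl fun m _ => by ring
    rw [e1]
    refine (norm_sum_le _ _).trans ?_
    calc _ ≤ ∑ m : ι, 2 * Q := Finset.sum_le_sum fun m _ => by
          refine (norm_add_le _ _).trans ?_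
          linarith [ha m x hx, hb m x hx]
      _ = _ := by rw [Finset.sum_const, Finset.card_univ, nsmul_eq_mul]
  refine (norm_perSol_le (h.drift_cont n) (h.drift_re_le n) hc (h.drift_nonres n) hA hθ).trans
    (le_of_eq ?_)
  rw [hQ, hA₀]
  ring

end IsOscillating

/-- A rapidly oscillating non-resonant system with a small Lipschitz perturbation has a periodic
solution, with a bound that does not depend on the size of the frequencies. -/
theorem exists_periodic_of_isOscillating [Fintype ι] {ℓ Λ c : ℝ} (hℓ : 0 < ℓ) (hΛ : 0 ≤ Λ)
    (hc : 0 < c) :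
    ∃ C : ℝ, 0 < C ∧ ∀ (s : ℝ) (ϖ r : ι → ℝ → ℝ) (a b qa qa' qb qb' : ι → ι → ℝ → ℝ),
      0 < s → C * s ≤ 1 → IsOscillating ℓ s Λ c ϖ r a b qa qa' qb qb' →
      ∀ (G : ℝ → (ι → ℂ) → ι → ℂ) (h : ι → ℝ → ℂ) (η L R : ℝ),
        Continuous (fun x : ℝ × (ι → ℂ) => G x.1 x.2) →
        (∀ n, IntervalIntegrable (h n) volume 0 ℓ) →
        0 ≤ η → 0 ≤ L → (∀ t ∈ Icc 0 ℓ, ‖G t 0‖ ≤ η) → (∀ n, ∫ t in (0 : ℝ)..ℓ, ‖h n t‖ ≤ η) →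
        (∀ t ∈ Icc 0 ℓ, ∀ x y, ‖x‖ ≤ R → ‖y‖ ≤ R → ‖G t x - G t y‖ ≤ L * ‖x - y‖) →
        C * L ≤ 1 → C * η ≤ R →
        ∃ z : ℝ → ι → ℂ, Continuous z ∧ z 0 = z ℓ ∧
          (∀ θ ∈ Icc 0 ℓ, ∀ n, z θ n = z 0 n + ∫ t in (0 : ℝ)..θ,
            (drift s (ϖ n) (r n) t * z t n
              + (coupling a b z n t + (G t (z t) n + h n t)))) ∧
          ∀ θ, ‖z θ‖ ≤ C * η := by
  set e := Real.exp (Λ * ℓ) with he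
  have he0 : 0 < e := Real.exp_pos _
  set C₀ := e * (c⁻¹ + 1) * e with hC₀
  have hC₀0 : 0 < C₀ := by positivity
  set cK := C₀ * (ℓ * (Fintype.card ι * (2 * Λ))) with hcK
  have hcK0 : 0 ≤ cK := by positivity
  set c₂ := (2 * (e * (c⁻¹ + 1)) * (Fintype.card ι) *
        (2 * Λ * (2 * (e * (e * (c⁻¹ + 1) * (e * ℓ)))
          + ℓ * ((1 + 2 * Λ) * (e * (e * (c⁻¹ + 1) * (e * ℓ))) + e))))
        * (Fintype.card ι * (2 * Λ)) with hc₂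
  have hc₂0 : 0 ≤ c₂ := by positivity
  -- The summands serve three purposes: `4 * c₂` makes the square of the coupling operator at most
  -- 1/4, the next term makes the nonlinear part a contraction, and the last one is the a priori
  -- bound for the fixed point.
  refine ⟨1 + 4 * c₂ + 4 * ((1 + cK) * (C₀ * ℓ)) + 2 * (1 + cK) * (C₀ * (ℓ + 1)), by positivity,
    ?_⟩
  set C := 1 + 4 * c₂ + 4 * ((1 + cK) * (C₀ * ℓ)) + 2 * (1 + cK) * (C₀ * (ℓ + 1)) with hC
  intro s ϖ r a b qa qa' qb qb' hs hCs hosc G h η L R hGc hh hη hL hG0 hhη hGL hCL hCR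
  -- The unknown lives in the Banach space of continuous functions on [0, ℓ]. Freezing it outside
  -- the interval gives functions on the line for the integrals and keeps the sup norm.
  let ext : C(Icc (0 : ℝ) ℓ, ι → ℂ) → ℝ → ι → ℂ := fun z t => z (projIcc 0 ℓ hℓ.le t)
  have hextc : ∀ z, Continuous (ext z) := fun z => z.continuous.comp continuous_projIcc
  have hextle : ∀ z t, ‖ext z t‖ ≤ ‖z‖ := fun z t => z.norm_coe_le_norm _
  have hext_mem : ∀ z (t : Icc (0 : ℝ) ℓ), ext z t = z t := fun z t => by
    simp [ext, projIcc_val]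
  have hdc : ∀ n, Continuous (drift s (ϖ n) (r n)) := hosc.drift_cont
  let T : (g : ι → ℝ → ℂ) → (∀ n, IntervalIntegrable (g n) volume 0 ℓ) → C(Icc (0 : ℝ) ℓ, ι → ℂ) :=
    fun g hg => ⟨fun θ n => perSol ℓ (drift s (ϖ n) (r n)) (g n) θ,
      continuous_pi fun n => (perSol_continuousOn hℓ.le (hdc n) (hg n)).domRestrict⟩
  have hTle : ∀ g hg A, 0 ≤ A → (∀ n, ∫ t in (0 : ℝ)..ℓ, ‖g n t‖ ≤ A) → ‖T g hg‖ ≤ C₀ * A := by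
    intro g hg A hA0 hA
    rw [ContinuousMap.norm_le _ (by positivity)]
    intro θ
    rw [pi_norm_le_iff_of_nonneg (by positivity)]
    intro n
    refine (hosc.norm_sol_le hc n (hg n) θ.2).trans ?_
    rw [hC₀, mul_assoc (e * (c⁻¹ + 1))]
    gcongr
    exact hA n
  have hcoup : ∀ z n, IntervalIntegrable (coupling a b (ext z) n) volume 0 ℓ := fun z n =>
    (hosc.coupling_cont (hextc z) n).intervalIntegrable _ _
  have hGi : ∀ z n, IntervalIntegrable (fun t => G t (ext z t) n + h n t) volume 0 ℓ := fun z n =>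
    (Continuous.intervalIntegrable ((continuous_apply n).comp
      (hGc.comp (continuous_id.prodMk (hextc z)))) _ _).add (hh n)
  let K : C(Icc (0 : ℝ) ℓ, ι → ℂ) → C(Icc (0 : ℝ) ℓ, ι → ℂ) := fun z =>
    T (fun n => coupling a b (ext z) n) (hcoup z)
  let Φ : C(Icc (0 : ℝ) ℓ, ι → ℂ) → C(Icc (0 : ℝ) ℓ, ι → ℂ) := fun z =>
    T (fun n t => G t (ext z t) n + h n t) (hGi z)
  have hTsub : ∀ g hg g' hg' (hgg : ∀ n, IntervalIntegrable (fun t => g n t - g' n t) volume 0 ℓ),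
      T g hg - T g' hg' = T (fun n t => g n t - g' n t) hgg := by
    intro g hg g' hg' hgg
    ext θ n
    exact (perSol_sub (hdc n) (hg n) (hg' n) θ.2).symm
  have hTcongr : ∀ g hg g' hg', (∀ n, ∀ t ∈ Icc 0 ℓ, g n t = g' n t) → T g hg = T g' hg' := by
    intro g hg g' hg' hgg
    ext θ n
    exact perSol_congr (hgg n) θ.2
  have hKsub : ∀ x y, K (x - y) = K x - K y := by
    intro x y
    simp only [K]
    rw [hTsub _ (hcoup x) _ (hcoup y) fun n => (hcoup x n).sub (hcoup y n)]
    refine hTcongr _ (hcoup (x - y)) _ (fun n => (hcoup x n).sub (hcoup y n)) fun n t _ => ?_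
    simp only [coupling, ← Finset.sum_sub_distrib]
    refine Finset.sum_congr rfl fun m _ => ?_
    simp only [ext, ContinuousMap.sub_apply, Pi.sub_apply, map_sub]
    ring
  have hcoup_le : ∀ z n t, ‖coupling a b (ext z) n t‖ ≤ Fintype.card ι * (2 * Λ) * ‖z‖ :=
    fun z n t => hosc.coupling_le (hextle z t) n
  have hK : ∀ x, ‖K x‖ ≤ cK * ‖x‖ := by
    intro x
    refine (hTle _ (hcoup x) (ℓ * (Fintype.card ι * (2 * Λ) * ‖x‖)) (by positivity) fun n =>
      intervalIntegral_norm_le_const hℓ.le fun t _ => hcoup_le x n t).trans (le_of_eq ?_)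
    rw [hcK]; ring
  have hKK : ∀ x, ‖K (K x)‖ ≤ 1 / 4 * ‖x‖ := by
    intro x
    have hsc : s * c₂ ≤ 1 / 4 := by
      have : 4 * c₂ * s ≤ C * s := by
        gcongr
        have h1 : 0 ≤ 4 * ((1 + cK) * (C₀ * ℓ)) := by positivity
        have h2 : 0 ≤ 2 * (1 + cK) * (C₀ * (ℓ + 1)) := by positivity
        rw [hC]; linarith
      linarith
    have key : ‖K (K x)‖ ≤ s * c₂ * ‖x‖ := by
      rw [ContinuousMap.norm_le _ (by positivity)]
      intro θ
      rw [pi_norm_le_iff_of_nonneg (by positivity)]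
      intro n
      -- The inner K x solves the decoupled system with a bounded continuous forcing, namely the
      -- coupling of x. This is the situation in which coupling and solving again gains the factor
      -- s.
      have h1 := hosc.norm_sol_coupling_sol_le hs hc hℓ.le (f := fun m => coupling a b (ext x) m)
        (F₁ := Fintype.card ι * (2 * Λ) * ‖x‖) (fun m => hosc.coupling_cont (hextc x) m)
        (fun m t _ => hcoup_le x m t) n θ.2
      have h2 : K (K x) θ n = perSol ℓ (drift s (ϖ n) (r n)) (coupling a b (fun t m =>
          perSol ℓ (drift s (ϖ m) (r m)) (coupling a b (ext x) m) t) n) θ := by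
        refine perSol_congr (fun t ht => ?_) θ.2
        simp only [coupling, ext]
        rw [projIcc_of_mem hℓ.le ht]
        rfl
      rw [h2]
      refine h1.trans (le_of_eq ?_)
      rw [hc₂, he]; ring
    exact key.trans (by gcongr)
  have hΦ0 : ‖Φ 0‖ ≤ C₀ * ((ℓ + 1) * η) := by
    refine hTle _ (hGi 0) _ (by positivity) fun n => ?_
    have i1 : IntervalIntegrable (fun t => G t (ext 0 t) n) volume 0 ℓ :=
      Continuous.intervalIntegrable ((continuous_apply n).comp
        (hGc.comp (continuous_id.prodMk (hextc 0)))) _ _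
    calc _ ≤ ∫ t in (0 : ℝ)..ℓ, (‖G t (ext 0 t) n‖ + ‖h n t‖) :=
          intervalIntegral.integral_mono_on hℓ.le (hGi 0 n).norm (i1.norm.add (hh n).norm)
            fun t _ => norm_add_le _ _
      _ = (∫ t in (0 : ℝ)..ℓ, ‖G t (ext 0 t) n‖) + ∫ t in (0 : ℝ)..ℓ, ‖h n t‖ :=
          intervalIntegral.integral_add i1.norm (hh n).norm
      _ ≤ ℓ * η + η := by
          gcongr
          · exact intervalIntegral_norm_le_const hℓ.le fun t ht =>
              (norm_le_pi_norm _ n).trans (hG0 t ht)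
          · exact hhη n
      _ = _ := by ring
  have hΦ : ∀ x y, ‖x‖ ≤ R → ‖y‖ ≤ R → ‖Φ x - Φ y‖ ≤ (C₀ * ℓ * L) * ‖x - y‖ := by
    intro x y hx hy
    simp only [Φ]
    rw [hTsub _ (hGi x) _ (hGi y) fun n => (hGi x n).sub (hGi y n)]
    refine (hTle _ (fun n => (hGi x n).sub (hGi y n)) (ℓ * (L * ‖x - y‖)) (by positivity) fun n =>
      intervalIntegral_norm_le_const hℓ.le fun t ht => ?_).trans (le_of_eq (by ring))
    have e1 : G t (ext x t) n + h n t - (G t (ext y t) n + h n t)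
        = (G t (ext x t) - G t (ext y t)) n := by simp
    rw [e1]
    refine (norm_le_pi_norm _ n).trans ((hGL t ht _ _ ((hextle x t).trans hx)
      ((hextle y t).trans hy)).trans ?_)
    gcongr
    exact hextle (x - y) t
  have hbig1 : 4 * ((1 + cK) * (C₀ * ℓ)) ≤ C := by
    have h2 : 0 ≤ 2 * (1 + cK) * (C₀ * (ℓ + 1)) := by positivity
    rw [hC]; linarith
  have hbig2 : 2 * (1 + cK) * (C₀ * (ℓ + 1)) ≤ C := by
    have h2 : 0 ≤ 4 * ((1 + cK) * (C₀ * ℓ)) := by positivity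
    rw [hC]; linarith
  have hq : (1 + cK) * (C₀ * ℓ * L) ≤ 1 / 4 := by
    have := mul_le_mul_of_nonneg_right hbig1 hL
    linarith
  have hR2 : 2 * (1 + cK) * (C₀ * ((ℓ + 1) * η)) ≤ C * η := by
    have := mul_le_mul_of_nonneg_right hbig2 hη
    linarith
  obtain ⟨x, hxle, hx⟩ := exists_fixedPoint_of_small_square K Φ hcK0
    (A := C₀ * ((ℓ + 1) * η)) (by positivity) hKsub hK hKK hΦ0 hΦ hq (hR2.trans hCR)
  have hfi : ∀ n, IntervalIntegrable
      (fun t => coupling a b (ext x) n t + (G t (ext x t) n + h n t)) volume 0 ℓ :=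
    fun n => (hcoup x n).add (hGi x n)
  have hxT : x = T (fun n t => coupling a b (ext x) n t + (G t (ext x t) n + h n t)) hfi := by
    have e1 := hTsub _ hfi (fun n t => G t (ext x t) n + h n t) (hGi x)
      (fun n => (hfi n).sub (hGi x n))
    have e2 : T (fun n t => coupling a b (ext x) n t + (G t (ext x t) n + h n t)
        - (G t (ext x t) n + h n t)) (fun n => (hfi n).sub (hGi x n)) = K x :=
      hTcongr _ (fun n => (hfi n).sub (hGi x n)) _ (hcoup x) fun n t _ => by simp
    rw [e2, sub_eq_iff_eq_add] at e1
    rw [e1]; exact hx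
  have hxv : ∀ θ ∈ Icc 0 ℓ, ∀ n, ext x θ n = perSol ℓ (drift s (ϖ n) (r n))
      (fun t => coupling a b (ext x) n t + (G t (ext x t) n + h n t)) θ := by
    intro θ hθ n
    have h1 : ext x θ = x ⟨θ, hθ⟩ := hext_mem x ⟨θ, hθ⟩
    rw [h1]
    exact congrFun (congrArg (fun w : C(Icc (0 : ℝ) ℓ, ι → ℂ) => w ⟨θ, hθ⟩) hxT) n
  have hne : ∀ n, Complex.exp (-phase (drift s (ϖ n) (r n)) ℓ) - 1 ≠ 0 := by
    intro n h0
    have h1 := abs_sin_im_le_norm_exp_sub_one (-phase (drift s (ϖ n) (r n)) ℓ)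
    rw [h0, norm_zero, Complex.neg_im, Real.sin_neg, abs_neg, phase_im (hdc n)] at h1
    linarith [hosc.drift_nonres n]
  refine ⟨ext x, hextc x, ?_, ?_, fun θ => (hextle x θ).trans (hxle.trans hR2)⟩
  · funext n
    rw [hxv 0 ⟨le_rfl, hℓ.le⟩ n, hxv ℓ ⟨hℓ.le, le_rfl⟩ n]
    exact perSol_periodic (hne n)
  · intro θ hθ n
    rw [hxv θ hθ n, hxv 0 ⟨le_rfl, hℓ.le⟩ n, perSol_eq_integral (hdc n) (hfi n) hθ]
    congr 1
    apply intervalIntegral.integral_congr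
    intro t ht
    rw [uIcc_of_le hθ.1] at ht
    simp only [hxv t ⟨ht.1, ht.2.trans hθ.2⟩ n]

end OscillatingSystem

/-! ### Reduction of the second order system -/

section SecondOrder

/-- Product rule for a `C¹` function and an absolutely continuous function. -/
theorem mul_eq_add_integral {A A' y g : ℝ → ℝ} {ℓ : ℝ} (hA : ∀ x, HasDerivAt A (A' x) x)
    (hA' : Continuous A') (hg : IntervalIntegrable g volume 0 ℓ)
    (hy : ∀ θ ∈ Icc 0 ℓ, y θ = y 0 + ∫ t in (0 : ℝ)..θ, g t) {θ : ℝ} (hθ : θ ∈ Icc 0 ℓ) :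
    A θ * y θ = A 0 * y 0 + ∫ t in (0 : ℝ)..θ, (A' t * y t + A t * g t) := by
  have hgθ : IntervalIntegrable g volume 0 θ := hg.mono_set
    (uIcc_subset_uIcc left_mem_uIcc (by rwa [uIcc_of_le (hθ.1.trans hθ.2)]))
  have hAc : Continuous A := continuous_iff_continuousAt.2 fun x => (hA x).continuousAt
  have h1 := real_mul_primitive hA hA' hgθ
  have h2 : A θ - A 0 = ∫ t in (0 : ℝ)..θ, A' t :=
    (intervalIntegral.integral_eq_sub_of_hasDerivAt (fun x _ => hA x)
      (hA'.intervalIntegrable _ _)).symm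
  have hprim : ContinuousOn (fun t => ∫ τ in (0 : ℝ)..t, g τ) (uIcc 0 θ) :=
    intervalIntegral.continuousOn_primitive_interval' hgθ left_mem_uIcc
  have h3 : ∫ t in (0 : ℝ)..θ, (A' t * y t + A t * g t) = ∫ t in (0 : ℝ)..θ,
      (y 0 * A' t + (A' t * (∫ τ in (0 : ℝ)..t, g τ) + A t * g t)) := by
    apply intervalIntegral.integral_congr
    intro t ht
    rw [uIcc_of_le hθ.1] at ht
    simp only [hy t ⟨ht.1, ht.2.trans hθ.2⟩]
    ring
  rw [h3, intervalIntegral.integral_add, intervalIntegral.integral_const_mul, ← h2, ← h1,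
    hy θ hθ]
  · ring
  · exact (continuous_const.mul hA').intervalIntegrable _ _
  · exact (hA'.continuousOn.mul hprim).intervalIntegrable.add (hgθ.continuousOn_mul
      hAc.continuousOn)

variable {ι : Type*} [Fintype ι] [DecidableEq ι]

/-- Periodic solutions of `s² (u'' + M u') + ϖ² u = F(θ, u) + h`, for small `s` and non-resonant
frequencies `ϖ / s`. -/
theorem exists_periodic_second_order {ℓ Λ c w₀ : ℝ} (hℓ : 0 < ℓ) (hΛ : 0 ≤ Λ) (hc : 0 < c)
    (hw₀ : 0 < w₀) :
    ∃ C : ℝ, 0 < C ∧ ∀ (s : ℝ) (ϖ ϖ' r : ι → ℝ → ℝ) (M a b qa qa' qb qb' : ι → ι → ℝ → ℝ),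
      0 < s → C * s ≤ 1 → IsOscillating ℓ s Λ c ϖ r a b qa qa' qb qb' →
      (∀ n t, HasDerivAt (ϖ n) (ϖ' n t) t) → (∀ n, Continuous (ϖ' n)) →
      (∀ n t, w₀ ≤ ϖ n t) → (∀ n, ϖ n 0 = ϖ n ℓ) → (∀ n m, Continuous (M n m)) →
      (∀ n t, r n t = ϖ' n t / (2 * ϖ n t) - M n n t / 2) →
      (∀ n m t, a n m t = if m = n then 0 else -(M n m t / 2)) →
      (∀ n m t, b n m t = M n m t / 2 + if m = n then ϖ' n t / (2 * ϖ n t) else 0) →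
      ∀ (F : ℝ → (ι → ℝ) → ι → ℝ) (h : ι → ℝ → ℝ) (η L R : ℝ),
        Continuous (fun x : ℝ × (ι → ℝ) => F x.1 x.2) →
        (∀ n, IntervalIntegrable (h n) volume 0 ℓ) →
        0 ≤ η → 0 ≤ L → (∀ t ∈ Icc 0 ℓ, ‖F t 0‖ ≤ η) → (∀ n, ∫ t in (0 : ℝ)..ℓ, |h n t| ≤ η) →
        (∀ t ∈ Icc 0 ℓ, ∀ x y, ‖x‖ ≤ R → ‖y‖ ≤ R → ‖F t x - F t y‖ ≤ L * ‖x - y‖) →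
        C * L ≤ s → C * η ≤ s * R →
        ∃ u u' u'' : ℝ → ι → ℝ, Continuous u ∧ Continuous u' ∧ u 0 = u ℓ ∧ u' 0 = u' ℓ ∧
          (∀ n, IntervalIntegrable (fun t => u'' t n) volume 0 ℓ) ∧
          (∀ θ ∈ Icc 0 ℓ, ∀ n, u θ n = u 0 n + ∫ t in (0 : ℝ)..θ, u' t n) ∧
          (∀ θ ∈ Icc 0 ℓ, ∀ n, u' θ n = u' 0 n + ∫ t in (0 : ℝ)..θ, u'' t n) ∧
          (∀ t n, s ^ 2 * u'' t n + s ^ 2 * ∑ m, M n m t * u' t m + ϖ n t ^ 2 * u t n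
            = F t (u t) n + h n t) ∧
          (∀ t, ‖u t‖ ≤ C * η / s) ∧ ∀ t, s * ‖u' t‖ ≤ C * η / s := by
  obtain ⟨C₁, hC₁, H⟩ := exists_periodic_of_isOscillating (ι := ι) hℓ hΛ hc
  refine ⟨C₁ + C₁ / w₀, by positivity, ?_⟩
  intro s ϖ ϖ' r M a b qa qa' qb qb' hs hCs hosc hϖ hϖ' hw hper hM hr ha hb F h η L R hFc hh hη hL
    hF0 hhη hFL hCL hCR
  have hC1le : C₁ ≤ C₁ + C₁ / w₀ := by
    have : 0 < C₁ / w₀ := by positivity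
    linarith
  have hC2le : C₁ / w₀ ≤ C₁ + C₁ / w₀ := by linarith
  have hϖpos : ∀ n t, 0 < ϖ n t := fun n t => hw₀.trans_le (hw n t)
  -- The first order unknown is z_n = ϖ_n u_n - i s u_n'; its real part returns u through `U`, its
  -- imaginary part returns u'.
  let U : ℝ → (ι → ℂ) → ι → ℝ := fun t x m => (x m).re / ϖ m t
  have hUc : Continuous fun x : ℝ × (ι → ℂ) => U x.1 x.2 := by
    refine continuous_pi fun m => ?_
    refine Continuous.div ?_ ((hosc.ϖ_cont m).comp continuous_fst) fun x => (hϖpos m x.1).ne'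
    exact Complex.continuous_re.comp ((continuous_apply m).comp continuous_snd)
  have hUle : ∀ t x y, ‖U t x - U t y‖ ≤ ‖x - y‖ / w₀ := by
    intro t x y
    rw [pi_norm_le_iff_of_nonneg (by positivity)]
    intro m
    have e : (U t x - U t y) m = ((x - y) m).re / ϖ m t := by simp [U]; ring
    rw [e, norm_div, Real.norm_eq_abs, Real.norm_eq_abs, abs_of_pos (hϖpos m t)]
    gcongr
    · exact (Complex.abs_re_le_norm _).trans (norm_le_pi_norm _ m)
    · exact hw m t
  have hU0 : ∀ t, U t 0 = 0 := fun t => by funext m; simp [U]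
  -- The data enter the first order system divided by s, which is the only loss in the estimates.
  -- Accordingly η becomes η/s; composing with `U` turns L into L/(s w₀) and R into R w₀.
  let G : ℝ → (ι → ℂ) → ι → ℂ := fun t x n => -(Complex.I * ((F t (U t x) n / s : ℝ) : ℂ))
  have hGc : Continuous fun x : ℝ × (ι → ℂ) => G x.1 x.2 := by
    refine continuous_pi fun n => ?_
    have h1 : Continuous fun x : ℝ × (ι → ℂ) => F x.1 (U x.1 x.2) n :=
      (continuous_apply n).comp (hFc.comp (continuous_fst.prodMk hUc))
    exact (continuous_const.mul (Complex.continuous_ofReal.comp (h1.div_const s))).neg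
  have hGn : ∀ t x y n, ‖(G t x - G t y) n‖ = |(F t (U t x) - F t (U t y)) n| / s := by
    intro t x y n
    have e : (G t x - G t y) n
        = -(Complex.I * (((F t (U t x) - F t (U t y)) n / s : ℝ) : ℂ)) := by
      simp [G]; ring
    rw [e, norm_neg, norm_mul, Complex.norm_I, one_mul, Complex.norm_real, Real.norm_eq_abs,
      abs_div, abs_of_pos hs]
  let k : ι → ℝ → ℂ := fun n t => -(Complex.I * ((h n t / s : ℝ) : ℂ))
  have hki : ∀ n, IntervalIntegrable (k n) volume 0 ℓ := fun n => by
    have h1 : IntervalIntegrable (fun t => ((h n t / s : ℝ) : ℂ)) volume 0 ℓ :=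
      ⟨((hh n).div_const s).1.ofReal, ((hh n).div_const s).2.ofReal⟩
    exact (h1.const_mul _).neg
  have hkn : ∀ n t, ‖k n t‖ = |h n t| / s := fun n t => by
    simp only [k]
    rw [norm_neg, norm_mul, Complex.norm_I, one_mul, Complex.norm_real, Real.norm_eq_abs,
      abs_div, abs_of_pos hs]
  obtain ⟨z, hzc, hzper, hz, hzle⟩ := H s ϖ r a b qa qa' qb qb' hs
    ((mul_le_mul_of_nonneg_right hC1le hs.le).trans hCs) hosc G k (η / s) (L / (s * w₀)) (R * w₀)
    hGc hki (by positivity) (by positivity)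
    (fun t ht => by
      rw [pi_norm_le_iff_of_nonneg (by positivity)]
      intro n
      simp only [G, hU0]
      rw [norm_neg, norm_mul, Complex.norm_I, one_mul, Complex.norm_real, norm_div,
        Real.norm_of_nonneg hs.le]
      gcongr
      exact (norm_le_pi_norm _ n).trans (hF0 t ht))
    (fun n => by
      simp only [hkn]
      rw [intervalIntegral.integral_div]
      gcongr
      exact hhη n)
    (fun t ht x y hx hy => by
      rw [pi_norm_le_iff_of_nonneg (by positivity)]
      intro n
      rw [hGn]
      have hball : ∀ x : ι → ℂ, ‖x‖ ≤ R * w₀ → ‖U t x‖ ≤ R := fun x hx => by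
        have := hUle t x 0
        rw [hU0, sub_zero, sub_zero] at this
        exact this.trans (by rw [div_le_iff₀ hw₀]; exact hx)
      have h1 := hFL t ht _ _ (hball x hx) (hball y hy)
      have h2 : |(F t (U t x) - F t (U t y)) n| ≤ L * (‖x - y‖ / w₀) :=
        (norm_le_pi_norm (F t (U t x) - F t (U t y)) n).trans
          (h1.trans (by gcongr; exact hUle t x y))
      calc _ ≤ L * (‖x - y‖ / w₀) / s := by gcongr
        _ = _ := by field_simp)
    (by
      have h1 : C₁ / w₀ * L ≤ s := (mul_le_mul_of_nonneg_right hC2le hL).trans hCL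
      calc _ = C₁ / w₀ * L / s := by field_simp
        _ ≤ 1 := by rw [div_le_one hs]; exact h1)
    (by
      have h1 : C₁ / w₀ * η ≤ s * R := (mul_le_mul_of_nonneg_right hC2le hη).trans hCR
      calc _ = C₁ / w₀ * η * w₀ / s := by field_simp
        _ ≤ s * R * w₀ / s := by gcongr
        _ = R * w₀ := by field_simp)
  let u : ℝ → ι → ℝ := fun t => U t (z t)
  let u' : ℝ → ι → ℝ := fun t n => -((z t n).im / s)
  let u'' : ℝ → ι → ℝ := fun t n =>
    (F t (u t) n + h n t - ϖ n t ^ 2 * u t n) / s ^ 2 - ∑ m, M n m t * u' t m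
  have hzn : ∀ n, Continuous fun t => z t n := fun n => (continuous_apply n).comp hzc
  have huc : Continuous u := hUc.comp (continuous_id.prodMk hzc)
  have hu'c : Continuous u' := continuous_pi fun n =>
    ((Complex.continuous_im.comp (hzn n)).div_const s).neg
  have hun : ∀ n, Continuous fun t => u t n := fun n => (continuous_apply n).comp huc
  have hu'n : ∀ n, Continuous fun t => u' t n := fun n => (continuous_apply n).comp hu'c
  have hFu : ∀ n, Continuous fun t => F t (u t) n := fun n =>
    (continuous_apply n).comp (hFc.comp (continuous_id.prodMk huc))
  have hu''i : ∀ n, IntervalIntegrable (fun t => u'' t n) volume 0 ℓ := by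
    intro n
    refine IntervalIntegrable.sub (IntervalIntegrable.div_const (IntervalIntegrable.sub
      (IntervalIntegrable.add ((hFu n).intervalIntegrable _ _) (hh n)) ?_) _) ?_
    · exact (((hosc.ϖ_cont n).pow 2).mul (hun n)).intervalIntegrable _ _
    · exact (continuous_finsetSum _ fun m _ => (hM n m).mul (hu'n m)).intervalIntegrable _ _
  let ζ : ι → ℝ → ℂ := fun n t => drift s (ϖ n) (r n) t * z t n
              + (coupling a b z n t + (G t (z t) n + k n t))
  -- Re z and Im z are written with z and conj z. The diagonal multiple of z_n has relative
  -- frequency zero and cannot be integrated by parts; it is therefore put into the drift as `r`,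
  -- and `a` vanishes on the diagonal.
  have hcoup : ∀ n t, (r n t : ℂ) * z t n + coupling a b z n t
      = ((ϖ' n t / ϖ n t * (z t n).re : ℝ) : ℂ)
        - Complex.I * ((∑ m, M n m t * (z t m).im : ℝ) : ℂ) := by
    intro n t
    have e1 : ∀ m, ((a n m t : ℂ) * z t m + (b n m t : ℂ) * (starRingEnd ℂ) (z t m))
        = -(Complex.I * ((M n m t * (z t m).im : ℝ) : ℂ))
          + if m = n then ((M n n t / 2 : ℝ) : ℂ) * z t n
            + ((ϖ' n t / (2 * ϖ n t) : ℝ) : ℂ) * (starRingEnd ℂ) (z t n) else 0 := by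
      intro m
      rw [ha, hb]
      by_cases hmn : m = n
      · subst hmn
        simp only [if_true]
        generalize ϖ' m t / (2 * ϖ m t) = q
        apply Complex.ext
        · simp; ring
        · simp; ring
      · simp only [if_neg hmn]
        apply Complex.ext
        · simp
        · simp; ring
    unfold coupling
    simp only [e1]
    rw [Finset.sum_add_distrib, Finset.sum_ite_eq' Finset.univ n, if_pos (Finset.mem_univ n),
      Finset.sum_neg_distrib, ← Finset.mul_sum, ← Complex.ofReal_sum, hr]
    have h2 : ϖ' n t / ϖ n t = 2 * (ϖ' n t / (2 * ϖ n t)) := by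
      have := (hϖpos n t).ne'
      field_simp
    rw [h2]
    generalize ϖ' n t / (2 * ϖ n t) = q
    apply Complex.ext
    · simp; ring
    · simp; ring
  have hζ : ∀ n t, ζ n t = ((-(ϖ n t / s * (z t n).im) + ϖ' n t / ϖ n t * (z t n).re : ℝ) : ℂ)
      + Complex.I * ((ϖ n t / s * (z t n).re - (∑ m, M n m t * (z t m).im)
        - (F t (u t) n + h n t) / s : ℝ) : ℂ) := by
    intro n t
    have e1 : ζ n t = Complex.I * ((ϖ n t / s : ℝ) : ℂ) * z t n
        + ((r n t : ℂ) * z t n + coupling a b z n t)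
        - Complex.I * (((F t (u t) n + h n t) / s : ℝ) : ℂ) := by
      simp only [ζ, drift, G, k, u]
      push_cast
      ring
    rw [e1, hcoup]
    apply Complex.ext
    · simp
    · simp; ring
  have hζre : ∀ n t, (ζ n t).re = -(ϖ n t / s * (z t n).im) + ϖ' n t / ϖ n t * (z t n).re := by
    intro n t; rw [hζ]; simp
  have hζim : ∀ n t, (ζ n t).im = ϖ n t / s * (z t n).re - (∑ m, M n m t * (z t m).im)
        - (F t (u t) n + h n t) / s := by
    intro n t; rw [hζ]; simp
  have hζi : ∀ n, IntervalIntegrable (ζ n) volume 0 ℓ := by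
    intro n
    refine IntervalIntegrable.add (((hosc.drift_cont n).mul (hzn n)).intervalIntegrable _ _)
      (IntervalIntegrable.add ((hosc.coupling_cont hzc n).intervalIntegrable _ _)
        (IntervalIntegrable.add (Continuous.intervalIntegrable ?_ _ _) (hki n)))
    exact (continuous_apply n).comp (hGc.comp (continuous_id.prodMk hzc))
  have hsub : ∀ θ ∈ Icc 0 ℓ, uIcc 0 θ ⊆ uIcc 0 ℓ := fun θ hθ =>
    uIcc_subset_uIcc left_mem_uIcc (by rwa [uIcc_of_le hℓ.le])
  have hzre : ∀ n, ∀ θ ∈ Icc 0 ℓ, (z θ n).re = (z 0 n).re + ∫ t in (0 : ℝ)..θ, (ζ n t).re := by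
    intro n θ hθ
    have e1 := congrArg Complex.re (hz θ hθ n)
    have e2 := Complex.reCLM.intervalIntegral_comp_comm ((hζi n).mono_set (hsub θ hθ))
    simp only [Complex.reCLM_apply] at e2
    rw [e2, e1, Complex.add_re]
  have hzim : ∀ n, ∀ θ ∈ Icc 0 ℓ, (z θ n).im = (z 0 n).im + ∫ t in (0 : ℝ)..θ, (ζ n t).im := by
    intro n θ hθ
    have e1 := congrArg Complex.im (hz θ hθ n)
    have e2 := Complex.imCLM.intervalIntegral_comp_comm ((hζi n).mono_set (hsub θ hθ))
    simp only [Complex.imCLM_apply] at e2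
    rw [e2, e1, Complex.add_im]
  refine ⟨u, u', u'', huc, hu'c, ?_, ?_, hu''i, ?_, ?_, ?_, ?_, ?_⟩
  -- Only the frequencies have to match at the endpoints in order to pass from z to u; no
  -- periodicity of `M` is used.
  · funext n; simp only [u, U, hzper, hper n]
  · funext n; simp only [u', hzper]
  · intro θ hθ n
    have hinv : ∀ x, HasDerivAt (fun t => (ϖ n t)⁻¹) (-ϖ' n x / ϖ n x ^ 2) x := fun x =>
      (hϖ n x).inv (hϖpos n x).ne'
    have hinvc : Continuous fun x => -ϖ' n x / ϖ n x ^ 2 :=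
      (hϖ' n).neg.div ((hosc.ϖ_cont n).pow 2) fun x => pow_ne_zero 2 (hϖpos n x).ne'
    have hre : IntervalIntegrable (fun t => (ζ n t).re) volume 0 ℓ :=
      ⟨(hζi n).1.re, (hζi n).2.re⟩
    have e1 := mul_eq_add_integral hinv hinvc hre (hzre n) hθ
    have e2 : ∀ t, u t n = (ϖ n t)⁻¹ * (z t n).re := fun t => by
      simp only [u, U]; rw [div_eq_inv_mul]
    rw [e2, e2, e1]
    congr 1
    apply intervalIntegral.integral_congr
    intro t _
    simp only [u', hζre]
    have h2 := (hϖpos n t).ne'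
    field_simp
    ring
  · intro θ hθ n
    have e1 : ∀ t, u'' t n = -((ζ n t).im / s) := by
      intro t
      rw [hζim]
      have h2 := (hϖpos n t).ne'
      have e3 : ∑ m, M n m t * u' t m = -((∑ m, M n m t * (z t m).im) / s) := by
        rw [Finset.sum_div, ← Finset.sum_neg_distrib]
        exact Finset.sum_congr rfl fun m _ => by simp only [u']; ring
      simp only [u'', e3]
      simp only [u, U]
      field_simp
      ring
    simp only [e1, u']
    rw [hzim n θ hθ, intervalIntegral.integral_neg, intervalIntegral.integral_div]
    ring
  · intro t n
    simp only [u'']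
    field_simp
    ring
  · intro t
    have h1 := hUle t (z t) 0
    rw [hU0, sub_zero, sub_zero] at h1
    calc _ ≤ ‖z t‖ / w₀ := h1
      _ ≤ C₁ * (η / s) / w₀ := by gcongr; exact hzle t
      _ = C₁ / w₀ * η / s := by field_simp
      _ ≤ _ := by gcongr
  · intro t
    have h1 : ‖u' t‖ ≤ ‖z t‖ / s := by
      rw [pi_norm_le_iff_of_nonneg (by positivity)]
      intro n
      simp only [u']
      rw [norm_neg, norm_div, Real.norm_of_nonneg hs.le]
      gcongr
      exact (Complex.abs_im_le_norm _).trans (norm_le_pi_norm _ n)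
    calc _ ≤ s * (‖z t‖ / s) := by gcongr
      _ = ‖z t‖ := by field_simp
      _ ≤ C₁ * (η / s) := hzle t
      _ = C₁ * η / s := by ring
      _ ≤ _ := by gcongr

end SecondOrder

/-! ### Families bounded in Cⁿ and Lipschitz in √ε -/

section UniformFamilies

/-- A family `f ε`, `ε ∈ I`, that is uniformly bounded. -/
def UnifBdd (I : Set ℝ) (f : ℝ → ℝ → ℝ) : Prop := ∃ K, ∀ ε ∈ I, ∀ θ, |f ε θ| ≤ K

/-- A family `f ε`, `ε ∈ I`, that is bounded away from zero. -/
def UnifPos (I : Set ℝ) (f : ℝ → ℝ → ℝ) : Prop := ∃ c > 0, ∀ ε ∈ I, ∀ θ, c ≤ f ε θ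

/-- A family `f ε`, `ε ∈ I`, of `Cⁿ` functions with uniformly bounded derivatives. -/
def UC (I : Set ℝ) : ℕ → (ℝ → ℝ → ℝ) → Prop
  | 0, f => (∀ ε ∈ I, Continuous (f ε)) ∧ UnifBdd I f
  | n + 1, f => (∀ ε ∈ I, Differentiable ℝ (f ε)) ∧ UnifBdd I f ∧ UC I n fun ε => deriv (f ε)

variable {I : Set ℝ} {f g : ℝ → ℝ → ℝ} {n : ℕ}

theorem UC.bdd (h : UC I n f) : UnifBdd I f := by
  cases n with
  | zero => exact h.2
  | succ n => exact h.2.1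

theorem UC.cont (h : UC I n f) : ∀ ε ∈ I, Continuous (f ε) := by
  cases n with
  | zero => exact h.1
  | succ n => exact fun ε hε => (h.1 ε hε).continuous

theorem UC.deriv (h : UC I (n + 1) f) : UC I n fun ε => deriv (f ε) := h.2.2

theorem UC.hasDerivAt (h : UC I (n + 1) f) {ε : ℝ} (hε : ε ∈ I) (θ : ℝ) :
    HasDerivAt (f ε) (_root_.deriv (f ε) θ) θ := (h.1 ε hε θ).hasDerivAt

theorem UnifBdd.congr (hf : UnifBdd I f) (h : ∀ ε ∈ I, f ε = g ε) : UnifBdd I g := by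
  obtain ⟨K, hK⟩ := hf
  exact ⟨K, fun ε hε θ => h ε hε ▸ hK ε hε θ⟩

theorem UC.congr (hf : UC I n f) (h : ∀ ε ∈ I, f ε = g ε) : UC I n g := by
  induction n generalizing f g with
  | zero => exact ⟨fun ε hε => h ε hε ▸ hf.1 ε hε, hf.2.congr h⟩
  | succ n ih =>
    exact ⟨fun ε hε => h ε hε ▸ hf.1 ε hε, hf.2.1.congr h,
      ih hf.2.2 fun ε hε => congrArg _root_.deriv (h ε hε)⟩

/-- To build a `Cⁿ⁺¹` family from a family of derivatives. -/
theorem UC.succ_of_hasDerivAt {f' : ℝ → ℝ → ℝ} (h : ∀ ε ∈ I, ∀ θ, HasDerivAt (f ε) (f' ε θ) θ)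
    (hb : UnifBdd I f) (h' : UC I n f') : UC I (n + 1) f :=
  ⟨fun ε hε θ => (h ε hε θ).differentiableAt, hb,
    h'.congr fun ε hε => (funext fun θ => (h ε hε θ).deriv).symm⟩

theorem UC.of_succ (h : UC I (n + 1) f) : UC I n f := by
  induction n generalizing f with
  | zero => exact ⟨h.cont, h.bdd⟩
  | succ n ih => exact ⟨h.1, h.bdd, ih h.2.2⟩

theorem UC.of_le {m : ℕ} (hmn : m ≤ n) (h : UC I n f) : UC I m f := by
  induction hmn with
  | refl => exact h
  | step _ ih => exact ih h.of_succ

theorem UC.mono {I' : Set ℝ} (h : UC I n f) (hI : I' ⊆ I) : UC I' n f := by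
  have hb : ∀ {f : ℝ → ℝ → ℝ}, UnifBdd I f → UnifBdd I' f :=
    fun ⟨K, hK⟩ => ⟨K, fun ε hε θ => hK ε (hI hε) θ⟩
  induction n generalizing f with
  | zero => exact ⟨fun ε hε => h.1 ε (hI hε), hb h.2⟩
  | succ n ih => exact ⟨fun ε hε => h.1 ε (hI hε), hb h.2.1, ih h.2.2⟩

theorem UnifBdd.add (hf : UnifBdd I f) (hg : UnifBdd I g) :
    UnifBdd I fun ε θ => f ε θ + g ε θ := by
  obtain ⟨K, hK⟩ := hf
  obtain ⟨L, hL⟩ := hg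
  exact ⟨K + L, fun ε hε θ => (abs_add_le _ _).trans (add_le_add (hK ε hε θ) (hL ε hε θ))⟩

theorem UnifBdd.neg (hf : UnifBdd I f) : UnifBdd I fun ε θ => -f ε θ := by
  obtain ⟨K, hK⟩ := hf
  exact ⟨K, fun ε hε θ => by rw [abs_neg]; exact hK ε hε θ⟩

theorem UnifBdd.mul (hf : UnifBdd I f) (hg : UnifBdd I g) :
    UnifBdd I fun ε θ => f ε θ * g ε θ := by
  obtain ⟨K, hK⟩ := hf
  obtain ⟨L, hL⟩ := hg
  exact ⟨K * L, fun ε hε θ => by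
    rw [abs_mul]
    exact mul_le_mul (hK ε hε θ) (hL ε hε θ) (abs_nonneg _) ((abs_nonneg _).trans (hK ε hε θ))⟩

theorem UnifBdd.inv {c : ℝ} (hc : 0 < c) (hf : ∀ ε ∈ I, ∀ θ, c ≤ |f ε θ|) :
    UnifBdd I fun ε θ => (f ε θ)⁻¹ :=
  ⟨c⁻¹, fun ε hε θ => by rw [abs_inv]; exact inv_anti₀ hc (hf ε hε θ)⟩

theorem UnifBdd.exp (hf : UnifBdd I f) : UnifBdd I fun ε θ => Real.exp (f ε θ) := by
  obtain ⟨K, hK⟩ := hf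
  exact ⟨Real.exp K, fun ε hε θ => by
    rw [abs_of_pos (Real.exp_pos _)]
    exact Real.exp_le_exp.2 ((le_abs_self _).trans (hK ε hε θ))⟩

theorem UnifBdd.sqrt (hf : UnifBdd I f) : UnifBdd I fun ε θ => Real.sqrt (f ε θ) := by
  obtain ⟨K, hK⟩ := hf
  exact ⟨Real.sqrt K, fun ε hε θ => by
    rw [abs_of_nonneg (Real.sqrt_nonneg _)]
    exact Real.sqrt_le_sqrt ((le_abs_self _).trans (hK ε hε θ))⟩

theorem UC.add (hf : UC I n f) (hg : UC I n g) : UC I n fun ε θ => f ε θ + g ε θ := by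
  induction n generalizing f g with
  | zero => exact ⟨fun ε hε => (hf.1 ε hε).add (hg.1 ε hε), hf.2.add hg.2⟩
  | succ n ih =>
    exact .succ_of_hasDerivAt (fun ε hε θ => (hf.hasDerivAt hε θ).add (hg.hasDerivAt hε θ))
      (hf.bdd.add hg.bdd) (ih hf.deriv hg.deriv)

theorem UC.neg (hf : UC I n f) : UC I n fun ε θ => -f ε θ := by
  induction n generalizing f with
  | zero => exact ⟨fun ε hε => (hf.1 ε hε).neg, hf.2.neg⟩
  | succ n ih =>
    exact .succ_of_hasDerivAt (fun ε hε θ => (hf.hasDerivAt hε θ).neg) hf.bdd.neg (ih hf.deriv)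

theorem UC.sub (hf : UC I n f) (hg : UC I n g) : UC I n fun ε θ => f ε θ - g ε θ := by
  simpa only [sub_eq_add_neg] using hf.add hg.neg

theorem UC.mul (hf : UC I n f) (hg : UC I n g) : UC I n fun ε θ => f ε θ * g ε θ := by
  induction n generalizing f g with
  | zero => exact ⟨fun ε hε => (hf.1 ε hε).mul (hg.1 ε hε), hf.2.mul hg.2⟩
  | succ n ih =>
    exact .succ_of_hasDerivAt (fun ε hε θ => (hf.hasDerivAt hε θ).mul (hg.hasDerivAt hε θ))
      (hf.bdd.mul hg.bdd) ((ih hf.deriv hg.of_succ).add (ih hf.of_succ hg.deriv))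

theorem UC.const (a : ℝ) : UC I n fun _ _ => a := by
  induction n generalizing a with
  | zero => exact ⟨fun _ _ => continuous_const, |a|, fun _ _ _ => le_rfl⟩
  | succ n ih =>
    exact .succ_of_hasDerivAt (fun ε hε θ => hasDerivAt_const θ a) ⟨|a|, fun _ _ _ => le_rfl⟩ (ih 0)

/-- The hypothesis concerns the absolute value because it is applied to differences of eigenvalues
and of frequencies, which may have either sign. -/
theorem UC.inv_of_abs {c : ℝ} (hc : 0 < c) (hpos : ∀ ε ∈ I, ∀ θ, c ≤ |f ε θ|) (hf : UC I n f) :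
    UC I n fun ε θ => (f ε θ)⁻¹ := by
  have hne : ∀ ε ∈ I, ∀ θ, f ε θ ≠ 0 := fun ε hε θ =>
    abs_pos.1 (hc.trans_le (hpos ε hε θ))
  induction n with
  | zero => exact ⟨fun ε hε => (hf.1 ε hε).inv₀ (hne ε hε), .inv hc hpos⟩
  | succ n ih =>
    refine .succ_of_hasDerivAt
      (f' := fun ε θ => -_root_.deriv (f ε) θ * ((f ε θ)⁻¹ * (f ε θ)⁻¹)) (fun ε hε θ => ?_)
      (.inv hc hpos) (hf.deriv.neg.mul ((ih hf.of_succ).mul (ih hf.of_succ)))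
    convert! (hf.hasDerivAt hε θ).inv (hne ε hε θ) using 1
    rw [div_eq_mul_inv, sq, mul_inv]

theorem UnifPos.abs_le (h : UnifPos I f) : ∃ c > 0, ∀ ε ∈ I, ∀ θ, c ≤ |f ε θ| := by
  obtain ⟨c, hc, h⟩ := h
  exact ⟨c, hc, fun ε hε θ => (h ε hε θ).trans (le_abs_self _)⟩

theorem UC.inv (hf : UC I n f) (h : UnifPos I f) : UC I n fun ε θ => (f ε θ)⁻¹ := by
  obtain ⟨c, hc, h⟩ := h.abs_le
  exact .inv_of_abs hc h hf

theorem UC.div (hf : UC I n f) (hg : UC I n g) (h : UnifPos I g) :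
    UC I n fun ε θ => f ε θ / g ε θ := by
  simpa only [div_eq_mul_inv] using hf.mul (hg.inv h)

theorem UC.exp (hf : UC I n f) : UC I n fun ε θ => Real.exp (f ε θ) := by
  induction n with
  | zero => exact ⟨fun ε hε => Real.continuous_exp.comp (hf.1 ε hε), hf.2.exp⟩
  | succ n ih =>
    exact .succ_of_hasDerivAt (fun ε hε θ => (hf.hasDerivAt hε θ).exp) hf.bdd.exp
      ((ih hf.of_succ).mul hf.deriv)

theorem UnifPos.sqrt (h : UnifPos I f) : UnifPos I fun ε θ => Real.sqrt (f ε θ) := by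
  obtain ⟨c, hc, h⟩ := h
  exact ⟨Real.sqrt c, Real.sqrt_pos.2 hc, fun ε hε θ => Real.sqrt_le_sqrt (h ε hε θ)⟩

theorem UnifPos.mul (hf : UnifPos I f) (hg : UnifPos I g) :
    UnifPos I fun ε θ => f ε θ * g ε θ := by
  obtain ⟨c, hc, h⟩ := hf
  obtain ⟨d, hd, h'⟩ := hg
  exact ⟨c * d, mul_pos hc hd, fun ε hε θ =>
    mul_le_mul (h ε hε θ) (h' ε hε θ) hd.le (hc.le.trans (h ε hε θ))⟩

theorem UnifPos.const {a : ℝ} (ha : 0 < a) : UnifPos I fun _ _ => a := ⟨a, ha, fun _ _ _ => le_rfl⟩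

theorem UnifPos.pos (h : UnifPos I f) {ε : ℝ} (hε : ε ∈ I) (θ : ℝ) : 0 < f ε θ := by
  obtain ⟨c, hc, h⟩ := h
  exact hc.trans_le (h ε hε θ)

theorem UnifPos.inv (hf : UnifPos I f) (hb : UnifBdd I f) : UnifPos I fun ε θ => (f ε θ)⁻¹ := by
  obtain ⟨K, hK⟩ := hb
  refine ⟨(|K| + 1)⁻¹, by positivity, fun ε hε θ => inv_anti₀ (hf.pos hε θ) ?_⟩
  linarith [hK ε hε θ, le_abs_self (f ε θ), le_abs_self K]

theorem UnifPos.div (hf : UnifPos I f) (hg : UnifPos I g) (hb : UnifBdd I g) :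
    UnifPos I fun ε θ => f ε θ / g ε θ := by
  simpa only [div_eq_mul_inv] using hf.mul (hg.inv hb)

theorem UnifPos.exp (hb : UnifBdd I f) : UnifPos I fun ε θ => Real.exp (f ε θ) := by
  obtain ⟨K, hK⟩ := hb
  refine ⟨Real.exp (-K), Real.exp_pos _, fun ε hε θ => Real.exp_le_exp.2 ?_⟩
  linarith [hK ε hε θ, neg_abs_le (f ε θ)]

theorem UC.sqrt (hf : UC I n f) (h : UnifPos I f) : UC I n fun ε θ => Real.sqrt (f ε θ) := by
  induction n with
  | zero => exact ⟨fun ε hε => Real.continuous_sqrt.comp (hf.1 ε hε), hf.2.sqrt⟩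
  | succ n ih =>
    exact .succ_of_hasDerivAt (fun ε hε θ => (hf.hasDerivAt hε θ).sqrt (h.pos hε θ).ne') hf.bdd.sqrt
      (hf.deriv.div ((UC.const 2).mul (ih hf.of_succ)) ((UnifPos.const two_pos).mul h.sqrt))

theorem UC.sum {κ : Type*} (s : Finset κ) {F : κ → ℝ → ℝ → ℝ} (h : ∀ k ∈ s, UC I n (F k)) :
    UC I n fun ε θ => ∑ k ∈ s, F k ε θ := by
  classical
  induction s using Finset.induction_on with
  | empty => simpa using UC.const 0
  | insert a s ha ih =>
    simp only [Finset.sum_insert ha]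
    exact (h a (Finset.mem_insert_self a s)).add
      (ih fun k hk => h k (Finset.mem_insert_of_mem hk))

theorem UC.of_periodic {g : ℝ → ℝ} {ℓ : ℝ} (hℓ : ℓ ≠ 0) (hg : ContDiff ℝ n g)
    (hp : Function.Periodic g ℓ) : UC I n fun _ => g := by
  have hb : ∀ {g : ℝ → ℝ}, Continuous g → Function.Periodic g ℓ → UnifBdd I fun _ => g := by
    intro g hg hp
    obtain ⟨K, hK⟩ := (hp.isBounded_of_continuous hℓ hg).exists_norm_le
    exact ⟨K, fun _ _ θ => hK _ (mem_range_self θ)⟩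
  induction n generalizing g with
  | zero => exact ⟨fun _ _ => hg.continuous, hb hg.continuous hp⟩
  | succ n ih =>
    rw [Nat.cast_succ, contDiff_succ_iff_deriv] at hg
    refine ⟨fun _ _ => hg.1, hb hg.1.continuous hp, ih hg.2.2 fun x => ?_⟩
    rw [← deriv_comp_add_const]
    exact congrArg (fun F => _root_.deriv F x) (funext hp)

theorem UniformC2.uc {ℓ ε₀ K : ℝ} (h : UniformC2 ℓ ε₀ K f) : UC (Ioo 0 ε₀) 2 f := by
  have hb : ∀ m ≤ 2, UnifBdd (Ioo 0 ε₀) fun ε => iteratedDeriv m (f ε) := fun m hm =>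
    ⟨K, fun ε hε θ => (h ε hε).2.2 m hm θ⟩
  have h0 := hb 0 (by norm_num)
  have h1 := hb 1 (by norm_num)
  have h2 := hb 2 (by norm_num)
  simp only [iteratedDeriv_zero] at h0
  simp only [iteratedDeriv_one] at h1
  simp only [iteratedDeriv_succ, iteratedDeriv_zero] at h2
  have hd : ∀ ε ∈ Ioo 0 ε₀, ContDiff ℝ 1 (deriv (f ε)) := fun ε hε => by
    have := (h ε hε).1
    rw [show (2 : WithTop ℕ∞) = 1 + 1 by norm_num, contDiff_succ_iff_deriv] at this
    exact this.2.2
  refine ⟨fun ε hε => (h ε hε).1.differentiable (by norm_num), h0,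
    fun ε hε => (hd ε hε).differentiable (by norm_num), h1, fun ε hε => ?_, h2⟩
  exact (contDiff_one_iff_deriv.1 (hd ε hε)).2

/-- A family that is Lipschitz in `√ε`, uniformly in `θ`. -/
def LipSqrt (I : Set ℝ) (f : ℝ → ℝ → ℝ) : Prop :=
  ∃ L, 0 ≤ L ∧ ∀ ε ∈ I, ∀ ζ ∈ I, ∀ θ, |f ε θ - f ζ θ| ≤ L * |Real.sqrt ε - Real.sqrt ζ|

/-- A family of `ℓ`-periodic functions, bounded in `C²` and Lipschitz in `√ε`. -/
structure Tame (I : Set ℝ) (ℓ : ℝ) (f : ℝ → ℝ → ℝ) : Prop where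
  uc : UC I 2 f
  lip : LipSqrt I f
  per : ∀ ε ∈ I, Function.Periodic (f ε) ℓ

variable {ℓ : ℝ}

theorem Tame.congr (hf : Tame I ℓ f) (h : ∀ ε ∈ I, f ε = g ε) : Tame I ℓ g := by
  refine ⟨hf.uc.congr h, ?_, fun ε hε => h ε hε ▸ hf.per ε hε⟩
  obtain ⟨L, hL0, hL⟩ := hf.lip
  exact ⟨L, hL0, fun ε hε ε' hε' θ => by rw [← h ε hε, ← h ε' hε']; exact hL ε hε ε' hε' θ⟩

theorem Tame.of_periodic {g : ℝ → ℝ} (hℓ : ℓ ≠ 0) (hg : ContDiff ℝ 2 g)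
    (hp : Function.Periodic g ℓ) : Tame I ℓ fun _ => g :=
  ⟨.of_periodic hℓ hg hp, ⟨0, le_rfl, fun _ _ _ _ _ => by simp⟩, fun _ _ => hp⟩

theorem Tame.const (a : ℝ) : Tame I ℓ fun _ _ => a :=
  ⟨.const a, ⟨0, le_rfl, fun _ _ _ _ _ => by simp⟩, fun _ _ _ => rfl⟩

theorem Tame.add (hf : Tame I ℓ f) (hg : Tame I ℓ g) : Tame I ℓ fun ε θ => f ε θ + g ε θ := by
  refine ⟨hf.uc.add hg.uc, ?_, fun ε hε => (hf.per ε hε).add (hg.per ε hε)⟩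
  obtain ⟨L, hL0, hL⟩ := hf.lip
  obtain ⟨M, hM0, hM⟩ := hg.lip
  refine ⟨L + M, by positivity, fun ε hε ε' hε' θ => ?_⟩
  calc _ = |(f ε θ - f ε' θ) + (g ε θ - g ε' θ)| := by congr 1; ring
    _ ≤ _ := abs_add_le _ _
    _ ≤ _ := by rw [add_mul]; exact add_le_add (hL ε hε ε' hε' θ) (hM ε hε ε' hε' θ)

theorem Tame.neg (hf : Tame I ℓ f) : Tame I ℓ fun ε θ => -f ε θ := by
  refine ⟨hf.uc.neg, ?_, fun ε hε θ => congrArg _ (hf.per ε hε θ)⟩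
  obtain ⟨L, hL0, hL⟩ := hf.lip
  refine ⟨L, hL0, fun ε hε ε' hε' θ => ?_⟩
  rw [neg_sub_neg, abs_sub_comm]
  exact hL ε hε ε' hε' θ

theorem Tame.sub (hf : Tame I ℓ f) (hg : Tame I ℓ g) : Tame I ℓ fun ε θ => f ε θ - g ε θ := by
  simpa only [sub_eq_add_neg] using hf.add hg.neg

theorem Tame.mul (hf : Tame I ℓ f) (hg : Tame I ℓ g) : Tame I ℓ fun ε θ => f ε θ * g ε θ := by
  refine ⟨hf.uc.mul hg.uc, ?_, fun ε hε => (hf.per ε hε).mul (hg.per ε hε)⟩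
  obtain ⟨L, hL0, hL⟩ := hf.lip
  obtain ⟨M, hM0, hM⟩ := hg.lip
  obtain ⟨A, hA⟩ := hf.uc.bdd
  obtain ⟨B, hB⟩ := hg.uc.bdd
  refine ⟨|A| * M + L * |B|, by positivity, fun ε hε ε' hε' θ => ?_⟩
  calc _ = |f ε θ * (g ε θ - g ε' θ) + (f ε θ - f ε' θ) * g ε' θ| := by congr 1; ring
    _ ≤ |f ε θ| * |g ε θ - g ε' θ| + |f ε θ - f ε' θ| * |g ε' θ| := by
        rw [← abs_mul, ← abs_mul]; exact abs_add_le _ _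
    _ ≤ |A| * (M * |Real.sqrt ε - Real.sqrt ε'|) + (L * |Real.sqrt ε - Real.sqrt ε'|) * |B| := by
        exact add_le_add
          (mul_le_mul ((hA ε hε θ).trans (le_abs_self _)) (hM ε hε ε' hε' θ) (abs_nonneg _)
            (abs_nonneg _))
          (mul_le_mul (hL ε hε ε' hε' θ) ((hB ε' hε' θ).trans (le_abs_self _)) (abs_nonneg _)
            (by positivity))
    _ = _ := by ring

theorem Tame.inv (hf : Tame I ℓ f) (h : UnifPos I f) : Tame I ℓ fun ε θ => (f ε θ)⁻¹ := by
  refine ⟨hf.uc.inv h, ?_, fun ε hε θ => congrArg _ (hf.per ε hε θ)⟩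
  obtain ⟨L, hL0, hL⟩ := hf.lip
  have hpos := @UnifPos.pos I f h
  obtain ⟨c, hc, h⟩ := h
  refine ⟨L / (c * c), by positivity, fun ε hε ε' hε' θ => ?_⟩
  rw [inv_sub_inv (hpos hε θ).ne' (hpos hε' θ).ne', abs_div, abs_sub_comm,
    abs_of_pos (mul_pos (hpos hε θ) (hpos hε' θ)), div_mul_eq_mul_div]
  exact div_le_div₀ (by positivity) (hL ε hε ε' hε' θ) (by positivity)
    (mul_le_mul (h ε hε θ) (h ε' hε' θ) hc.le (hpos hε θ).le)

theorem Tame.div (hf : Tame I ℓ f) (hg : Tame I ℓ g) (h : UnifPos I g) :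
    Tame I ℓ fun ε θ => f ε θ / g ε θ := by
  simpa only [div_eq_mul_inv] using hf.mul (hg.inv h)

theorem abs_exp_sub_exp_le {K x y : ℝ} (hx : x ≤ K) (hy : y ≤ K) :
    |Real.exp x - Real.exp y| ≤ Real.exp K * |x - y| := by
  have key : ∀ {x y : ℝ}, x ≤ K → y ≤ x → Real.exp x - Real.exp y ≤ Real.exp K * (x - y) := by
    intro x y hx hyx
    have h1 : Real.exp y = Real.exp x * Real.exp (y - x) := by rw [← Real.exp_add]; congr 1; ring
    have h2 := Real.add_one_le_exp (y - x)
    have h3 : Real.exp x ≤ Real.exp K := Real.exp_le_exp.2 hx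
    have h4 := Real.exp_pos x
    nlinarith [mul_le_mul_of_nonneg_left h2 h4.le]
  rcases le_total y x with hyx | hxy
  · rw [abs_of_nonneg (sub_nonneg.2 (Real.exp_le_exp.2 hyx)), abs_of_nonneg (sub_nonneg.2 hyx)]
    exact key hx hyx
  · rw [abs_sub_comm, abs_sub_comm x, abs_of_nonneg (sub_nonneg.2 (Real.exp_le_exp.2 hxy)),
      abs_of_nonneg (sub_nonneg.2 hxy)]
    exact key hy hxy

theorem Tame.exp (hf : Tame I ℓ f) : Tame I ℓ fun ε θ => Real.exp (f ε θ) := by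
  refine ⟨hf.uc.exp, ?_, fun ε hε θ => congrArg _ (hf.per ε hε θ)⟩
  obtain ⟨L, hL0, hL⟩ := hf.lip
  obtain ⟨K, hK⟩ := hf.uc.bdd
  refine ⟨Real.exp K * L, by positivity, fun ε hε ε' hε' θ => ?_⟩
  refine (abs_exp_sub_exp_le ((le_abs_self _).trans (hK ε hε θ))
    ((le_abs_self _).trans (hK ε' hε' θ))).trans ?_
  rw [mul_assoc]
  gcongr
  exact hL ε hε ε' hε' θ

theorem Tame.mono {I' : Set ℝ} (hf : Tame I ℓ f) (hI : I' ⊆ I) : Tame I' ℓ f := by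
  refine ⟨hf.uc.mono hI, ?_, fun ε hε => hf.per ε (hI hε)⟩
  obtain ⟨L, hL0, hL⟩ := hf.lip
  exact ⟨L, hL0, fun ε hε ε' hε' θ => hL ε (hI hε) ε' (hI hε') θ⟩

theorem UniformC2.tame {ε₀ K : ℝ} (h : UniformC2 ℓ ε₀ K f) (h' : LipschitzInSqrt ε₀ K f) :
    Tame (Ioo 0 ε₀) ℓ f :=
  ⟨h.uc, ⟨|K|, abs_nonneg K, fun ε hε ε' hε' θ => (h' ε hε ε' hε' θ).trans
    (mul_le_mul_of_nonneg_right (le_abs_self K) (abs_nonneg _))⟩, fun ε hε => (h ε hε).2.1⟩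

end UniformFamilies

/-! ### Tridiagonal matrices: symmetrization and coercivity -/

section Tridiagonal

variable {N : ℕ}

/-- The tridiagonal matrix with lower off-diagonal entries `-c i` and upper ones `-d i`, whose
rows act as `c i (v i - v (i - 1)) - d i (v (i + 1) - v i)` with `v (-1) = - v 0`. -/
def tri (N : ℕ) (c d : ℕ → ℝ) : Matrix (Fin N) (Fin N) ℝ :=
  Matrix.of fun i j =>
    if j = i then (if i.val = 0 then 2 else 1) * c i + d i
    else if j.val + 1 = i.val then -c i
    else if i.val + 1 = j.val then -d i
    else 0

/-- Extension of a vector by zero to a sequence. -/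
def extZero (v : Fin N → ℝ) (k : ℕ) : ℝ := if h : k < N then v ⟨k, h⟩ else 0

theorem extZero_val (v : Fin N → ℝ) (i : Fin N) : extZero v i = v i := by simp [extZero]

theorem extZero_lt (v : Fin N → ℝ) {k : ℕ} (h : k < N) : extZero v k = v ⟨k, h⟩ := by
  simp [extZero, h]

/-- The reflection v(-1) = -v 0 is absorbed by the factor 2 on the diagonal, so row 0 has no lower
neighbour. This is spelled out because `0 - 1 = 0` for natural numbers. In the last row `extZero`
supplies a zero. -/
theorem tri_mulVec (c d : ℕ → ℝ) (v : Fin N → ℝ) (i : Fin N) :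
    (tri N c d).mulVec v i = ((if i.val = 0 then 2 else 1) * c i + d i) * extZero v i
      - c i * (if i.val = 0 then 0 else extZero v (i - 1)) - d i * extZero v (i + 1) := by
  have hsplit : ∀ j : Fin N, tri N c d i j * v j
      = (if j = i then ((if i.val = 0 then 2 else 1) * c i + d i) * v j else 0)
        + ((if j.val + 1 = i.val then -c i * v j else 0)
          + (if i.val + 1 = j.val then -d i * v j else 0)) := by
    intro j
    simp only [tri, Matrix.of_apply]
    by_cases h1 : j = i
    · subst h1; simp
    · by_cases h2 : j.val + 1 = i.val
      · have h3 : ¬ (i.val + 1 = j.val) := by omega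
        simp [h1, h2, h3]
      · simp [h1, h2]
  simp only [Matrix.mulVec, dotProduct, hsplit, Finset.sum_add_distrib]
  rw [Finset.sum_ite_eq' Finset.univ i, if_pos (Finset.mem_univ i), extZero_val]
  have e1 : (∑ j : Fin N, if j.val + 1 = i.val then -c i * v j else 0)
      = -(c i * if i.val = 0 then 0 else extZero v (i - 1)) := by
    by_cases h0 : i.val = 0
    · rw [if_pos h0, mul_zero, neg_zero]
      exact Finset.sum_eq_zero fun j _ => if_neg (by omega)
    · have hlt : i.val - 1 < N := by omega
      rw [if_neg h0, extZero_lt v hlt, Finset.sum_eq_single ⟨i.val - 1, hlt⟩]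
      · rw [if_pos (by simp; omega)]; ring
      · intro j _ hj
        exact if_neg fun h => hj (Fin.ext (by simp; omega))
      · simp
  have e2 : (∑ j : Fin N, if i.val + 1 = j.val then -d i * v j else 0)
      = -(d i * extZero v (i + 1)) := by
    by_cases h0 : i.val + 1 < N
    · rw [extZero_lt v h0, Finset.sum_eq_single ⟨i.val + 1, h0⟩]
      · simp
      · intro j _ hj
        exact if_neg fun h => hj (Fin.ext (by simp; omega))
      · simp
    · have : extZero v (i.val + 1) = 0 := by simp [extZero, h0]
      rw [this, mul_zero, neg_zero]
      exact Finset.sum_eq_zero fun j _ => if_neg (by omega)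
  rw [e1, e2]
  ring

/-- Weights that symmetrize `tri N c d`. -/
def wt (c d : ℕ → ℝ) : ℕ → ℝ
  | 0 => 1
  | k + 1 => wt c d k * d k / c (k + 1)

/-- Bounds for the entries of `tri N c d`. -/
structure TriBounds (N : ℕ) (c d : ℕ → ℝ) (c₀ c₁ : ℝ) : Prop where
  pos : 0 < c₀
  c_lo : ∀ k < N, c₀ ≤ c k
  c_hi : ∀ k < N, c k ≤ c₁
  d_lo : ∀ k, k + 1 < N → c₀ ≤ d k
  d_hi : ∀ k < N, d k ≤ c₁
  d_last : ∀ k, k + 1 = N → d k = 0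

namespace TriBounds

variable {c d : ℕ → ℝ} {c₀ c₁ : ℝ}

theorem c_pos (h : TriBounds N c d c₀ c₁) {k : ℕ} (hk : k < N) : 0 < c k :=
  h.pos.trans_le (h.c_lo k hk)

theorem d_nonneg (h : TriBounds N c d c₀ c₁) {k : ℕ} (hk : k < N) : 0 ≤ d k := by
  rcases Nat.lt_or_ge (k + 1) N with h1 | h1
  · exact h.pos.le.trans (h.d_lo k h1)
  · rw [h.d_last k (by omega)]

theorem c₁_pos (h : TriBounds N c d c₀ c₁) (hN : 1 ≤ N) : 0 < c₁ :=
  (h.c_pos (k := 0) hN).trans_le (h.c_hi 0 hN)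

theorem c₀_le_c₁ (h : TriBounds N c d c₀ c₁) (hN : 1 ≤ N) : c₀ ≤ c₁ :=
  (h.c_lo 0 hN).trans (h.c_hi 0 hN)

theorem wt_pos (h : TriBounds N c d c₀ c₁) {k : ℕ} (hk : k < N) : 0 < wt c d k := by
  induction k with
  | zero => simp [wt]
  | succ k ih =>
    have h1 := ih (by omega)
    have h2 := h.c_pos hk
    have h3 : 0 < d k := h.pos.trans_le (h.d_lo k hk)
    simp only [wt]
    positivity

theorem wt_le (h : TriBounds N c d c₀ c₁) (hN : 1 ≤ N) {k : ℕ} (hk : k < N) :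
    wt c d k ≤ (c₁ / c₀) ^ N := by
  have h1 : 1 ≤ c₁ / c₀ := by rw [le_div_iff₀ h.pos, one_mul]; exact h.c₀_le_c₁ hN
  have key : wt c d k ≤ (c₁ / c₀) ^ k := by
    induction k with
    | zero => simp [wt]
    | succ k ih =>
      have h0 := h.pos
      have e1 := ih (by omega)
      have e2 : wt c d (k + 1) = wt c d k * (d k / c (k + 1)) := by simp only [wt]; ring
      rw [e2, pow_succ]
      refine mul_le_mul e1 (div_le_div₀ (h.c₁_pos hN).le (h.d_hi k (by omega)) h.pos
        (h.c_lo _ hk)) (div_nonneg (h.d_nonneg (by omega)) (h.c_pos hk).le) (by positivity)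
  exact key.trans (pow_le_pow_right₀ h1 hk.le)

theorem le_wt (h : TriBounds N c d c₀ c₁) (hN : 1 ≤ N) {k : ℕ} (hk : k < N) :
    (c₀ / c₁) ^ N ≤ wt c d k := by
  have hc₁ := h.c₁_pos hN
  have h0 := h.pos
  have h1 : c₀ / c₁ ≤ 1 := by rw [div_le_one hc₁]; exact h.c₀_le_c₁ hN
  have key : (c₀ / c₁) ^ k ≤ wt c d k := by
    induction k with
    | zero => simp [wt]
    | succ k ih =>
      have e1 := ih (by omega)
      have e2 : wt c d (k + 1) = wt c d k * (d k / c (k + 1)) := by simp only [wt]; ring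
      rw [e2, pow_succ]
      exact mul_le_mul e1 (div_le_div₀ (h.d_nonneg (by omega)) (h.d_lo k hk) (h.c_pos hk)
        (h.c_hi _ hk)) (by positivity) (h.wt_pos (by omega)).le
  exact (pow_le_pow_of_le_one (by positivity) h1 hk.le).trans key

theorem wt_mul_c (h : TriBounds N c d c₀ c₁) {k : ℕ} (hk : k + 1 < N) :
    wt c d (k + 1) * c (k + 1) = wt c d k * d k := by
  simp only [wt]
  rw [div_mul_cancel₀ _ (h.c_pos hk).ne']

/-- The recursion for the weights is precisely the balance wt(k+1) c(k+1) = wt(k) d(k) of opposite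
off-diagonal entries, so the matrix is self-adjoint for the weighted inner product. -/
theorem wt_symm (h : TriBounds N c d c₀ c₁) (i j : Fin N) :
    wt c d i * tri N c d i j = wt c d j * tri N c d j i := by
  simp only [tri, Matrix.of_apply]
  by_cases h1 : j = i
  · subst h1; simp
  · have h1' : i ≠ j := fun e => h1 e.symm
    by_cases h2 : j.val + 1 = i.val
    · have h3 : ¬ (i.val + 1 = j.val) := by omega
      have h4 := h.wt_mul_c (k := j.val) (by omega)
      simp only [h1, h1', h2, h3, if_true, if_false]
      rw [h2] at h4
      linarith
    · by_cases h3 : i.val + 1 = j.val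
      · have h4 := h.wt_mul_c (k := i.val) (by omega)
        simp only [h1, h1', h2, h3, if_true, if_false]
        rw [h3] at h4
        linarith
      · simp [h1, h1', h2, h3]

theorem abs_diag_le (h : TriBounds N c d c₀ c₁) {k : ℕ} (hk : k < N) :
    |(if k = 0 then 2 else 1) * c k + d k| ≤ 3 * c₁ := by
  have h1 := h.c_pos hk
  have h2 := h.d_nonneg hk
  have h3 := h.c_hi k hk
  have h4 := h.d_hi k hk
  split_ifs <;> rw [abs_of_nonneg (by positivity)] <;> linarith

theorem abs_mulVec_le (h : TriBounds N c d c₀ c₁) {v : Fin N → ℝ} {A : ℝ} (hA : ∀ i, |v i| ≤ A)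
    (i : Fin N) : |(tri N c d).mulVec v i| ≤ 5 * c₁ * A := by
  have hA0 : 0 ≤ A := (abs_nonneg _).trans (hA i)
  have hext : ∀ k, |extZero v k| ≤ A := fun k => by
    unfold extZero
    split_ifs with hk
    · exact hA _
    · simpa using hA0
  have hext' : |if i.val = 0 then 0 else extZero v (i - 1)| ≤ A := by
    split_ifs
    · simpa using hA0
    · exact hext _
  rw [tri_mulVec]
  have e1 := mul_le_mul (h.abs_diag_le i.2) (hext i) (abs_nonneg _)
    ((abs_nonneg _).trans (h.abs_diag_le i.2))
  have e2 : |c i * (if i.val = 0 then 0 else extZero v (i - 1))| ≤ c₁ * A := by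
    rw [abs_mul, abs_of_pos (h.c_pos i.2)]
    exact mul_le_mul (h.c_hi i i.2) hext' (abs_nonneg _) ((h.c_pos i.2).le.trans (h.c_hi i i.2))
  have e3 : |d i * extZero v (i + 1)| ≤ c₁ * A := by
    rw [abs_mul, abs_of_nonneg (h.d_nonneg i.2)]
    exact mul_le_mul (h.d_hi i i.2) (hext _) (abs_nonneg _)
      ((h.d_nonneg i.2).trans (h.d_hi i i.2))
  rw [← abs_mul] at e1
  refine (abs_sub _ _).trans ((add_le_add (abs_sub _ _) le_rfl).trans ?_)
  linarith

/-- A vector is controlled by its first component and `(B - ρ) v`. -/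
theorem abs_le_of_residual (h : TriBounds N c d c₀ c₁) (hN : 1 ≤ N) {ρ η : ℝ}
    (hρ : |ρ| ≤ 5 * c₁) {v : Fin N → ℝ} (hη : ∀ i, |(tri N c d).mulVec v i - ρ * v i| ≤ η)
    (i : Fin N) : |v i| ≤ (10 * c₁ / c₀ + 1 / c₀ + 1) ^ N * (|v ⟨0, hN⟩| + η) := by
  have hc₁ := h.c₁_pos hN
  have hc₀ := h.pos
  set A := 10 * c₁ / c₀ + 1 / c₀ + 1 with hA
  have hA1 : 1 ≤ A := by
    have : 0 ≤ 10 * c₁ / c₀ + 1 / c₀ := by positivity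
    linarith
  have hη0 : 0 ≤ η := (abs_nonneg _).trans (hη ⟨0, hN⟩)
  set Z := |v ⟨0, hN⟩| + η with hZ
  have hZ0 : 0 ≤ Z := by positivity
  have key : ∀ k, ∀ j ≤ k, j < N → |extZero v j| ≤ A ^ k * Z := by
    intro k
    induction k with
    | zero =>
      intro j hj hjN
      have : j = 0 := by omega
      subst this
      rw [extZero_lt v hN, pow_zero, one_mul, hZ]
      linarith
    | succ k ih =>
      intro j hj hjN
      rcases Nat.lt_or_ge j (k + 1) with hj1 | hj1
      · refine (ih j (by omega) hjN).trans ?_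
        exact mul_le_mul_of_nonneg_right (pow_le_pow_right₀ hA1 (Nat.le_succ k)) hZ0
      · have hjk : j = k + 1 := by omega
        subst hjk
        have hk : k < N := by omega
        have e0 := hη ⟨k, hk⟩
        rw [tri_mulVec] at e0
        simp only at e0
        rw [← extZero_lt v hk] at e0
        set D := (if k = 0 then (2 : ℝ) else 1) * c k + d k
        set V' := if k = 0 then 0 else extZero v (k - 1)
        have hd0 : 0 < d k := hc₀.trans_le (h.d_lo k hjN)
        have hV' : |V'| ≤ A ^ k * Z := by
          simp only [V']
          split_ifs
          · rw [abs_zero]; positivity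
          · exact ih _ (by omega) (by omega)
        have hV := ih k le_rfl hk
        have hD : |D - ρ| ≤ 8 * c₁ := by
          have := abs_sub D ρ
          have := h.abs_diag_le hk
          linarith
        -- Row k is solved for the next component. Since `d k` is bounded below whenever there is a
        -- next row, each component is determined by the two preceding ones and the residual, and
        -- the constant is multiplied by at most A.
        have e1 : d k * extZero v (k + 1)
            = (D - ρ) * extZero v k - c k * V'
              - (D * extZero v k - c k * V' - d k * extZero v (k + 1) - ρ * extZero v k) := by ring
        have e2 : |d k * extZero v (k + 1)| ≤ 8 * c₁ * (A ^ k * Z) + c₁ * (A ^ k * Z) + η := by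
          rw [e1]
          refine (abs_sub _ _).trans (add_le_add ((abs_sub _ _).trans (add_le_add ?_ ?_)) e0)
          · rw [abs_mul]
            exact mul_le_mul hD hV (abs_nonneg _) (by positivity)
          · rw [abs_mul, abs_of_pos (h.c_pos hk)]
            exact mul_le_mul (h.c_hi k hk) hV' (abs_nonneg _) hc₁.le
        have e3 : η ≤ A ^ k * Z := by
          have : Z ≤ A ^ k * Z := le_mul_of_one_le_left hZ0 (one_le_pow₀ hA1)
          have h3 : η ≤ Z := by rw [hZ]; linarith [abs_nonneg (v ⟨0, hN⟩)]
          linarith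
        rw [abs_mul, abs_of_pos hd0] at e2
        have e4 : c₀ * |extZero v (k + 1)| ≤ (10 * c₁ + 1) * (A ^ k * Z) := by
          have := mul_le_mul_of_nonneg_right (h.d_lo k hjN) (abs_nonneg (extZero v (k + 1)))
          have h5 : 0 ≤ c₁ * (A ^ k * Z) := by positivity
          linarith
        have e5 : |extZero v (k + 1)| ≤ (10 * c₁ + 1) * (A ^ k * Z) / c₀ := by
          rw [le_div_iff₀ hc₀]; linarith
        refine e5.trans ?_
        have e6 : (10 * c₁ + 1) / c₀ ≤ A := by rw [hA, add_div]; linarith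
        calc _ = ((10 * c₁ + 1) / c₀) * (A ^ k * Z) := by ring
          _ ≤ A * (A ^ k * Z) := by gcongr
          _ = _ := by rw [pow_succ]; ring
  have := key N i i.2.le i.2
  rwa [extZero_val] at this

/-- Summation by parts turns the weighted quadratic form into a weighted sum of squared differences.
The reflected boundary condition anchors the vector at its first component, so a discrete Poincaré
inequality, the source of N², controls the whole vector. -/
theorem sum_wt_mul_mulVec (h : TriBounds N c d c₀ c₁) (hN : 1 ≤ N) (v : Fin N → ℝ) :
    (c₀ / c₁) ^ N * c₀ / N ^ 2 * ∑ i, v i ^ 2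
      ≤ ∑ i : Fin N, wt c d i * v i * (tri N c d).mulVec v i := by
  have hc₁ := h.c₁_pos hN
  have hc₀ := h.pos
  set V := extZero v with hV
  -- The jump across the reflection is V 0 - (-V 0) = 2 V 0. Half of it is taken as δ 0, so that the
  -- δ's add up to V; the missing factor 2 is put into the flux `q`.
  let δ : ℕ → ℝ := fun k => if k = 0 then V 0 else V k - V (k - 1)
  let q : ℕ → ℝ := fun k => if k < N then (if k = 0 then 2 else 1) * (wt c d k * c k) * δ k else 0
  have hrow : ∀ i : Fin N, wt c d i * v i * (tri N c d).mulVec v i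
      = V i * (q i - q (i + 1)) := by
    intro i
    rw [tri_mulVec, ← extZero_val v i, ← hV]
    have hq1 : q (i + 1) = wt c d i * d i * (V (i + 1) - V i) := by
      simp only [q, δ]
      by_cases h1 : i.val + 1 < N
      · simp only [h1, if_true, Nat.succ_ne_zero, if_false, Nat.add_sub_cancel, one_mul]
        rw [h.wt_mul_c h1]
      · rw [if_neg h1, h.d_last i (by omega)]; ring
    rw [hq1]
    simp only [q, δ, i.2, if_true]
    by_cases h0 : i.val = 0
    · simp only [h0, if_true]; ring
    · simp only [h0, if_false]; ring
  have htel : ∀ n, ∑ k ∈ Finset.range (n + 1), V k * (q k - q (k + 1))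
      = (∑ k ∈ Finset.range (n + 1), q k * δ k) - V n * q (n + 1) := by
    intro n
    induction n with
    | zero => simp [δ]; ring
    | succ n ih =>
      rw [Finset.sum_range_succ, ih, Finset.sum_range_succ _ (n + 1)]
      simp only [δ, Nat.succ_ne_zero, if_false, Nat.add_sub_cancel]
      ring
  obtain ⟨n, rfl⟩ : ∃ n, N = n + 1 := ⟨N - 1, by omega⟩
  have hqN : q (n + 1) = 0 := by simp [q]
  have hsum : ∑ i : Fin (n + 1), wt c d i * v i * (tri (n + 1) c d).mulVec v i
      = ∑ k ∈ Finset.range (n + 1), q k * δ k := by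
    rw [Finset.sum_congr rfl fun i _ => hrow i,
      Fin.sum_univ_eq_sum_range (fun k => V k * (q k - q (k + 1))), htel, hqN, mul_zero, sub_zero]
  have hVδ : ∀ k, V k = ∑ j ∈ Finset.range (k + 1), δ j := by
    intro k
    induction k with
    | zero => simp [δ]
    | succ k ih =>
      rw [Finset.sum_range_succ, ← ih]
      simp [δ]
  set S := ∑ k ∈ Finset.range (n + 1), δ k ^ 2 with hS
  have hS0 : 0 ≤ S := Finset.sum_nonneg fun k _ => sq_nonneg _
  have hVk : ∀ k < n + 1, V k ^ 2 ≤ (n + 1 : ℕ) * S := by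
    intro k hk
    rw [hVδ k]
    refine (sq_sum_le_card_mul_sum_sq (s := Finset.range (k + 1)) (f := δ)).trans ?_
    rw [Finset.card_range]
    have h1 : ∑ j ∈ Finset.range (k + 1), δ j ^ 2 ≤ S :=
      Finset.sum_le_sum_of_subset_of_nonneg (Finset.range_mono (by omega))
        fun _ _ _ => sq_nonneg _
    have h2 : ((k + 1 : ℕ) : ℝ) ≤ (n + 1 : ℕ) := by exact_mod_cast hk
    exact mul_le_mul h2 h1 (Finset.sum_nonneg fun _ _ => sq_nonneg _) (by positivity)
  have hv2 : ∑ i, v i ^ 2 ≤ ((n + 1 : ℕ) : ℝ) ^ 2 * S := by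
    calc _ ≤ ∑ i : Fin (n + 1), ((n + 1 : ℕ) : ℝ) * S := Finset.sum_le_sum fun i _ => by
          rw [← extZero_val v i]; exact hVk i i.2
      _ = _ := by
          rw [Finset.sum_const, Finset.card_univ, Fintype.card_fin, nsmul_eq_mul]; ring
  have hqδ : (c₀ / c₁) ^ (n + 1) * c₀ * S ≤ ∑ k ∈ Finset.range (n + 1), q k * δ k := by
    rw [hS, Finset.mul_sum]
    refine Finset.sum_le_sum fun k hk => ?_
    have hk' := Finset.mem_range.1 hk
    have h1 := mul_le_mul (h.le_wt hN hk') (h.c_lo k hk') hc₀.le (h.wt_pos hk').le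
    have h2 : wt c d k * c k ≤ (if k = 0 then 2 else 1) * (wt c d k * c k) := by
      have : 0 ≤ wt c d k * c k := mul_nonneg (h.wt_pos hk').le (h.c_pos hk').le
      split_ifs <;> linarith
    simp only [q, hk', if_true]
    calc _ ≤ (if k = 0 then 2 else 1) * (wt c d k * c k) * δ k ^ 2 := by
          exact mul_le_mul_of_nonneg_right (h1.trans h2) (sq_nonneg _)
      _ = _ := by ring
  rw [hsum]
  refine le_trans ?_ hqδ
  rw [div_mul_eq_mul_div, div_le_iff₀ (by positivity)]
  have h3 : 0 ≤ (c₀ / c₁) ^ (n + 1) * c₀ := by positivity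
  calc _ ≤ (c₀ / c₁) ^ (n + 1) * c₀ * (((n + 1 : ℕ) : ℝ) ^ 2 * S) := by gcongr
    _ = _ := by ring

end TriBounds

end Tridiagonal

/-! ### Simple spectrum, inverse frame and perturbation of eigenvalues -/

section Eigenframe

variable {N : ℕ}

/-- The columns of `P` are unit eigenvectors of `A` that form a basis, with eigenvalues in
decreasing order. -/
structure IsFrame (A P : Matrix (Fin N) (Fin N) ℝ) (ρ : Fin N → ℝ) : Prop where
  unit_col : ∀ j, ∑ i, P i j ^ 2 = 1
  isUnit : IsUnit P
  eigen : A * P = P * Matrix.diagonal ρ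
  antitone : Antitone ρ

namespace IsFrame

variable {A P : Matrix (Fin N) (Fin N) ℝ} {ρ : Fin N → ℝ}

theorem mulVec_col (e : IsFrame A P ρ) (i j : Fin N) :
    A.mulVec (fun k => P k j) i = ρ j * P i j := by
  have h := congrFun (congrFun e.eigen i) j
  rw [Matrix.mul_diagonal] at h
  rw [mul_comm, ← h]
  rfl

theorem abs_le_one (e : IsFrame A P ρ) (i j : Fin N) : |P i j| ≤ 1 := by
  have h1 : P i j ^ 2 ≤ 1 := by
    rw [← e.unit_col j]
    exact Finset.single_le_sum (f := fun i => P i j ^ 2) (fun i _ => sq_nonneg _)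
      (Finset.mem_univ i)
  exact (sq_le_one_iff_abs_le_one _).1 h1

variable {c d : ℕ → ℝ} {c₀ c₁ : ℝ}

/-- Read the eigenvalue equation in the row of the largest component of the eigenvector. -/
theorem abs_eigenvalue_le (e : IsFrame (tri N c d) P ρ) (h : TriBounds N c d c₀ c₁) (j : Fin N) :
    |ρ j| ≤ 5 * c₁ := by
  obtain ⟨i, -, hi⟩ := Finset.exists_max_image Finset.univ (fun i => |P i j|) ⟨j, Finset.mem_univ j⟩
  have hpos : 0 < |P i j| := by
    rcases (abs_nonneg (P i j)).eq_or_lt with h0 | h0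
    · exfalso
      have h1 : ∀ k, P k j = 0 := fun k => abs_nonpos_iff.1
        ((hi k (Finset.mem_univ k)).trans h0.symm.le)
      have h2 := e.unit_col j
      simp [h1] at h2
    · exact h0
  have h1 := h.abs_mulVec_le (v := fun k => P k j) (fun k => hi k (Finset.mem_univ k)) i
  rw [e.mulVec_col, abs_mul] at h1
  exact le_of_mul_le_mul_right h1 hpos

/-- The usual argument for self-adjoint operators: the weighted bilinear form, evaluated on the two
columns in either order, produces either eigenvalue. -/
theorem weighted_orthogonal (e : IsFrame (tri N c d) P ρ) (h : TriBounds N c d c₀ c₁)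
    {a b : Fin N} (hab : ρ a ≠ ρ b) : ∑ i : Fin N, wt c d i * P i a * P i b = 0 := by
  have key : ∀ a b : Fin N, ρ b * ∑ i : Fin N, wt c d i * P i a * P i b
      = ∑ i : Fin N, ∑ j, wt c d i * tri N c d i j * P i a * P j b := by
    intro a b
    rw [Finset.mul_sum]
    refine Finset.sum_congr rfl fun i _ => ?_
    have h1 := e.mulVec_col i b
    simp only [Matrix.mulVec, dotProduct] at h1
    calc _ = wt c d i * P i a * (ρ b * P i b) := by ring
      _ = _ := by
        rw [← h1, Finset.mul_sum]
        exact Finset.sum_congr rfl fun j _ => by ring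
  have h1 := key a b
  have h2 := key b a
  rw [Finset.sum_comm] at h2
  have h3 : ∑ i : Fin N, ∑ j, wt c d i * tri N c d i j * P i a * P j b
      = ∑ y : Fin N, ∑ x : Fin N, wt c d x * tri N c d x y * P x b * P y a := by
    refine Finset.sum_congr rfl fun i _ => Finset.sum_congr rfl fun j _ => ?_
    rw [h.wt_symm i j]; ring
  have h4 : ∑ i : Fin N, wt c d i * P i b * P i a = ∑ i : Fin N, wt c d i * P i a * P i b :=
    Finset.sum_congr rfl fun i _ => by ring
  rw [h4] at h2
  have h5 : (ρ b - ρ a) * ∑ i : Fin N, wt c d i * P i a * P i b = 0 := by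
    rw [sub_mul, h1, h2, h3, sub_self]
  rcases mul_eq_zero.1 h5 with h6 | h6
  · exact absurd (sub_eq_zero.1 h6).symm hab
  · exact h6

/-- An eigenvector has zero residual, so all its components are bounded by a multiple of the first
one; for a unit vector the first one cannot be small. -/
theorem first_component (e : IsFrame (tri N c d) P ρ) (h : TriBounds N c d c₀ c₁) (hN : 1 ≤ N)
    (j : Fin N) :
    1 ≤ N * ((10 * c₁ / c₀ + 1 / c₀ + 1) ^ N) ^ 2 * P ⟨0, hN⟩ j ^ 2 := by
  set Q := (10 * c₁ / c₀ + 1 / c₀ + 1) ^ N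
  have h1 : ∀ i, |P i j| ≤ Q * |P ⟨0, hN⟩ j| := fun i => by
    have := h.abs_le_of_residual hN (e.abs_eigenvalue_le h j) (v := fun k => P k j) (η := 0)
      (fun i => by rw [e.mulVec_col, sub_self, abs_zero]) i
    rwa [add_zero] at this
  rw [← e.unit_col j]
  calc _ ≤ ∑ i : Fin N, Q ^ 2 * P ⟨0, hN⟩ j ^ 2 := Finset.sum_le_sum fun i _ => by
        have := pow_le_pow_left₀ (abs_nonneg _) (h1 i) 2
        rwa [mul_pow, sq_abs, sq_abs] at this
    _ = _ := by rw [Finset.sum_const, Finset.card_univ, Fintype.card_fin, nsmul_eq_mul]; ring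

/-- The lower bound for the norm of a weighted unit vector. -/
theorem le_weighted_norm (e : IsFrame (tri N c d) P ρ) (h : TriBounds N c d c₀ c₁) (hN : 1 ≤ N)
    (j : Fin N) : (c₀ / c₁) ^ N ≤ ∑ i : Fin N, wt c d i * P i j ^ 2 := by
  calc _ = ∑ i : Fin N, (c₀ / c₁) ^ N * P i j ^ 2 := by
        rw [← Finset.mul_sum, e.unit_col, mul_one]
    _ ≤ _ := Finset.sum_le_sum fun i _ =>
        mul_le_mul_of_nonneg_right (h.le_wt hN i.2) (sq_nonneg _)

/-- The eigenvalues are separated, with a bound that depends only on the bounds for the entries. -/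
theorem exists_gap (hN : 1 ≤ N) (hc₀ : 0 < c₀) (hc₁ : 0 < c₁) :
    ∃ g > 0, ∀ (c d : ℕ → ℝ) (P : Matrix (Fin N) (Fin N) ℝ) (ρ : Fin N → ℝ),
      TriBounds N c d c₀ c₁ → IsFrame (tri N c d) P ρ → ∀ a b, a ≠ b → g ≤ |ρ a - ρ b| := by
  set Q := (10 * c₁ / c₀ + 1 / c₀ + 1) ^ N with hQ
  have hQ0 : 0 < Q := by positivity
  have hN0 : (0 : ℝ) < N := by exact_mod_cast hN
  set m := (c₀ / c₁) ^ N with hm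
  set M := (c₁ / c₀) ^ N with hM
  have hm0 : 0 < m := by positivity
  have hM0 : 0 < M := by positivity
  refine ⟨Real.sqrt (m / (N * Q ^ 2) / (N * (M * Q ^ 2))), by positivity, ?_⟩
  intro c d P ρ h e a b hab
  set z : Fin N := ⟨0, hN⟩ with hz
  -- D is the combination of two eigenvectors whose first component vanishes. Its residual for `ρ b`
  -- is a multiple of `ρ b - ρ a`, so a small gap would make D small. Weighted orthogonality,
  -- together with the lower bound for first components, keeps D away from zero.
  let D : Fin N → ℝ := fun i => P z a * P i b - P z b * P i a
  have hD : ∀ i, (tri N c d).mulVec D i - ρ b * D i = P z b * (ρ b - ρ a) * P i a := by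
    intro i
    have e1 : D = P z a • (fun k => P k b) - P z b • (fun k => P k a) := by
      funext k; simp [D]
    have e2 : (tri N c d).mulVec D i = P z a * (ρ b * P i b) - P z b * (ρ a * P i a) := by
      rw [e1, Matrix.mulVec_sub, Matrix.mulVec_smul, Matrix.mulVec_smul]
      simp only [Pi.sub_apply, Pi.smul_apply, smul_eq_mul, e.mulVec_col]
    rw [e2]
    simp only [D]
    ring
  have hDz : D z = 0 := by simp only [D]; ring
  have hDle : ∀ i, |D i| ≤ Q * |ρ a - ρ b| := by
    intro i
    have := h.abs_le_of_residual hN (e.abs_eigenvalue_le h b) (v := D) (η := |ρ a - ρ b|)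
      (fun i => by
        rw [hD, abs_mul, abs_mul, abs_sub_comm (ρ b)]
        have h1 := e.abs_le_one z b
        have h2 := e.abs_le_one i a
        have h3 := abs_nonneg (ρ a - ρ b)
        calc _ ≤ 1 * |ρ a - ρ b| * 1 := by gcongr
          _ = _ := by ring) i
    rwa [← hz, hDz, abs_zero, zero_add] at this
  have hfirst := e.first_component h hN
  rw [← hz, ← hQ] at hfirst
  have hza : P z a ≠ 0 := fun h0 => by
    have := hfirst a
    rw [h0] at this
    norm_num at this
  -- Orthogonality presupposes distinct eigenvalues, so coincidence is excluded first: it would give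
  -- D = 0, a linear relation between two columns of an invertible matrix.
  have hne : ρ a ≠ ρ b := by
    intro heq
    have hD0 : ∀ i, D i = 0 := fun i => by
      have := hDle i
      rw [heq, sub_self, abs_zero, mul_zero] at this
      exact abs_nonpos_iff.1 this
    have h1 : P.mulVec (Pi.single b (P z a) - Pi.single a (P z b)) = 0 := by
      funext i
      rw [Matrix.mulVec_sub, Matrix.mulVec_single, Matrix.mulVec_single]
      simpa [D, mul_comm] using hD0 i
    have h2 := (Matrix.mulVec_injective_iff_isUnit.2 e.isUnit)
      (h1.trans (Matrix.mulVec_zero P).symm)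
    have h3 := congrFun h2 b
    simp [hab.symm] at h3
    exact hza h3
  have horth := e.weighted_orthogonal h hne
  have hsum : ∑ i : Fin N, wt c d i * D i ^ 2 = P z a ^ 2 * (∑ i : Fin N, wt c d i * P i b ^ 2)
      + P z b ^ 2 * ∑ i : Fin N, wt c d i * P i a ^ 2 := by
    have : ∀ i : Fin N, wt c d i * D i ^ 2 = P z a ^ 2 * (wt c d i * P i b ^ 2)
        + P z b ^ 2 * (wt c d i * P i a ^ 2)
        - 2 * (P z a * P z b) * (wt c d i * P i a * P i b) := fun i => by simp only [D]; ring
    rw [Finset.sum_congr rfl fun i _ => this i, Finset.sum_sub_distrib, Finset.sum_add_distrib,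
      ← Finset.mul_sum, ← Finset.mul_sum, ← Finset.mul_sum, horth]
    ring
  have hlow : m / (N * Q ^ 2) ≤ ∑ i : Fin N, wt c d i * D i ^ 2 := by
    rw [hsum]
    have h1 := e.le_weighted_norm h hN b
    have h2 : 0 ≤ P z b ^ 2 * ∑ i : Fin N, wt c d i * P i a ^ 2 :=
      mul_nonneg (sq_nonneg _) (hm0.le.trans (e.le_weighted_norm h hN a))
    have h3 : 1 / (N * Q ^ 2) ≤ P z a ^ 2 := by
      rw [div_le_iff₀ (by positivity)]
      linarith [hfirst a]
    calc _ = 1 / (N * Q ^ 2) * m := by ring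
      _ ≤ P z a ^ 2 * ∑ i : Fin N, wt c d i * P i b ^ 2 := by gcongr
      _ ≤ _ := by linarith
  have hup : ∑ i : Fin N, wt c d i * D i ^ 2 ≤ N * (M * Q ^ 2) * |ρ a - ρ b| ^ 2 := by
    calc _ ≤ ∑ i : Fin N, M * (Q * |ρ a - ρ b|) ^ 2 := Finset.sum_le_sum fun i _ => by
          have h1 := h.wt_le hN i.2
          have h2 := pow_le_pow_left₀ (abs_nonneg _) (hDle i) 2
          rw [sq_abs] at h2
          exact mul_le_mul h1 h2 (sq_nonneg _) hM0.le
      _ = _ := by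
          rw [Finset.sum_const, Finset.card_univ, Fintype.card_fin, nsmul_eq_mul]; ring
  refine Real.sqrt_le_iff.2 ⟨abs_nonneg _, ?_⟩
  rw [div_le_iff₀ (by positivity)]
  linarith

theorem injective_eigenvalue (e : IsFrame (tri N c d) P ρ) (h : TriBounds N c d c₀ c₁)
    (hN : 1 ≤ N) {a b : Fin N} (hab : a ≠ b) : ρ a ≠ ρ b := by
  obtain ⟨g, hg, H⟩ := exists_gap hN h.pos (h.c₁_pos hN)
  intro heq
  have := H c d P ρ h e a b hab
  rw [heq, sub_self, abs_zero] at this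
  linarith

/-- By weighted orthogonality Pᵀ diag(wt) P is diagonal, which makes the inverse explicit. Bounds
and smoothness of P⁻¹ then follow from those of P and the weights, without any estimate of the
determinant. -/
theorem inv_apply (e : IsFrame (tri N c d) P ρ) (h : TriBounds N c d c₀ c₁) (hN : 1 ≤ N)
    (i j : Fin N) : P⁻¹ i j = P j i * wt c d j / ∑ k : Fin N, wt c d k * P k i ^ 2 := by
  have hm0 : 0 < (c₀ / c₁) ^ N := pow_pos (div_pos h.pos (h.c₁_pos hN)) N
  have hpos : ∀ i, 0 < ∑ k : Fin N, wt c d k * P k i ^ 2 := fun i =>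
    hm0.trans_le (e.le_weighted_norm h hN i)
  have key : (Matrix.of fun i j : Fin N => P j i * wt c d j / ∑ k : Fin N, wt c d k * P k i ^ 2) * P
      = 1 := by
    ext a b
    simp only [Matrix.mul_apply, Matrix.of_apply]
    have e1 : ∑ x : Fin N, P x a * wt c d x / (∑ k : Fin N, wt c d k * P k a ^ 2) * P x b
        = (∑ x : Fin N, wt c d x * P x a * P x b) / ∑ k : Fin N, wt c d k * P k a ^ 2 := by
      rw [Finset.sum_div]
      exact Finset.sum_congr rfl fun x _ => by ring
    rw [e1]
    by_cases hab : a = b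
    · subst hab
      rw [Matrix.one_apply_eq, div_eq_one_iff_eq (hpos a).ne']
      exact Finset.sum_congr rfl fun x _ => by ring
    · rw [Matrix.one_apply_ne hab, e.weighted_orthogonal h (e.injective_eigenvalue h hN hab),
        zero_div]
  rw [Matrix.inv_eq_left_inv key]
  rfl

theorem abs_inv_le (e : IsFrame (tri N c d) P ρ) (h : TriBounds N c d c₀ c₁) (hN : 1 ≤ N)
    (i j : Fin N) : |P⁻¹ i j| ≤ (c₁ / c₀) ^ N / (c₀ / c₁) ^ N := by
  have hc₀ := h.pos
  have hc₁ := h.c₁_pos hN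
  have hm0 : 0 < (c₀ / c₁) ^ N := by positivity
  have h1 := e.le_weighted_norm h hN i
  rw [e.inv_apply h hN, abs_div, abs_mul, abs_of_pos (h.wt_pos j.2),
    abs_of_pos (hm0.trans_le h1)]
  refine div_le_div₀ (by positivity) ?_ hm0 h1
  calc _ ≤ 1 * (c₁ / c₀) ^ N :=
        mul_le_mul (e.abs_le_one j i) (h.wt_le hN j.2) (h.wt_pos j.2).le zero_le_one
    _ = _ := one_mul _

/-- Coercivity is tested on the eigenvector itself: the quadratic form equals ρ times the weighted
norm, and the weights are bounded above. -/
theorem le_eigenvalue (e : IsFrame (tri N c d) P ρ) (h : TriBounds N c d c₀ c₁) (hN : 1 ≤ N)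
    (j : Fin N) : (c₀ / c₁) ^ N * c₀ / N ^ 2 / (c₁ / c₀) ^ N ≤ ρ j := by
  have hc₀ := h.pos
  have hc₁ := h.c₁_pos hN
  have hN0 : (0 : ℝ) < N := by exact_mod_cast hN
  have h1 := h.sum_wt_mul_mulVec hN (fun k => P k j)
  simp only [e.mulVec_col, e.unit_col, mul_one] at h1
  have h2 : ∑ i : Fin N, wt c d i * P i j * (ρ j * P i j)
      = ρ j * ∑ i : Fin N, wt c d i * P i j ^ 2 := by
    rw [Finset.mul_sum]
    exact Finset.sum_congr rfl fun i _ => by ring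
  rw [h2] at h1
  have h3 : ∑ i : Fin N, wt c d i * P i j ^ 2 ≤ (c₁ / c₀) ^ N := by
    calc _ ≤ ∑ i : Fin N, (c₁ / c₀) ^ N * P i j ^ 2 := Finset.sum_le_sum fun i _ =>
          mul_le_mul_of_nonneg_right (h.wt_le hN i.2) (sq_nonneg _)
      _ = _ := by rw [← Finset.mul_sum, e.unit_col, mul_one]
  have h4 : 0 < (c₀ / c₁) ^ N * c₀ / N ^ 2 := by positivity
  have h5 : 0 < ∑ i : Fin N, wt c d i * P i j ^ 2 :=
    (show 0 < (c₀ / c₁) ^ N by positivity).trans_le (e.le_weighted_norm h hN j)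
  have h6 : 0 < ρ j := by
    by_contra hneg
    have := mul_nonpos_of_nonpos_of_nonneg (not_lt.1 hneg) h5.le
    linarith
  rw [div_le_iff₀ (by positivity)]
  exact h1.trans (mul_le_mul_of_nonneg_left h3 h6.le)

/-- The ordered eigenvalues are Lipschitz functions of the entries. -/
theorem exists_lipschitz (hN : 1 ≤ N) (hc₀ : 0 < c₀) (hc₁ : 0 < c₁) :
    ∃ L, 0 ≤ L ∧ ∀ (c d c' d' : ℕ → ℝ) (P P' : Matrix (Fin N) (Fin N) ℝ) (ρ ρ' : Fin N → ℝ) (Δ : ℝ),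
      TriBounds N c d c₀ c₁ → TriBounds N c' d' c₀ c₁ →
      IsFrame (tri N c d) P ρ → IsFrame (tri N c' d') P' ρ' →
      (∀ i j, |tri N c d i j - tri N c' d' i j| ≤ Δ) → ∀ i, |ρ i - ρ' i| ≤ L * Δ := by
  obtain ⟨g, hg, hgap⟩ := exists_gap hN hc₀ hc₁
  have hN0 : (0 : ℝ) < N := by exact_mod_cast hN
  set p := (c₁ / c₀) ^ N / (c₀ / c₁) ^ N with hp
  have hp0 : 0 < p := by positivity
  set L₁ := (N : ℝ) * N * (N * (p * N)) with hL₁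
  have hL₁0 : 0 < L₁ := by positivity
  refine ⟨L₁ + 20 * c₁ * L₁ / g, by positivity, ?_⟩
  intro c d c' d' P P' ρ ρ' Δ h h' e e' hΔ
  have hΔ0 : 0 ≤ Δ := (abs_nonneg _).trans (hΔ ⟨0, hN⟩ ⟨0, hN⟩)
  have hdet : IsUnit P.det := (Matrix.isUnit_iff_isUnit_det P).1 e.isUnit
  -- The j-th eigenvector of the second matrix is expanded in the first frame with coefficients y.
  -- It is an approximate eigenvector of the first matrix with residual of order Δ, so (ρ i - ρ' j)
  -- y i is of order Δ for every i; the index of the largest coefficient is the one to take.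
  have hclose : ∀ j, ∃ i, |ρ i - ρ' j| ≤ L₁ * Δ := by
    intro j
    set x : Fin N → ℝ := fun k => P' k j with hx
    set y : Fin N → ℝ := P⁻¹.mulVec x with hy
    have hPy : P.mulVec y = x := by
      rw [hy, Matrix.mulVec_mulVec, Matrix.mul_nonsing_inv P hdet, Matrix.one_mulVec]
    set r : Fin N → ℝ := fun i => (tri N c d).mulVec x i - (tri N c' d').mulVec x i with hr
    have hrle : ∀ i, |r i| ≤ N * Δ := by
      intro i
      have e1 : r i = ∑ k, (tri N c d i k - tri N c' d' i k) * x k := by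
        simp only [hr, Matrix.mulVec, dotProduct, ← Finset.sum_sub_distrib, sub_mul]
      rw [e1]
      refine (Finset.abs_sum_le_sum_abs _ _).trans ?_
      calc _ ≤ ∑ k : Fin N, Δ := Finset.sum_le_sum fun k _ => by
            rw [abs_mul]
            calc _ ≤ Δ * 1 := mul_le_mul (hΔ i k) (e'.abs_le_one k j) (abs_nonneg _) hΔ0
              _ = Δ := mul_one _
        _ = _ := by rw [Finset.sum_const, Finset.card_univ, Fintype.card_fin, nsmul_eq_mul]
    have hΛy : ∀ i, (ρ i - ρ' j) * y i = P⁻¹.mulVec r i := by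
      intro i
      have e1 : (tri N c d).mulVec x = P.mulVec (fun i => ρ i * y i) := by
        rw [← hPy, Matrix.mulVec_mulVec, e.eigen, ← Matrix.mulVec_mulVec]
        congr 1
        funext k
        rw [Matrix.mulVec_diagonal]
      have e2 : r = P.mulVec (fun i => ρ i * y i) - ρ' j • x := by
        rw [← e1]
        funext k
        simp only [hr, Pi.sub_apply, Pi.smul_apply, smul_eq_mul]
        rw [e'.mulVec_col k j]
      rw [e2, Matrix.mulVec_sub, Matrix.mulVec_mulVec, Matrix.nonsing_inv_mul P hdet,
        Matrix.one_mulVec, Matrix.mulVec_smul, ← hy]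
      simp only [Pi.sub_apply, Pi.smul_apply, smul_eq_mul]
      ring
    have hinvr : ∀ i, |P⁻¹.mulVec r i| ≤ N * (p * (N * Δ)) := by
      intro i
      simp only [Matrix.mulVec, dotProduct]
      refine (Finset.abs_sum_le_sum_abs _ _).trans ?_
      calc _ ≤ ∑ k : Fin N, p * (N * Δ) := Finset.sum_le_sum fun k _ => by
            rw [abs_mul]
            exact mul_le_mul (e.abs_inv_le h hN i k) (hrle k) (abs_nonneg _) hp0.le
        _ = _ := by rw [Finset.sum_const, Finset.card_univ, Fintype.card_fin, nsmul_eq_mul]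
    obtain ⟨i, -, hi⟩ := Finset.exists_max_image Finset.univ (fun i => |y i|)
      ⟨j, Finset.mem_univ j⟩
    have hyi : 1 / ((N : ℝ) * N) ≤ |y i| := by
      have hxle : ∀ k, |x k| ≤ N * |y i| := by
        intro k
        rw [← hPy]
        simp only [Matrix.mulVec, dotProduct]
        refine (Finset.abs_sum_le_sum_abs _ _).trans ?_
        calc _ ≤ ∑ m : Fin N, |y i| := Finset.sum_le_sum fun m _ => by
              rw [abs_mul]
              calc _ ≤ 1 * |y i| := mul_le_mul (e.abs_le_one k m) (hi m (Finset.mem_univ m))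
                    (abs_nonneg _) zero_le_one
                _ = _ := one_mul _
          _ = _ := by rw [Finset.sum_const, Finset.card_univ, Fintype.card_fin, nsmul_eq_mul]
      have h1 : 1 ≤ (N : ℝ) * (N * |y i|) := by
        rw [← e'.unit_col j]
        calc _ ≤ ∑ k : Fin N, N * |y i| := Finset.sum_le_sum fun k _ => by
              have h2 := e'.abs_le_one k j
              have h3 : P' k j ^ 2 ≤ |P' k j| := by
                rw [← sq_abs]; nlinarith [abs_nonneg (P' k j)]
              exact h3.trans (hxle k)
          _ = _ := by rw [Finset.sum_const, Finset.card_univ, Fintype.card_fin, nsmul_eq_mul]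
      rw [div_le_iff₀ (by positivity)]
      linarith
    refine ⟨i, ?_⟩
    have h1 : |ρ i - ρ' j| * |y i| ≤ N * (p * (N * Δ)) := by
      rw [← abs_mul, hΛy]; exact hinvr i
    have h2 : |ρ i - ρ' j| * (1 / ((N : ℝ) * N)) ≤ N * (p * (N * Δ)) :=
      (mul_le_mul_of_nonneg_left hyi (abs_nonneg _)).trans h1
    rw [mul_one_div, div_le_iff₀ (by positivity)] at h2
    rw [hL₁]
    linarith
  intro i
  by_cases hsmall : 2 * (L₁ * Δ) < g
  -- If Δ is small against the gap, the assignment of nearest eigenvalues must respect the order. A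
  -- strictly monotone self-map of `Fin N` is the identity.
  · choose f hf using hclose
    have hmono : StrictMono f := by
      intro a b hab
      by_contra hle
      have h1 : ρ (f a) ≤ ρ (f b) := e.antitone (not_lt.1 hle)
      have h2 : ρ' b ≤ ρ' a := e'.antitone hab.le
      have h3 := hgap c' d' P' ρ' h' e' a b hab.ne
      rw [abs_of_nonneg (sub_nonneg.2 h2)] at h3
      have h4 := abs_le.1 (hf a)
      have h5 := abs_le.1 (hf b)
      linarith [h4.1, h4.2, h5.1, h5.2]
    have hid : f i = i := le_antisymm hmono.apply_le hmono.le_apply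
    have h1 := hf i
    rw [hid] at h1
    refine h1.trans (mul_le_mul_of_nonneg_right ?_ hΔ0)
    have : 0 ≤ 20 * c₁ * L₁ / g := by positivity
    linarith
  -- For Δ not small, the trivial bound 10 c₁ for the difference is already a multiple of Δ.
  · have h1 := abs_sub (ρ i) (ρ' i)
    have h2 := e.abs_eigenvalue_le h i
    have h3 := e'.abs_eigenvalue_le h' i
    have h4 : 10 * c₁ ≤ 20 * c₁ * L₁ / g * Δ := by
      rw [div_mul_eq_mul_div, le_div_iff₀ hg]
      have := mul_le_mul_of_nonneg_left (not_lt.1 hsmall) (by positivity : 0 ≤ 10 * c₁)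
      linarith
    have h5 : 0 ≤ L₁ * Δ := by positivity
    rw [add_mul]
    linarith

end IsFrame

end Eigenframe

/-! ### Uniform C² bounds for eigenframes -/

section FrameFamilies

variable {N : ℕ}

/-- A family of tridiagonal matrices with uniformly controlled entries, and a `C²` eigenframe. -/
structure FrameFamily (I : Set ℝ) (ℓ : ℝ) (N : ℕ) (c₀ c₁ : ℝ) (c d : ℕ → ℝ → ℝ → ℝ)
    (P : ℝ → ℝ → Matrix (Fin N) (Fin N) ℝ) (ρ : ℝ → ℝ → Fin N → ℝ) : Prop where
  one_le : 1 ≤ N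
  tame_c : ∀ k < N, Tame I ℓ (c k)
  tame_d : ∀ k < N, Tame I ℓ (d k)
  bounds : ∀ ε ∈ I, ∀ θ, TriBounds N (fun k => c k ε θ) (fun k => d k ε θ) c₀ c₁
  frame : ∀ ε ∈ I, ∀ θ, IsFrame (tri N (fun k => c k ε θ) (fun k => d k ε θ)) (P ε θ) (ρ ε θ)
  contDiff : ∀ ε ∈ I, ∀ i j, ContDiff ℝ 2 fun θ => P ε θ i j

namespace FrameFamily

variable {I : Set ℝ} {ℓ c₀ c₁ : ℝ} {c d : ℕ → ℝ → ℝ → ℝ}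
  {P : ℝ → ℝ → Matrix (Fin N) (Fin N) ℝ} {ρ : ℝ → ℝ → Fin N → ℝ}

/-- The matrix at the parameter `ε` and the point `θ`. -/
def mat (N : ℕ) (c d : ℕ → ℝ → ℝ → ℝ) (ε θ : ℝ) : Matrix (Fin N) (Fin N) ℝ :=
  tri N (fun k => c k ε θ) (fun k => d k ε θ)

theorem tame_mat (h : FrameFamily I ℓ N c₀ c₁ c d P ρ) (i j : Fin N) :
    Tame I ℓ fun ε θ => mat N c d ε θ i j := by
  simp only [mat, tri, Matrix.of_apply]
  split_ifs
  · exact ((Tame.const 2).mul (h.tame_c i i.2)).add (h.tame_d i i.2)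
  · exact ((Tame.const 1).mul (h.tame_c i i.2)).add (h.tame_d i i.2)
  · exact (h.tame_c i i.2).neg
  · exact (h.tame_d i i.2).neg
  · exact Tame.const 0

theorem uc_wt (h : FrameFamily I ℓ N c₀ c₁ c d P ρ) {k : ℕ} (hk : k < N) :
    UC I 2 fun ε θ => wt (fun k => c k ε θ) (fun k => d k ε θ) k := by
  induction k with
  | zero => exact UC.const 1
  | succ k ih =>
    simp only [wt]
    refine ((ih (by omega)).mul (h.tame_d k (by omega)).uc).div (h.tame_c _ hk).uc ?_
    -- Positivity of `c₀` is recorded only inside the bounds at some ε in I; over an empty parameter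
    -- set the claim is vacuous.
    rcases I.eq_empty_or_nonempty with hI | ⟨ε, hε⟩
    · exact ⟨1, one_pos, fun ε hε => by simp [hI] at hε⟩
    · exact ⟨c₀, (h.bounds ε hε 0).pos, fun ε hε θ => (h.bounds ε hε θ).c_lo _ hk⟩

theorem c₀_pos (h : FrameFamily I ℓ N c₀ c₁ c d P ρ) {ε : ℝ} (hε : ε ∈ I) : 0 < c₀ :=
  (h.bounds ε hε 0).pos

theorem c₁_pos (h : FrameFamily I ℓ N c₀ c₁ c d P ρ) {ε : ℝ} (hε : ε ∈ I) : 0 < c₁ :=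
  (h.bounds ε hε 0).c₁_pos h.one_le

theorem uc_zero (h : FrameFamily I ℓ N c₀ c₁ c d P ρ) (i j : Fin N) :
    UC I 0 fun ε θ => P ε θ i j :=
  ⟨fun ε hε => (h.contDiff ε hε i j).continuous, 1, fun ε hε θ => (h.frame ε hε θ).abs_le_one i j⟩

theorem uc_inv (h : FrameFamily I ℓ N c₀ c₁ c d P ρ) {n : ℕ} (hn : n ≤ 2)
    (hP : ∀ i j, UC I n fun ε θ => P ε θ i j) (i j : Fin N) :
    UC I n fun ε θ => (P ε θ)⁻¹ i j := by
  have hw : ∀ k : Fin N, UC I n fun ε θ => wt (fun k => c k ε θ) (fun k => d k ε θ) k :=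
    fun k => (h.uc_wt k.2).of_le hn
  refine UC.congr (f := fun ε θ => P ε θ j i * wt (fun k => c k ε θ) (fun k => d k ε θ) j /
    ∑ k : Fin N, wt (fun k => c k ε θ) (fun k => d k ε θ) k * (P ε θ k i * P ε θ k i)) ?_ ?_
  · refine ((hP j i).mul (hw j)).div
      (UC.sum _ fun k _ => (hw k).mul ((hP k i).mul (hP k i))) ?_
    rcases I.eq_empty_or_nonempty with hI | ⟨ε, hε⟩
    · exact ⟨1, one_pos, fun ε hε => by simp [hI] at hε⟩
    · refine ⟨(c₀ / c₁) ^ N, pow_pos (div_pos (h.c₀_pos hε) (h.c₁_pos hε)) N, fun ε hε θ => ?_⟩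
      simpa only [sq] using (h.frame ε hε θ).le_weighted_norm (h.bounds ε hε θ) h.one_le i
  · intro ε hε
    funext θ
    rw [(h.frame ε hε θ).inv_apply (h.bounds ε hε θ) h.one_le]
    simp only [sq]

/-- Columns have unit length, so the eigenvalue is pᵀ B p. It therefore inherits the regularity of P
and of the entries; no smoothness of ρ is assumed. -/
theorem eigenvalue_eq (h : FrameFamily I ℓ N c₀ c₁ c d P ρ) {ε : ℝ} (hε : ε ∈ I) (θ : ℝ)
    (j : Fin N) : ρ ε θ j = ∑ i, ∑ k, P ε θ i j * (mat N c d ε θ i k * P ε θ k j) := by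
  have e := h.frame ε hε θ
  have h1 : ∀ i, ∑ k, P ε θ i j * (mat N c d ε θ i k * P ε θ k j) = ρ ε θ j * P ε θ i j ^ 2 := by
    intro i
    rw [← Finset.mul_sum]
    have := e.mulVec_col i j
    simp only [Matrix.mulVec, dotProduct] at this
    unfold mat
    rw [this]
    ring
  rw [Finset.sum_congr rfl fun i _ => h1 i, ← Finset.mul_sum, e.unit_col, mul_one]

theorem uc_eigenvalue (h : FrameFamily I ℓ N c₀ c₁ c d P ρ) {n : ℕ} (hn : n ≤ 2)
    (hP : ∀ i j, UC I n fun ε θ => P ε θ i j) (j : Fin N) : UC I n fun ε θ => ρ ε θ j := by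
  refine UC.congr (f := fun ε θ => ∑ i, ∑ k, P ε θ i j * (mat N c d ε θ i k * P ε θ k j)) ?_
    fun ε hε => funext fun θ => (h.eigenvalue_eq hε θ j).symm
  exact UC.sum _ fun i _ => UC.sum _ fun k _ =>
    (hP i j).mul (((h.tame_mat i k).uc.of_le hn).mul (hP k j))

/-- The logarithmic derivative `P⁻¹ P'` of the frame. -/
def logDer (P : ℝ → ℝ → Matrix (Fin N) (Fin N) ℝ) (ε θ : ℝ) : Matrix (Fin N) (Fin N) ℝ :=
  (P ε θ)⁻¹ * Matrix.of fun i j => deriv (fun t => P ε t i j) θ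

theorem deriv_eq (h : FrameFamily I ℓ N c₀ c₁ c d P ρ) {ε : ℝ} (hε : ε ∈ I) (θ : ℝ)
    (i j : Fin N) : deriv (fun t => P ε t i j) θ = ∑ k, P ε θ i k * logDer P ε θ k j := by
  have hdet : IsUnit (P ε θ).det :=
    (Matrix.isUnit_iff_isUnit_det _).1 (h.frame ε hε θ).isUnit
  have h1 : P ε θ * logDer P ε θ = Matrix.of fun i j => deriv (fun t => P ε t i j) θ := by
    rw [logDer, ← Matrix.mul_assoc, Matrix.mul_nonsing_inv _ hdet, Matrix.one_mul]
  have h2 := congrFun (congrFun h1 i) j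
  rw [Matrix.mul_apply] at h2
  rw [h2]
  rfl

/-- Differentiate B P = P diag ρ and multiply by P⁻¹: off the diagonal ρ' drops out, and (ρ_j -
ρ_i)(P⁻¹P')_ij = (P⁻¹B'P)_ij. The right-hand side contains no derivative of P. -/
theorem logDer_offDiag (h : FrameFamily I ℓ N c₀ c₁ c d P ρ) {ε : ℝ} (hε : ε ∈ I) (θ : ℝ)
    {i j : Fin N} (hij : i ≠ j) :
    logDer P ε θ i j = (∑ a, ∑ b, (P ε θ)⁻¹ i a *
      (deriv (fun t => mat N c d ε t a b) θ * P ε θ b j)) * (ρ ε θ j - ρ ε θ i)⁻¹ := by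
  have e := h.frame ε hε θ
  have hdet : IsUnit (P ε θ).det := (Matrix.isUnit_iff_isUnit_det _).1 e.isUnit
  have hPd : ∀ a b, HasDerivAt (fun t => P ε t a b) (deriv (fun t => P ε t a b) θ) θ := fun a b =>
    ((h.contDiff ε hε a b).differentiable (by norm_num) θ).hasDerivAt
  have hBd : ∀ a b, HasDerivAt (fun t => mat N c d ε t a b)
      (deriv (fun t => mat N c d ε t a b) θ) θ := fun a b => (h.tame_mat a b).uc.hasDerivAt hε θ
  obtain ⟨ρ', hρ'⟩ : ∃ ρ', HasDerivAt (fun t => ρ ε t j) ρ' θ := by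
    rw [funext fun t => h.eigenvalue_eq hε t j]
    exact ⟨_, HasDerivAt.fun_sum fun i _ => HasDerivAt.fun_sum fun k _ =>
      (hPd i j).fun_mul ((hBd i k).fun_mul (hPd k j))⟩
  set P' : Matrix (Fin N) (Fin N) ℝ := Matrix.of fun i j => deriv (fun t => P ε t i j) θ with hP'
  set B' : Matrix (Fin N) (Fin N) ℝ := Matrix.of fun a b => deriv (fun t => mat N c d ε t a b) θ
    with hB'
  have hrow : ∀ a, (B' * P ε θ) a j + (mat N c d ε θ * P') a j
      = P' a j * ρ ε θ j + P ε θ a j * ρ' := by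
    intro a
    have h1 : HasDerivAt (fun t => ∑ k, mat N c d ε t a k * P ε t k j)
        (∑ k, (deriv (fun t => mat N c d ε t a k) θ * P ε θ k j
          + mat N c d ε θ a k * deriv (fun t => P ε t k j) θ)) θ :=
      HasDerivAt.fun_sum fun k _ => (hBd a k).fun_mul (hPd k j)
    have h2 : (fun t => ∑ k, mat N c d ε t a k * P ε t k j) = fun t => P ε t a j * ρ ε t j := by
      funext t
      have := (h.frame ε hε t).mulVec_col a j
      simp only [Matrix.mulVec, dotProduct] at this
      unfold mat
      rw [this, mul_comm]
    rw [h2] at h1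
    have h3 := h1.unique ((hPd a j).fun_mul hρ')
    rw [Finset.sum_add_distrib] at h3
    simp only [Matrix.mul_apply, hB', hP', Matrix.of_apply]
    exact h3
  have hPB : (P ε θ)⁻¹ * mat N c d ε θ = Matrix.diagonal (ρ ε θ) * (P ε θ)⁻¹ := by
    have h1 : mat N c d ε θ = P ε θ * Matrix.diagonal (ρ ε θ) * (P ε θ)⁻¹ := by
      rw [← e.eigen, Matrix.mul_assoc, Matrix.mul_nonsing_inv _ hdet, Matrix.mul_one]
      rfl
    rw [h1, ← Matrix.mul_assoc, ← Matrix.mul_assoc, Matrix.nonsing_inv_mul _ hdet, Matrix.one_mul]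
  have hfull : ((P ε θ)⁻¹ * (B' * P ε θ)) i j + ρ ε θ i * logDer P ε θ i j
      = logDer P ε θ i j * ρ ε θ j := by
    have h1 : ((P ε θ)⁻¹ * (mat N c d ε θ * P')) i j = ρ ε θ i * logDer P ε θ i j := by
      rw [← Matrix.mul_assoc, hPB, Matrix.mul_assoc, Matrix.diagonal_mul]
      rfl
    have h2 : ((P ε θ)⁻¹ * P ε θ) i j = 0 := by
      rw [Matrix.nonsing_inv_mul _ hdet, Matrix.one_apply_ne hij]
    rw [← h1]
    simp only [logDer]
    rw [Matrix.mul_apply, Matrix.mul_apply, Matrix.mul_apply, ← Finset.sum_add_distrib]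
    rw [Matrix.mul_apply] at h2
    calc _ = ∑ a, (P ε θ)⁻¹ i a * (P' a j * ρ ε θ j + P ε θ a j * ρ') :=
          Finset.sum_congr rfl fun a _ => by rw [← hrow a]; ring
      _ = (∑ a, (P ε θ)⁻¹ i a * P' a j) * ρ ε θ j + (∑ a, (P ε θ)⁻¹ i a * P ε θ a j) * ρ' := by
          rw [Finset.sum_mul, Finset.sum_mul, ← Finset.sum_add_distrib]
          exact Finset.sum_congr rfl fun a _ => by ring
      _ = _ := by rw [h2, zero_mul, add_zero]
  have hne : ρ ε θ j - ρ ε θ i ≠ 0 := sub_ne_zero.2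
    (e.injective_eigenvalue (h.bounds ε hε θ) h.one_le hij.symm)
  have hexp : ((P ε θ)⁻¹ * (B' * P ε θ)) i j = ∑ a, ∑ b, (P ε θ)⁻¹ i a *
      (deriv (fun t => mat N c d ε t a b) θ * P ε θ b j) := by
    simp only [Matrix.mul_apply, Finset.mul_sum, hB', Matrix.of_apply]
  rw [← hexp, eq_mul_inv_iff_mul_eq₀ hne]
  linarith

/-- The eigenvalue equation leaves the diagonal free; it is fixed by differentiating the
normalization |p_j|² = 1. The columns need not be orthogonal in the Euclidean product, so
off-diagonal entries reappear. -/
theorem logDer_diag (h : FrameFamily I ℓ N c₀ c₁ c d P ρ) {ε : ℝ} (hε : ε ∈ I) (θ : ℝ)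
    (j : Fin N) : logDer P ε θ j j = -∑ k ∈ Finset.univ.erase j,
      (∑ i, P ε θ i j * P ε θ i k) * logDer P ε θ k j := by
  have hPd : ∀ a b, HasDerivAt (fun t => P ε t a b) (deriv (fun t => P ε t a b) θ) θ := fun a b =>
    ((h.contDiff ε hε a b).differentiable (by norm_num) θ).hasDerivAt
  have h1 : HasDerivAt (fun t => ∑ i, P ε t i j * P ε t i j)
      (∑ i, (deriv (fun t => P ε t i j) θ * P ε θ i j + P ε θ i j * deriv (fun t => P ε t i j) θ))
      θ := HasDerivAt.fun_sum fun i _ => (hPd i j).fun_mul (hPd i j)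
  have h2 : (fun t => ∑ i, P ε t i j * P ε t i j) = fun _ => 1 := by
    funext t
    rw [← (h.frame ε hε t).unit_col j]
    exact Finset.sum_congr rfl fun i _ => (sq _).symm
  rw [h2] at h1
  have h3 := h1.unique (hasDerivAt_const θ (1 : ℝ))
  have h4 : ∑ i, P ε θ i j * deriv (fun t => P ε t i j) θ = 0 := by
    have : ∑ i, (deriv (fun t => P ε t i j) θ * P ε θ i j
        + P ε θ i j * deriv (fun t => P ε t i j) θ)
        = 2 * ∑ i, P ε θ i j * deriv (fun t => P ε t i j) θ := by
      rw [Finset.mul_sum]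
      exact Finset.sum_congr rfl fun i _ => by ring
    rw [this] at h3
    linarith
  have h5 : ∑ k, (∑ i, P ε θ i j * P ε θ i k) * logDer P ε θ k j = 0 := by
    rw [← h4]
    simp only [h.deriv_eq hε θ, Finset.mul_sum, Finset.sum_mul]
    rw [Finset.sum_comm]
    exact Finset.sum_congr rfl fun i _ => Finset.sum_congr rfl fun k _ => by ring
  rw [← Finset.add_sum_erase _ _ (Finset.mem_univ j)] at h5
  have h6 : ∑ i, P ε θ i j * P ε θ i j = 1 := congrFun h2 θ
  rw [h6, one_mul] at h5
  linarith

theorem exists_gap (h : FrameFamily I ℓ N c₀ c₁ c d P ρ) :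
    ∃ g > 0, ∀ ε ∈ I, ∀ θ, ∀ i j, i ≠ j → g ≤ |ρ ε θ i - ρ ε θ j| := by
  rcases I.eq_empty_or_nonempty with hI | ⟨ε, hε⟩
  · exact ⟨1, one_pos, fun ε hε => by simp [hI] at hε⟩
  · obtain ⟨g, hg, H⟩ := IsFrame.exists_gap h.one_le (h.c₀_pos hε) (h.c₁_pos hε)
    exact ⟨g, hg, fun ε hε θ i j hij => H _ _ _ _ (h.bounds ε hε θ) (h.frame ε hε θ) i j hij⟩

theorem uc_logDer (h : FrameFamily I ℓ N c₀ c₁ c d P ρ) {n : ℕ} (hn : n ≤ 1)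
    (hP : ∀ i j, UC I n fun ε θ => P ε θ i j) (i j : Fin N) :
    UC I n fun ε θ => logDer P ε θ i j := by
  obtain ⟨g, hg, hgap⟩ := h.exists_gap
  have hn2 : n ≤ 2 := by omega
  have hoff : ∀ i j, i ≠ j → UC I n fun ε θ => logDer P ε θ i j := by
    intro i j hij
    refine UC.congr (f := fun ε θ => (∑ a, ∑ b, (P ε θ)⁻¹ i a *
      (deriv (fun t => mat N c d ε t a b) θ * P ε θ b j)) * (ρ ε θ j - ρ ε θ i)⁻¹) ?_
      fun ε hε => funext fun θ => (h.logDer_offDiag hε θ hij).symm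
    refine (UC.sum _ fun a _ => UC.sum _ fun b _ => (h.uc_inv hn2 hP i a).mul
      (((h.tame_mat a b).uc.deriv.of_le hn).mul (hP b j))).mul ?_
    exact UC.inv_of_abs hg (fun ε hε θ => hgap ε hε θ j i hij.symm)
      ((h.uc_eigenvalue hn2 hP j).sub (h.uc_eigenvalue hn2 hP i))
  by_cases hij : i = j
  · subst hij
    refine UC.congr (f := fun ε θ => -∑ k ∈ Finset.univ.erase i,
      (∑ a, P ε θ a i * P ε θ a k) * logDer P ε θ k i) ?_
      fun ε hε => funext fun θ => (h.logDer_diag hε θ i).symm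
    exact (UC.sum _ fun k hk => (UC.sum _ fun a _ => (hP a i).mul (hP a k)).mul
      (hoff k i (Finset.ne_of_mem_erase hk))).neg
  · exact hoff i j hij

/-- Bootstrap: P' = P (P⁻¹P'), and the formulas for P⁻¹P' involve P and B' but not P'. So a uniform
bound in Cⁿ yields one in Cⁿ⁺¹, up to the C² regularity of the entries; the start is |P| ≤ 1. -/
theorem uc_succ (h : FrameFamily I ℓ N c₀ c₁ c d P ρ) {n : ℕ} (hn : n ≤ 1)
    (hP : ∀ i j, UC I n fun ε θ => P ε θ i j) (i j : Fin N) :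
    UC I (n + 1) fun ε θ => P ε θ i j := by
  refine ⟨fun ε hε => (h.contDiff ε hε i j).differentiable (by norm_num), (hP i j).bdd, ?_⟩
  refine UC.congr (f := fun ε θ => ∑ k, P ε θ i k * logDer P ε θ k j) ?_
    fun ε hε => funext fun θ => (h.deriv_eq hε θ i j).symm
  exact UC.sum _ fun k _ => (hP i k).mul (h.uc_logDer hn hP k j)

theorem uc (h : FrameFamily I ℓ N c₀ c₁ c d P ρ) (i j : Fin N) : UC I 2 fun ε θ => P ε θ i j :=
  h.uc_succ le_rfl (h.uc_succ zero_le_one h.uc_zero) i j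

theorem uc_logDer_one (h : FrameFamily I ℓ N c₀ c₁ c d P ρ) (i j : Fin N) :
    UC I 1 fun ε θ => logDer P ε θ i j :=
  h.uc_logDer le_rfl (fun i j => (h.uc i j).of_succ) i j

theorem unifPos_eigenvalue (h : FrameFamily I ℓ N c₀ c₁ c d P ρ) (j : Fin N) :
    UnifPos I fun ε θ => ρ ε θ j := by
  rcases I.eq_empty_or_nonempty with hI | ⟨ε, hε⟩
  · exact ⟨1, one_pos, fun ε hε => by simp [hI] at hε⟩
  · have h0 := h.c₀_pos hε
    have h1 := h.c₁_pos hε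
    have h2 : (0 : ℝ) < N := by exact_mod_cast h.one_le
    exact ⟨_, by positivity, fun ε hε θ =>
      (h.frame ε hε θ).le_eigenvalue (h.bounds ε hε θ) h.one_le j⟩

/-- Dependence on ε and periodicity pass to the ordered eigenvalues because these are determined by
the matrix. Periodicity is the Lipschitz estimate with Δ = 0 at θ and θ + ℓ. The frame P itself is
assumed neither periodic nor regular in ε. -/
theorem tame_eigenvalue (h : FrameFamily I ℓ N c₀ c₁ c d P ρ) (j : Fin N) :
    Tame I ℓ fun ε θ => ρ ε θ j := by
  refine ⟨h.uc_eigenvalue le_rfl h.uc j, ?_, ?_⟩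
  · rcases I.eq_empty_or_nonempty with hI | ⟨ε, hε⟩
    · exact ⟨0, le_rfl, fun ε hε => by simp [hI] at hε⟩
    · obtain ⟨L, hL, H⟩ := IsFrame.exists_lipschitz h.one_le (h.c₀_pos hε) (h.c₁_pos hε)
      choose Lm hLm0 hLm using fun i j => (h.tame_mat i j).lip
      refine ⟨L * ∑ i, ∑ j, Lm i j, mul_nonneg hL (Finset.sum_nonneg fun i _ =>
        Finset.sum_nonneg fun j _ => hLm0 i j), fun ε hε ε' hε' θ => ?_⟩
      rw [mul_assoc]
      refine H _ _ _ _ _ _ _ _ _ (h.bounds ε hε θ) (h.bounds ε' hε' θ) (h.frame ε hε θ)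
        (h.frame ε' hε' θ) (fun a b => (hLm a b ε hε ε' hε' θ).trans ?_) j
      gcongr
      calc Lm a b ≤ ∑ j, Lm a j :=
            Finset.single_le_sum (f := Lm a) (fun j _ => hLm0 a j) (Finset.mem_univ b)
        _ ≤ _ := Finset.single_le_sum (f := fun a => ∑ j, Lm a j)
            (fun a _ => Finset.sum_nonneg fun j _ => hLm0 a j) (Finset.mem_univ a)
  · intro ε hε θ
    obtain ⟨L, hL, H⟩ := IsFrame.exists_lipschitz h.one_le (h.c₀_pos hε) (h.c₁_pos hε)
    have := H _ _ _ _ _ _ _ _ 0 (h.bounds ε hε (θ + ℓ)) (h.bounds ε hε θ)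
      (h.frame ε hε (θ + ℓ)) (h.frame ε hε θ) (fun a b => by
        have := (h.tame_mat a b).per ε hε θ
        simp only [mat] at this
        rw [this, sub_self, abs_zero]) j
    rw [mul_zero] at this
    exact sub_eq_zero.1 (abs_nonpos_iff.1 this)

end FrameFamily

end FrameFamilies

/-! ### Regularity and periodicity of the boundary data -/

theorem natCast_le_infty (n : ℕ) : (n : WithTop ℕ∞) ≤ ∞ := by
  have h : ((n : ℕ∞) : WithTop ℕ∞) ≤ ∞ := WithTop.coe_le_coe.2 le_top
  simpa using h

namespace Setting

variable (S : Setting)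

theorem c_mem_closure (θ : ℝ) : S.c θ ∈ closure S.Ω :=
  frontier_subset_closure (S.frontier_eq ▸ mem_range_self θ)

theorem Vloc_zero (θ : ℝ) : S.Vloc 0 θ = S.V (S.c θ) := by simp [Vloc]

theorem Vloc_zero_pos (θ : ℝ) : 0 < S.Vloc 0 θ := by
  rw [Vloc_zero]; exact S.V_pos _ (S.c_mem_closure θ)

theorem contDiff_Vloc_zero : ContDiff ℝ ∞ (S.Vloc 0) := by
  rw [funext S.Vloc_zero, ← contDiffOn_univ]
  exact S.V_smooth.comp S.c_smooth.contDiffOn fun θ _ => S.c_mem_closure θ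

theorem contDiff_deriv_c : ContDiff ℝ ∞ (deriv S.c) :=
  (contDiff_infty_iff_deriv.1 S.c_smooth).2

theorem contDiff_deriv_c_apply (i : Fin 2) : ContDiff ℝ ∞ fun θ => deriv S.c θ i :=
  contDiff_euclidean.1 S.contDiff_deriv_c i

theorem contDiff_ν : ContDiff ℝ ∞ S.ν := by
  rw [contDiff_euclidean]
  intro i
  fin_cases i
  · simpa [ν] using S.contDiff_deriv_c_apply 1
  · simpa [ν] using (S.contDiff_deriv_c_apply 0).neg

theorem contDiff_k : ContDiff ℝ ∞ S.k :=
  ((contDiff_infty_iff_deriv.1 S.contDiff_ν).2).inner ℝ S.contDiff_deriv_c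

theorem deriv_c_periodic : Function.Periodic (deriv S.c) S.ℓ := fun θ => by
  rw [← deriv_comp_add_const]
  exact congrArg (fun F => deriv F θ) (funext S.c_periodic)

theorem ν_periodic : Function.Periodic S.ν S.ℓ := fun θ => by
  simp only [ν, S.deriv_c_periodic θ]

theorem k_periodic : Function.Periodic S.k S.ℓ := fun θ => by
  have h : deriv S.ν (θ + S.ℓ) = deriv S.ν θ := by
    rw [← deriv_comp_add_const]
    exact congrArg (fun F => deriv F θ) (funext S.ν_periodic)
  simp only [k, h, S.deriv_c_periodic θ]

theorem Vloc_periodic (t : ℝ) : Function.Periodic (S.Vloc t) S.ℓ := fun θ => by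
  simp only [Vloc, S.c_periodic θ, S.ν_periodic θ]

theorem β₁_periodic : Function.Periodic S.β₁ S.ℓ := fun θ => by
  simp only [β₁, fun t => S.Vloc_periodic t θ]

/-- Since V is smooth only relative to the closure of the domain, its derivative there is a relative
one, f', which is locally C² along the boundary. The orientation condition says that short inward
normal segments stay in the domain, so the one-sided derivative equals f'(c θ) applied to -ν θ, a
composition of C² maps. -/
theorem contDiff_β₁ : ContDiff ℝ 2 S.β₁ := by
  rw [contDiff_iff_contDiffAt]
  intro θ₀
  have hV : ContDiffWithinAt ℝ (2 + 1) S.V (closure S.Ω) (S.c θ₀) :=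
    (S.V_smooth _ (S.c_mem_closure θ₀)).of_le (by
      have h := natCast_le_infty 3
      norm_num at h ⊢
      exact h)
  obtain ⟨u, hu, husub, -, f', hf', hf'c⟩ :=
    (contDiffWithinAt_succ_iff_hasFDerivWithinAt' (by norm_num)).1 hV
  rw [insert_eq_of_mem (S.c_mem_closure θ₀)] at hu
  have hcu : ∀ᶠ θ in 𝓝 θ₀, S.c θ ∈ u := by
    have h1 : Tendsto S.c (𝓝 θ₀) (𝓝[closure S.Ω] S.c θ₀) :=
      tendsto_nhdsWithin_iff.2 ⟨S.c_smooth.continuous.continuousAt,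
        Eventually.of_forall S.c_mem_closure⟩
    exact h1 hu
  have hcomp : ContDiffAt ℝ 2 (fun θ => f' (S.c θ)) θ₀ := by
    rw [← contDiffWithinAt_univ] at *
    exact hf'c.comp θ₀ ((S.c_smooth.of_le (natCast_le_infty 2)).contDiffAt.contDiffWithinAt)
      fun θ _ => S.c_mem_closure θ
  have hν : ContDiffAt ℝ 2 (fun θ => -S.ν θ) θ₀ :=
    (S.contDiff_ν.of_le (natCast_le_infty 2)).contDiffAt.neg
  refine (hcomp.clm_apply hν).congr_of_eventuallyEq ?_
  filter_upwards [hcu] with θ hθ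
  have hpath : HasDerivWithinAt (fun t : ℝ => S.c θ - t • S.ν θ) (-S.ν θ)
      {t | S.c θ - t • S.ν θ ∈ closure S.Ω} 0 := by
    have h1 : HasDerivAt (fun t : ℝ => S.c θ - t • S.ν θ) (-S.ν θ) 0 := by
      simpa using ((hasDerivAt_id (0 : ℝ)).smul_const (S.ν θ)).const_sub (S.c θ)
    exact h1.hasDerivWithinAt
  have hVd : HasFDerivWithinAt S.V (f' (S.c θ)) (closure S.Ω) (S.c θ - (0 : ℝ) • S.ν θ) := by
    simpa using hf' _ hθ
  have h2 := hVd.comp_hasDerivWithinAt (0 : ℝ) hpath fun t ht => ht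
  have h3 : {t | S.c θ - t • S.ν θ ∈ closure S.Ω} ∈ 𝓝[Ici 0] (0 : ℝ) := by
    rw [← Ioi_insert, nhdsWithin_insert]
    refine mem_sup.2 ⟨?_, ?_⟩
    · simpa using S.c_mem_closure θ
    · filter_upwards [S.c_oriented θ] with t ht using subset_closure ht.1
  exact (h2.mono_of_mem_nhdsWithin h3).derivWithin (uniqueDiffOn_Ici 0 0 self_mem_Ici)

theorem β_pos (θ : ℝ) : 0 < S.β θ := Real.sqrt_pos.2 (S.Vloc_zero_pos θ)

theorem β_sq (θ : ℝ) : S.β θ ^ 2 = S.Vloc 0 θ := Real.sq_sqrt (S.Vloc_zero_pos θ).le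

theorem contDiff_β : ContDiff ℝ 2 S.β :=
  (S.contDiff_Vloc_zero.of_le (natCast_le_infty 2)).sqrt fun θ => (S.Vloc_zero_pos θ).ne'

theorem β_periodic : Function.Periodic S.β S.ℓ := fun θ => by
  simp only [β, S.Vloc_periodic 0 θ]

end Setting

/-! ### Regularity and bounds of the matrix entries -/

section CoefficientFamilies

theorem UnifPos.of_periodic {I : Set ℝ} {g : ℝ → ℝ} {ℓ : ℝ} (hℓ : ℓ ≠ 0) (hg : Continuous g)
    (hp : Function.Periodic g ℓ) (hpos : ∀ θ, 0 < g θ) : UnifPos I fun _ => g := by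
  obtain ⟨_, ⟨θ₀, rfl⟩, h⟩ := (hp.compact_of_continuous hℓ hg).exists_isLeast (range_nonempty g)
  exact ⟨g θ₀, hpos θ₀, fun _ _ θ => h (mem_range_self θ)⟩

variable (S : Setting)

/-- The common value of the two sides of the system for `fbar`, divided by `6 √2 β²`. -/
def source (θ : ℝ) : ℝ :=
  (2 * Real.sqrt 2 / 3 * S.k θ - Real.sqrt 2 / 3 * (S.β₁ θ / S.β θ ^ 2))
    / (6 * Real.sqrt 2 * S.β θ ^ 2)

/-- The numerator is 2√2/3 times the generalized mean curvature; this is where its positivity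
enters. -/
theorem source_pos (hS : ∀ θ, 0 < S.meanCurv θ) (θ : ℝ) : 0 < source S θ := by
  have h1 := hS θ
  have h2 := S.β_pos θ
  have h3 : 2 * Real.sqrt 2 / 3 * S.k θ - Real.sqrt 2 / 3 * (S.β₁ θ / S.β θ ^ 2)
      = 2 * Real.sqrt 2 / 3 * S.meanCurv θ := by
    rw [Setting.meanCurv, ← S.β_sq]
    field_simp
  rw [source, h3]
  positivity

theorem tame_β (I : Set ℝ) : Tame I S.ℓ fun _ => S.β :=
  .of_periodic S.ℓ_pos.ne' S.contDiff_β S.β_periodic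

theorem unifPos_β (I : Set ℝ) : UnifPos I fun _ => S.β :=
  .of_periodic S.ℓ_pos.ne' S.contDiff_β.continuous S.β_periodic S.β_pos

theorem tame_source (I : Set ℝ) : Tame I S.ℓ fun _ => source S := by
  have hk : Tame I S.ℓ fun _ => S.k :=
    .of_periodic S.ℓ_pos.ne' (S.contDiff_k.of_le (natCast_le_infty 2)) S.k_periodic
  have hβ₁ : Tame I S.ℓ fun _ => S.β₁ := .of_periodic S.ℓ_pos.ne' S.contDiff_β₁ S.β₁_periodic
  have hβ_sq : Tame I S.ℓ fun _ θ => S.β θ ^ 2 := by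
    simpa only [sq] using (tame_β S I).mul (tame_β S I)
  have hβ_sq_pos : UnifPos I fun _ θ => S.β θ ^ 2 := by
    simpa only [sq] using (unifPos_β S I).mul (unifPos_β S I)
  exact (((Tame.const _).mul hk).sub ((Tame.const _).mul (hβ₁.div hβ_sq hβ_sq_pos))).div
    ((Tame.const _).mul hβ_sq) ((UnifPos.const (by positivity)).mul hβ_sq_pos)

theorem unifPos_source (hS : ∀ θ, 0 < S.meanCurv θ) (I : Set ℝ) : UnifPos I fun _ => source S :=
  .of_periodic S.ℓ_pos.ne' ((tame_source S {0}).uc.cont 0 rfl)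
    ((tame_source S {0}).per 0 rfl) (source_pos S hS)

variable {S} {N : ℕ} {p : Params} {ε₀ δ₀ δ K : ℝ}

theorem source_eq (hp : p.Admissible S N ε₀ δ₀ δ K) {ε : ℝ} (hε : ε ∈ Ioo 0 ε₀) {j : ℕ}
    (hj : j ∈ Finset.Icc 1 N) (θ : ℝ) :
    source S θ = γ₁ S N p ε j θ * dCoef S N p ε j θ
      - γ₂ S N p ε j θ * dCoef S N p ε (j + 1) θ := by
  have h2 := S.β_pos θ
  obtain ⟨hj1, hj2⟩ := Finset.mem_Icc.1 hj
  rw [source, hp.fbar_eq ε hε j hj θ, mul_div_cancel_left₀ _ (by positivity)]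
  have e1 : dCoef S N p ε (j + 1) θ = ((N : ℝ) - j) * Real.exp (-(Real.sqrt 2 * S.β θ *
            (p.fbar ε (j + 1) θ - p.fbar ε j θ))) := by
    unfold dCoef
    split_ifs with h
    · have : reflect (fun i => p.fbar ε i θ) (j + 1 - 1) = p.fbar ε j θ := by
        simp [reflect]; omega
      rw [this]
      push_cast
      ring
    -- For the last layer the exponential contains the meaningless value of `fbar` at N + 1, but its
    -- factor N - j vanishes, in agreement with d_{N+1} = 0.
    · have : j = N := by omega
      subst this
      simp
  rw [e1, dCoef, if_pos hj2]
  ring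

theorem abs_reflect_le {f : ℕ → ℝ} {A : ℝ} (hf : ∀ j ∈ Finset.Icc 1 N, |f j| ≤ A) {j : ℕ}
    (hj : j ∈ Finset.Icc 1 N) : |reflect f (j - 1)| ≤ A := by
  obtain ⟨hj1, hj2⟩ := Finset.mem_Icc.1 hj
  unfold reflect
  split_ifs with h
  · rw [abs_neg]; exact hf 1 (Finset.mem_Icc.2 ⟨le_rfl, by omega⟩)
  · exact hf _ (Finset.mem_Icc.2 ⟨by omega, by omega⟩)

theorem one_le_sub_add_one {j : ℕ} (hj : j ∈ Finset.Icc 1 N) : (1 : ℝ) ≤ (N : ℝ) - j + 1 := by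
  have : (j : ℝ) ≤ N := by exact_mod_cast (Finset.mem_Icc.1 hj).2
  linarith

theorem dCoef_bounds (hp : p.Admissible S N ε₀ δ₀ δ K) {j : ℕ} (hj : j ∈ Finset.Icc 1 N) :
    UnifPos (Ioo 0 ε₀) (fun ε => dCoef S N p ε j) ∧
      UnifBdd (Ioo 0 ε₀) (fun ε => dCoef S N p ε j) := by
  have hb : UnifBdd (Ioo 0 ε₀) fun ε θ => -(Real.sqrt 2 * S.β θ *
      (p.fbar ε j θ - reflect (fun i => p.fbar ε i θ) (j - 1))) := by
    refine (((UC.const (n := 0) (Real.sqrt 2)).bdd.mul (tame_β S _).uc.bdd).mul ?_).neg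
    refine ⟨K + K, fun ε hε θ => (abs_sub _ _).trans (add_le_add (hp.fbar_bound ε hε j hj θ) ?_)⟩
    exact abs_reflect_le (fun i hi => hp.fbar_bound ε hε i hi θ) hj
  have heq : ∀ ε ∈ Ioo 0 ε₀, (fun θ => ((N : ℝ) - j + 1) * Real.exp (-(Real.sqrt 2 * S.β θ *
      (p.fbar ε j θ - reflect (fun i => p.fbar ε i θ) (j - 1))))) = dCoef S N p ε j := by
    intro ε _
    funext θ
    rw [dCoef, if_pos (Finset.mem_Icc.1 hj).2]
  constructor
  · obtain ⟨a, ha, h⟩ := (UnifPos.const (I := Ioo 0 ε₀)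
      (zero_lt_one.trans_le (one_le_sub_add_one hj))).mul (UnifPos.exp hb)
    exact ⟨a, ha, fun ε hε θ => by
      have h1 : a ≤ dCoef S N p ε j θ := by rw [← heq ε hε]; exact h ε hε θ
      exact h1⟩
  · exact ((UC.const (n := 0) ((N : ℝ) - j + 1)).bdd.mul hb.exp).congr heq

theorem dCoef_nonneg (hp : p.Admissible S N ε₀ δ₀ δ K) {ε : ℝ} (hε : ε ∈ Ioo 0 ε₀) {j : ℕ}
    (hj : 1 ≤ j) (θ : ℝ) : 0 ≤ dCoef S N p ε j θ := by
  by_cases h : j ≤ N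
  · exact ((dCoef_bounds hp (Finset.mem_Icc.2 ⟨hj, h⟩)).1.pos hε θ).le
  · rw [dCoef, if_neg h]

theorem γ₂_nonneg (hp : p.Admissible S N ε₀ δ₀ δ K) {ε : ℝ} (hε : ε ∈ Ioo 0 ε₀) {j : ℕ}
    (hj : j ∈ Finset.Icc 1 N) (θ : ℝ) : 0 ≤ γ₂ S N p ε j θ :=
  integral_nonneg fun _ => mul_nonneg (mul_nonneg (hp.χ_mem ε hε j hj _ θ).1 (sq_nonneg _))
    (Real.exp_pos _).le

/-- The algebraic system reads γ₁ d_j = source + γ₂ d_{j+1}, and the last term is nonnegative. So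
positive curvature alone keeps γ₁ away from zero, on the full range of ε. -/
theorem unifPos_γ₁ (hS : ∀ θ, 0 < S.meanCurv θ) (hp : p.Admissible S N ε₀ δ₀ δ K) {j : ℕ}
    (hj : j ∈ Finset.Icc 1 N) : UnifPos (Ioo 0 ε₀) fun ε => γ₁ S N p ε j := by
  obtain ⟨hd, hdb⟩ := dCoef_bounds hp hj
  obtain ⟨a, ha, h⟩ := (unifPos_source S hS (Ioo 0 ε₀)).div hd hdb
  refine ⟨a, ha, fun ε hε θ => (h ε hε θ).trans ?_⟩
  rw [div_le_iff₀ (hd.pos hε θ), source_eq hp hε hj]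
  have := mul_nonneg (γ₂_nonneg hp hε hj θ) (dCoef_nonneg hp hε (Nat.le_add_left 1 j) θ)
  linarith

theorem tame_γ₁ (hp : p.Admissible S N ε₀ δ₀ δ K) {j : ℕ} (hj : j ∈ Finset.Icc 1 N) :
    Tame (Ioo 0 ε₀) S.ℓ fun ε => γ₁ S N p ε j := (hp.γ₁_C2 j hj).tame (hp.γ₁_lip j hj)

theorem tame_γ₂ (hp : p.Admissible S N ε₀ δ₀ δ K) {j : ℕ} (hj : j ∈ Finset.Icc 1 N) :
    Tame (Ioo 0 ε₀) S.ℓ fun ε => γ₂ S N p ε j := (hp.γ₂_C2 j hj).tame (hp.γ₂_lip j hj)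

theorem tame_fcheck (hp : p.Admissible S N ε₀ δ₀ δ K) {j : ℕ} (hj : j ∈ Finset.Icc 1 N) :
    Tame (Ioo 0 ε₀) S.ℓ fun ε => p.fcheck ε j := (hp.fcheck_C2 j hj).tame (hp.fcheck_lip j hj)

/-- `fbar` is only assumed bounded. The regularity of d_j is recovered from the algebraic system,
d_j = (source + γ₂ d_{j+1}) / γ₁, by downward recursion from d_{N+1} = 0; `i` measures the distance
from the top. -/
theorem tame_dCoef (hS : ∀ θ, 0 < S.meanCurv θ) (hp : p.Admissible S N ε₀ δ₀ δ K) (i : ℕ) :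
    ∀ j, 1 ≤ j → N + 1 ≤ j + i → Tame (Ioo 0 ε₀) S.ℓ fun ε => dCoef S N p ε j := by
  have hzero : ∀ j, ¬ j ≤ N → Tame (Ioo 0 ε₀) S.ℓ fun ε => dCoef S N p ε j := fun j hj =>
    (Tame.const 0).congr fun ε _ => by funext θ; rw [dCoef, if_neg hj]
  induction i with
  | zero => exact fun j _ hj => hzero j (by omega)
  | succ i ih =>
    intro j hj1 hj
    by_cases hjN : j ≤ N
    · have hjm : j ∈ Finset.Icc 1 N := Finset.mem_Icc.2 ⟨hj1, hjN⟩
      have h1 := unifPos_γ₁ hS hp hjm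
      refine Tame.congr (((tame_source S _).add ((tame_γ₂ hp hjm).mul
        (ih (j + 1) (by omega) (by omega)))).div (tame_γ₁ hp hjm) h1) fun ε hε => ?_
      funext θ
      rw [div_eq_iff (h1.pos hε θ).ne', source_eq hp hε hjm]
      ring
    · exact hzero j hjN

theorem kCoef_factor (hp : p.Admissible S N ε₀ δ₀ δ K) {j : ℕ} (hj : j ∈ Finset.Icc 1 N) :
    Tame (Ioo 0 ε₀) S.ℓ fun ε θ => -(Real.sqrt 2 * S.β θ *
      (p.fcheck ε j θ - reflect (fun i => p.fcheck ε i θ) (j - 1))) := by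
  obtain ⟨hj1, hj2⟩ := Finset.mem_Icc.1 hj
  refine (((Tame.const _).mul (tame_β S _)).mul ((tame_fcheck hp hj).sub ?_)).neg
  unfold reflect
  split_ifs with h
  · exact (tame_fcheck hp (Finset.mem_Icc.2 ⟨le_rfl, by omega⟩)).neg
  · exact tame_fcheck hp (Finset.mem_Icc.2 ⟨by omega, by omega⟩)

theorem tame_kCoef (hS : ∀ θ, 0 < S.meanCurv θ) (hp : p.Admissible S N ε₀ δ₀ δ K) {j : ℕ}
    (hj : 1 ≤ j) : Tame (Ioo 0 ε₀) S.ℓ fun ε => kCoef S N p ε j := by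
  by_cases hjN : j ≤ N
  · have hjm : j ∈ Finset.Icc 1 N := Finset.mem_Icc.2 ⟨hj, hjN⟩
    refine ((tame_dCoef hS hp (N + 1) j hj (by omega)).mul (kCoef_factor hp hjm).exp).congr
      fun ε _ => ?_
    funext θ
    rw [kCoef, if_pos hjN]
  · exact (Tame.const 0).congr fun ε _ => by funext θ; rw [kCoef, if_neg hjN]

theorem unifPos_kCoef (hp : p.Admissible S N ε₀ δ₀ δ K) {j : ℕ} (hj : j ∈ Finset.Icc 1 N) :
    UnifPos (Ioo 0 ε₀) fun ε => kCoef S N p ε j := by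
  obtain ⟨a, ha, h⟩ := (dCoef_bounds hp hj).1.mul (UnifPos.exp (kCoef_factor hp hj).uc.bdd)
  refine ⟨a, ha, fun ε hε θ => (h ε hε θ).trans (le_of_eq ?_)⟩
  change _ = kCoef S N p ε j θ
  rw [kCoef, if_pos (Finset.mem_Icc.1 hj).2]

theorem tame_twelve_β_sq (I : Set ℝ) : Tame I S.ℓ fun _ θ => 12 * S.β θ ^ 2 := by
  simpa only [sq] using (Tame.const 12).mul ((tame_β S I).mul (tame_β S I))

theorem unifPos_twelve_β_sq (I : Set ℝ) : UnifPos I fun _ θ => 12 * S.β θ ^ 2 := by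
  simpa only [sq] using (UnifPos.const (by norm_num)).mul ((unifPos_β S I).mul (unifPos_β S I))

theorem tame_cc (hS : ∀ θ, 0 < S.meanCurv θ) (hp : p.Admissible S N ε₀ δ₀ δ K) {j : ℕ}
    (hj : j ∈ Finset.Icc 1 N) : Tame (Ioo 0 ε₀) S.ℓ fun ε => cc S N p ε j :=
  ((tame_twelve_β_sq _).mul (tame_γ₁ hp hj)).mul (tame_kCoef hS hp (Finset.mem_Icc.1 hj).1)

theorem tame_dd (hS : ∀ θ, 0 < S.meanCurv θ) (hp : p.Admissible S N ε₀ δ₀ δ K) {j : ℕ}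
    (hj : j ∈ Finset.Icc 1 N) : Tame (Ioo 0 ε₀) S.ℓ fun ε => dd S N p ε j :=
  ((tame_twelve_β_sq _).mul (tame_γ₂ hp hj)).mul (tame_kCoef hS hp (Nat.le_add_left 1 j))

theorem unifPos_cc (hS : ∀ θ, 0 < S.meanCurv θ) (hp : p.Admissible S N ε₀ δ₀ δ K) {j : ℕ}
    (hj : j ∈ Finset.Icc 1 N) : UnifPos (Ioo 0 ε₀) fun ε => cc S N p ε j :=
  ((unifPos_twelve_β_sq _).mul (unifPos_γ₁ hS hp hj)).mul (unifPos_kCoef hp hj)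

theorem dd_last (ε θ : ℝ) : dd S N p ε N θ = 0 := by
  rw [dd, kCoef, if_neg (by omega), mul_zero]

end CoefficientFamilies

/-! ### Decay of the heteroclinic profile -/

section Profile

theorem hasDerivAt_H (x : ℝ) :
    HasDerivAt H (1 / (Real.sqrt 2 * Real.cosh (x / Real.sqrt 2) ^ 2)) x := by
  have h1 : HasDerivAt (fun x : ℝ => x / Real.sqrt 2) (1 / Real.sqrt 2) x :=
    (hasDerivAt_id x).div_const _
  have hc := (Real.cosh_pos (x / Real.sqrt 2)).ne'
  have h2 := h1.sinh.div h1.cosh hc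
  refine (h2.congr_of_eventuallyEq (Eventually.of_forall fun y => ?_)).congr_deriv ?_
  · exact Real.tanh_eq_sinh_div_cosh _
  · have := Real.cosh_sq (x / Real.sqrt 2)
    have h3 : Real.sqrt 2 ≠ 0 := by positivity
    field_simp
    linarith

theorem deriv_H : deriv H = fun x => 1 / (Real.sqrt 2 * Real.cosh (x / Real.sqrt 2) ^ 2) :=
  funext fun x => (hasDerivAt_H x).deriv

theorem continuous_deriv_H : Continuous (deriv H) := by
  rw [deriv_H]
  refine continuous_const.div (by fun_prop) fun x => ?_
  have := Real.cosh_pos (x / Real.sqrt 2)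
  positivity

theorem deriv_H_pos (x : ℝ) : 0 < deriv H x := by
  rw [deriv_H]
  have := Real.cosh_pos (x / Real.sqrt 2)
  positivity

theorem one_add_sq_le_cosh_sq (y : ℝ) : 1 + y ^ 2 ≤ Real.cosh y ^ 2 := by
  have h : |y| ≤ |Real.sinh y| := by
    rw [Real.abs_sinh]; exact Real.self_le_sinh_iff.2 (abs_nonneg y)
  rw [Real.cosh_sq]
  linarith [sq_le_sq.2 h]

/-- With y = x/√2, (H')² is a multiple of cosh(y)^(-4) and the exponential is at most 4 cosh(y)²;
the remaining cosh(y)^(-2) dominates nothing worse than 1/(1 + x²) up to a constant. The summand 1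
lets the same bound serve for the unweighted integral. -/
theorem deriv_H_sq_le (x : ℝ) : deriv H x ^ 2 * (Real.exp (Real.sqrt 2 * x) + 1)
    ≤ 8 * (1 + x ^ 2)⁻¹ := by
  set y := x / Real.sqrt 2 with hy
  have hx2 : Real.sqrt 2 ^ 2 = 2 := Real.sq_sqrt (by norm_num)
  have hx : x = Real.sqrt 2 * y := by rw [hy]; field_simp
  have hc := Real.cosh_pos y
  have h1 : Real.exp (Real.sqrt 2 * x) ≤ 4 * Real.cosh y ^ 2 := by
    have : Real.sqrt 2 * x = y + y := by
      rw [hx]; linear_combination y * hx2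
    rw [this, Real.exp_add]
    have h2 : Real.exp y ≤ 2 * Real.cosh y := by
      rw [Real.cosh_eq]; linarith [Real.exp_pos (-y)]
    nlinarith [Real.exp_pos y]
  have h2 := one_add_sq_le_cosh_sq y
  have h3 : deriv H x ^ 2 = (2 * Real.cosh y ^ 2 * Real.cosh y ^ 2)⁻¹ := by
    rw [deriv_H]
    simp only [← hy]
    rw [div_pow, mul_pow, hx2, one_pow, one_div]
    congr 1; ring
  have h4 : 1 + x ^ 2 ≤ 2 * Real.cosh y ^ 2 := by
    rw [hx, mul_pow, hx2]; linarith
  rw [h3, ← div_eq_inv_mul, ← div_eq_mul_inv, div_le_div_iff₀ (by positivity) (by positivity)]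
  have h5 : (1:ℝ) ≤ Real.cosh y ^ 2 := by nlinarith [sq_nonneg y]
  calc _ ≤ (5 * Real.cosh y ^ 2) * (2 * Real.cosh y ^ 2) := by
        apply mul_le_mul _ h4 (by positivity) (by positivity)
        linarith
    _ ≤ _ := by nlinarith [sq_nonneg (Real.cosh y ^ 2)]

theorem integrable_deriv_H_sq : Integrable fun x => deriv H x ^ 2 := by
  refine (integrable_inv_one_add_sq.const_mul 8).mono'
    (continuous_deriv_H.pow 2).aestronglyMeasurable (Eventually.of_forall fun x => ?_)
  rw [Real.norm_of_nonneg (sq_nonneg _)]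
  refine le_trans ?_ (deriv_H_sq_le x)
  nlinarith [Real.exp_pos (Real.sqrt 2 * x), sq_nonneg (deriv H x)]

theorem γ₀_pos : 0 < γ₀ := by
  rw [γ₀, integral_pos_iff_support_of_nonneg (fun x => sq_nonneg _) integrable_deriv_H_sq]
  have : Function.support (fun x => deriv H x ^ 2) = univ :=
    eq_univ_of_forall fun x => (pow_pos (deriv_H_pos x) 2).ne'
  rw [this]
  simp

theorem integrable_cutoff {χ : ℝ → ℝ} (hχ : Measurable χ) (h : ∀ x, χ x ∈ Icc (0 : ℝ) 1) :
    Integrable fun x => χ x * deriv H x ^ 2 * Real.exp (Real.sqrt 2 * x) := by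
  have hm : Measurable (deriv H) := continuous_deriv_H.measurable
  refine (integrable_inv_one_add_sq.const_mul 8).mono'
    (by fun_prop) (Eventually.of_forall fun x => ?_)
  have hE := Real.exp_pos (Real.sqrt 2 * x)
  rw [Real.norm_of_nonneg (mul_nonneg (mul_nonneg (h x).1 (sq_nonneg _)) hE.le)]
  refine le_trans ?_ (deriv_H_sq_le x)
  rw [mul_assoc]
  refine (mul_le_of_le_one_left (by positivity) (h x).2).trans ?_
  gcongr
  linarith

end Profile

/-! ### Positions of the layers and lower bounds for γ₂ -/

section LayerPositions

variable {S : Setting} {N : ℕ} {p : Params} {ε₀ δ₀ δ K : ℝ}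

theorem fdot_eq {ε : ℝ} (hε : 0 < ε) {j : ℕ} (hj : j ∈ Finset.Icc 1 N) (θ : ℝ) :
    Real.sqrt 2 * S.β θ * fdot S N ε j θ = ((j : ℝ) - 1 / 2) * -Real.log ε
      + (-(Real.log N / 2) + Real.log ((N - j).factorial : ℝ)
        - Real.log ((N - 1).factorial : ℝ)) := by
  obtain ⟨hj1, hj2⟩ := Finset.mem_Icc.1 hj
  have hβ := S.β_pos θ
  have hN : (N : ℝ) ≠ 0 := by
    have : 1 ≤ N := hj1.trans hj2
    positivity
  have hf : ∀ k : ℕ, ((k.factorial : ℕ) : ℝ) ≠ 0 := fun k => by positivity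
  have e1 : Real.log (1 / (N * ε)) = -Real.log N - Real.log ε := by
    rw [one_div, Real.log_inv, Real.log_mul hN hε.ne']; ring
  have e2 : Real.log (((N - j).factorial : ℝ) / (((N - 1).factorial : ℝ) * ε ^ (j - 1)))
      = Real.log ((N - j).factorial : ℝ) - Real.log ((N - 1).factorial : ℝ)
        - ((j : ℝ) - 1) * Real.log ε := by
    rw [Real.log_div (hf _) (mul_ne_zero (hf _) (by positivity)),
      Real.log_mul (hf _) (by positivity), Real.log_pow, Nat.cast_sub hj1]
    push_cast
    ring
  rw [fdot, e1, e2]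
  field_simp
  ring

/-- In the variable √2 β s, the layers sit at (j - 1/2)(-ln ε) up to bounded errors. Neighbours are
thus separated by about -ln ε, and the first layer is half that distance from the boundary. -/
theorem exists_pos_approx (hp : p.Admissible S N ε₀ δ₀ δ K) : ∃ A, ∀ ε ∈ Ioo 0 ε₀,
    ∀ j ∈ Finset.Icc 1 N, ∀ θ,
      |Real.sqrt 2 * S.β θ * pos S N p ε j θ - ((j : ℝ) - 1 / 2) * -Real.log ε| ≤ A := by
  have key : ∀ j ∈ Finset.Icc 1 N, UnifBdd (Ioo 0 ε₀) fun ε θ =>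
      Real.sqrt 2 * S.β θ * pos S N p ε j θ - ((j : ℝ) - 1 / 2) * -Real.log ε := by
    intro j hj
    have hb : UnifBdd (Ioo 0 ε₀) fun ε θ => p.fbar ε j θ :=
      ⟨K, fun ε hε θ => hp.fbar_bound ε hε j hj θ⟩
    refine UnifBdd.congr (((UC.const (n := 0) (-(Real.log N / 2)
        + Real.log ((N - j).factorial : ℝ) - Real.log ((N - 1).factorial : ℝ))).bdd.add
      (((UC.const (n := 0) (Real.sqrt 2)).bdd.mul (tame_β S _).uc.bdd).mul
        (hb.add (tame_fcheck hp hj).uc.bdd)))) fun ε hε => ?_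
    funext θ
    have := fdot_eq (S := S) hε.1 hj θ
    rw [pos]
    linear_combination -this
  choose! A hA using key
  refine ⟨∑ j ∈ Finset.Icc 1 N, |A j|, fun ε hε j hj θ => ?_⟩
  refine ((hA j hj ε hε θ).trans (le_abs_self _)).trans ?_
  exact Finset.single_le_sum (f := fun j => |A j|) (fun i _ => abs_nonneg _) hj

theorem eventually_small (N : ℕ) (A : ℝ) {b : ℝ} (hb : 0 < b) :
    ∀ᶠ ε in 𝓝[>] (0 : ℝ), A < -Real.log ε ∧ (N * -Real.log ε + A) < b / ε := by
  have h1 : ∀ᶠ ε in 𝓝[>] (0 : ℝ), A < -Real.log ε :=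
    (tendsto_neg_atBot_atTop.comp Real.tendsto_log_nhdsGT_zero).eventually_gt_atTop A
  have h2 : Tendsto (fun ε : ℝ => N * -(Real.log ε * ε ^ (1 : ℝ)) + A * ε) (𝓝[>] 0) (𝓝 0) := by
    have h3 := (tendsto_log_mul_rpow_nhdsGT_zero one_pos).neg.const_mul (N : ℝ)
    have h4 : Tendsto (fun ε : ℝ => A * ε) (𝓝[>] 0) (𝓝 (A * 0)) :=
      (tendsto_id.const_mul A).mono_left nhdsWithin_le_nhds
    simpa using h3.add h4
  filter_upwards [h1, h2.eventually_lt_const hb, self_mem_nhdsWithin] with ε h hε h0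
  refine ⟨h, ?_⟩
  rw [lt_div_iff₀ h0]
  rw [Real.rpow_one] at hε
  linarith

/-- The distance to the midpoints grows like -ln ε / 2 in the scaled variable, while positions
remain far below δ₀/ε. A window of fixed width around each layer is therefore eventually inside the
region where the cut-off is one. -/
theorem exists_χ_eq_one (hδ₀ : 0 < δ₀) (hε₀ : 0 < ε₀) (hp : p.Admissible S N ε₀ δ₀ δ K) :
    ∃ ε₁ ∈ Ioc 0 ε₀, ∀ ε ∈ Ioo 0 ε₁, ∀ j ∈ Finset.Icc 1 N, ∀ θ, ∀ x ∈ Icc (-1 : ℝ) 1,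
      p.χ ε j (pos S N p ε j θ + x / S.β θ) θ = 1 := by
  obtain ⟨A, hA⟩ := exists_pos_approx hp
  -- β does not depend on ε, so the parameter set {0} is a dummy.
  obtain ⟨b, hb, hβ⟩ := unifPos_β S {0}
  have hr2 : Real.sqrt 2 < 2 := by
    rw [Real.sqrt_lt' (by norm_num)]; norm_num
  have hr1 : 1 < Real.sqrt 2 := by
    rw [Real.lt_sqrt (by norm_num)]; norm_num
  obtain ⟨ε₂, hε₂, hsub⟩ := mem_nhdsGT_iff_exists_Ioo_subset.1
    (eventually_small N (4 * A + 6) (mul_pos (mul_pos (zero_lt_one.trans hr1) hb) hδ₀))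
  refine ⟨min ε₀ ε₂, ⟨lt_min hε₀ hε₂, min_le_left _ _⟩, fun ε hε j hj θ x hx => ?_⟩
  have hε' : ε ∈ Ioo 0 ε₀ := ⟨hε.1, hε.2.trans_le (min_le_left _ _)⟩
  obtain ⟨hl, hu⟩ := hsub ⟨hε.1, hε.2.trans_le (min_le_right _ _)⟩
  have hβθ : b ≤ S.β θ := hβ 0 rfl θ
  have hβp := S.β_pos θ
  have hA0 : 0 ≤ A := (abs_nonneg _).trans (hA ε hε' j hj θ)
  set Λ := -Real.log ε with hΛ
  set B := Real.sqrt 2 * S.β θ with hB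
  have hBp : 0 < B := by positivity
  obtain ⟨hj1, hj2⟩ := Finset.mem_Icc.1 hj
  have hj1' : (1 : ℝ) ≤ j := by exact_mod_cast hj1
  have hj2' : (j : ℝ) ≤ N := by exact_mod_cast hj2
  have hs : B * (pos S N p ε j θ + x / S.β θ) = B * pos S N p ε j θ + Real.sqrt 2 * x := by
    rw [hB]; field_simp
  have hxb : |Real.sqrt 2 * x| ≤ 2 := by
    rw [abs_mul, abs_of_pos (zero_lt_one.trans hr1)]
    calc Real.sqrt 2 * |x| ≤ 2 * 1 := by
          gcongr; exact abs_le.2 hx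
      _ = 2 := by norm_num
  have hpj := abs_le.1 (hA ε hε' j hj θ)
  have hxb' := abs_le.1 hxb
  refine hp.χ_eq_one ε hε' j hj _ θ ?_ ?_ ?_ ?_
  · refine pos_of_mul_pos_right ?_ hBp.le
    rw [hs]
    nlinarith
  · have h1 : B * (pos S N p ε j θ + x / S.β θ) < B * (δ₀ / ε) := by
      rw [hs]
      have h2 : Real.sqrt 2 * b * δ₀ / ε ≤ B * (δ₀ / ε) := by
        rw [hB, mul_div_assoc]
        have : 0 ≤ δ₀ / ε := div_nonneg hδ₀.le hε.1.le
        gcongr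
      nlinarith
    exact lt_of_mul_lt_mul_left h1 hBp.le
  · refine le_of_mul_le_mul_left ?_ hBp
    rw [hs, mid, reflect]
    -- The lower midpoint of the first layer is 0 by the reflection convention; all other layers
    -- have a genuine lower neighbour.
    split_ifs with h0
    · have : j = 1 := by omega
      subst this
      have : B * ((-pos S N p ε 1 θ + pos S N p ε 1 θ) / 2) = 0 := by ring
      rw [this]
      push_cast at hpj
      nlinarith
    · have hq := abs_le.1 (hA ε hε' (j - 1) (Finset.mem_Icc.2 ⟨by omega, by omega⟩) θ)
      rw [Nat.cast_sub hj1] at hq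
      push_cast at hq
      nlinarith
  · intro hjN
    refine le_of_mul_le_mul_left ?_ hBp
    rw [hs, mid, reflect, if_neg (by omega), Nat.add_sub_cancel]
    have hq := abs_le.1 (hA ε hε' (j + 1) (Finset.mem_Icc.2 ⟨by omega, by omega⟩) θ)
    push_cast at hq
    nlinarith

/-- In the algebraic system γ₂ appears with the opposite sign, so no lower bound comes from there.
The integral is instead bounded below by its part over the window |x| ≤ 1, which requires small ε.
-/
theorem exists_unifPos_γ₂ (hδ₀ : 0 < δ₀) (hε₀ : 0 < ε₀) (hp : p.Admissible S N ε₀ δ₀ δ K) :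
    ∃ ε₁ ∈ Ioc 0 ε₀, ∀ j ∈ Finset.Icc 1 N, UnifPos (Ioo 0 ε₁) fun ε => γ₂ S N p ε j := by
  obtain ⟨ε₁, hε₁, h⟩ := exists_χ_eq_one hδ₀ hε₀ hp
  refine ⟨ε₁, hε₁, fun j hj => ⟨∫ x in (-1 : ℝ)..1, deriv H x ^ 2 * Real.exp (Real.sqrt 2 * x),
    ?_, fun ε hε θ => ?_⟩⟩
  · refine intervalIntegral.intervalIntegral_pos_of_pos ?_
      (fun x => mul_pos (pow_pos (deriv_H_pos x) 2) (Real.exp_pos _)) (by norm_num)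
    have := continuous_deriv_H
    exact Continuous.intervalIntegrable (by fun_prop) _ _
  · have hε' : ε ∈ Ioo 0 ε₀ := ⟨hε.1, hε.2.trans_le hε₁.2⟩
    have hmem : ∀ x, p.χ ε j (pos S N p ε j θ + x / S.β θ) θ ∈ Icc (0 : ℝ) 1 := fun x =>
      hp.χ_mem ε hε' j hj _ θ
    have hinteg := integrable_cutoff (χ := fun x => p.χ ε j (pos S N p ε j θ + x / S.β θ) θ)
      ((hp.χ_measurable ε hε' j hj θ).comp (by fun_prop)) hmem
    rw [intervalIntegral.integral_of_le (by norm_num)]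
    have heq : ∫ x in Ioc (-1 : ℝ) 1, deriv H x ^ 2 * Real.exp (Real.sqrt 2 * x)
        = ∫ x in Ioc (-1 : ℝ) 1, p.χ ε j (pos S N p ε j θ + x / S.β θ) θ * deriv H x ^ 2
          * Real.exp (Real.sqrt 2 * x) := by
      refine setIntegral_congr_fun measurableSet_Ioc fun x hx => ?_
      simp only [h ε hε j hj θ x (Ioc_subset_Icc_self hx), one_mul]
    rw [heq]
    exact setIntegral_le_integral hinteg (Eventually.of_forall fun x =>
      mul_nonneg (mul_nonneg (hmem x).1 (sq_nonneg _)) (Real.exp_pos _).le)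

theorem UnifPos.mono {I I' : Set ℝ} {f : ℝ → ℝ → ℝ} (hf : UnifPos I f) (hI : I' ⊆ I) :
    UnifPos I' f := by
  obtain ⟨c, hc, h⟩ := hf
  exact ⟨c, hc, fun ε hε θ => h ε (hI hε) θ⟩

theorem exists_pos_le_of_forall {n : ℕ} {f : ℕ → ℝ → ℝ → ℝ} {I : Set ℝ}
    (h : ∀ k < n, UnifPos I (f k)) : ∃ c > 0, ∀ k < n, ∀ ε ∈ I, ∀ θ, c ≤ f k ε θ := by
  induction n with
  | zero => exact ⟨1, one_pos, fun k hk => absurd hk (by omega)⟩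
  | succ n ih =>
    obtain ⟨c, hc, hc'⟩ := ih fun k hk => h k (by omega)
    obtain ⟨d, hd, hd'⟩ := h n (by omega)
    refine ⟨min c d, lt_min hc hd, fun k hk ε hε θ => ?_⟩
    rcases Nat.lt_succ_iff_lt_or_eq.1 hk with hk | rfl
    · exact (min_le_left _ _).trans (hc' k hk ε hε θ)
    · exact (min_le_right _ _).trans (hd' ε hε θ)

theorem exists_le_of_forall {n : ℕ} {f : ℕ → ℝ → ℝ → ℝ} {I : Set ℝ}
    (h : ∀ k < n, UnifBdd I (f k)) : ∃ C, ∀ k < n, ∀ ε ∈ I, ∀ θ, f k ε θ ≤ C := by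
  induction n with
  | zero => exact ⟨1, fun k hk => absurd hk (by omega)⟩
  | succ n ih =>
    obtain ⟨c, hc'⟩ := ih fun k hk => h k (by omega)
    obtain ⟨d, hd'⟩ := h n (by omega)
    refine ⟨max c d, fun k hk ε hε θ => ?_⟩
    rcases Nat.lt_succ_iff_lt_or_eq.1 hk with hk | rfl
    · exact (hc' k hk ε hε θ).trans (le_max_left _ _)
    · exact ((le_abs_self _).trans (hd' ε hε θ)).trans (le_max_right _ _)

/-- The matrix `B` is by definition `tri` with the layer index shifted by one. Only the lower bound
for γ₂ forces the parameter range to shrink to `ε₁`. -/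
theorem exists_frameFamily (hS : ∀ θ, 0 < S.meanCurv θ) (hN : 1 ≤ N) (hδ₀ : 0 < δ₀) (hε₀ : 0 < ε₀)
    (hp : p.Admissible S N ε₀ δ₀ δ K) {P : ℝ → ℝ → Matrix (Fin N) (Fin N) ℝ}
    {ρ : ℝ → ℝ → Fin N → ℝ} (hP : ∀ ε ∈ Ioo 0 ε₀, IsEigenframe S N p ε (P ε) (ρ ε)) :
    ∃ ε₁ ∈ Ioc 0 ε₀, ∃ c₀ c₁, FrameFamily (Ioo 0 ε₁) S.ℓ N c₀ c₁
      (fun k ε => cc S N p ε (k + 1)) (fun k ε => dd S N p ε (k + 1)) P ρ := by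
  obtain ⟨ε₁, hε₁, hγ⟩ := exists_unifPos_γ₂ hδ₀ hε₀ hp
  have hI : Ioo 0 ε₁ ⊆ Ioo 0 ε₀ := Ioo_subset_Ioo_right hε₁.2
  have hmem : ∀ k < N, k + 1 ∈ Finset.Icc 1 N := fun k hk => Finset.mem_Icc.2 ⟨by omega, by omega⟩
  have hc : ∀ k < N, Tame (Ioo 0 ε₁) S.ℓ fun ε => cc S N p ε (k + 1) := fun k hk =>
    (tame_cc hS hp (hmem k hk)).mono hI
  have hd : ∀ k < N, Tame (Ioo 0 ε₁) S.ℓ fun ε => dd S N p ε (k + 1) := fun k hk =>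
    (tame_dd hS hp (hmem k hk)).mono hI
  obtain ⟨a, ha, hca⟩ := exists_pos_le_of_forall (n := N) (I := Ioo 0 ε₁)
    (f := fun k ε => cc S N p ε (k + 1)) fun k hk => (unifPos_cc hS hp (hmem k hk)).mono hI
  -- The last upper entry is zero, so a positive lower bound is sought only for the first N - 1.
  obtain ⟨b, hb, hdb⟩ := exists_pos_le_of_forall (n := N - 1) (I := Ioo 0 ε₁)
    (f := fun k ε => dd S N p ε (k + 1)) fun k hk =>
      ((unifPos_twelve_β_sq _).mul (hγ _ (hmem k (by omega)))).mul
        ((unifPos_kCoef hp (hmem (k + 1) (by omega))).mono hI)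
  obtain ⟨A, hcA⟩ := exists_le_of_forall (n := N) (I := Ioo 0 ε₁)
    (f := fun k ε => cc S N p ε (k + 1)) fun k hk => (hc k hk).uc.bdd
  obtain ⟨B', hdB⟩ := exists_le_of_forall (n := N) (I := Ioo 0 ε₁)
    (f := fun k ε => dd S N p ε (k + 1)) fun k hk => (hd k hk).uc.bdd
  refine ⟨ε₁, hε₁, min a b, max A B', hN, hc, hd, fun ε hε θ => ?_, fun ε hε θ => ?_,
    fun ε hε => (hP ε (hI hε)).contDiff⟩
  · exact
      { pos := lt_min ha hb
        c_lo := fun k hk => (min_le_left _ _).trans (hca k hk ε hε θ)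
        c_hi := fun k hk => (hcA k hk ε hε θ).trans (le_max_left _ _)
        d_lo := fun k hk => (min_le_right _ _).trans (hdb k (by omega) ε hε θ)
        d_hi := fun k hk => (hdB k hk ε hε θ).trans (le_max_right _ _)
        d_last := fun k hk => by rw [hk]; exact dd_last ε θ }
  · have e := hP ε (hI hε)
    exact ⟨e.unit_col θ, e.isUnit θ, e.eigen θ, e.antitone θ⟩

end LayerPositions

/-! ### Non-resonant values of ε -/

section Nonresonance

/-- The addition formula bounds sin(y - x) by |sin x| + |sin y|, so two phases a moderate distance
apart cannot both be nearly resonant. -/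
theorem abs_sin_ge_or {x y d : ℝ} (hd : 0 < d) (h₁ : d ≤ y - x) (h₂ : y - x ≤ 1) :
    Real.sin d / 2 ≤ |Real.sin x| ∨ Real.sin d / 2 ≤ |Real.sin y| := by
  by_contra! h
  have hpi := Real.pi_gt_three
  have h3 : Real.sin d ≤ Real.sin (y - x) :=
    Real.sin_le_sin_of_le_of_le_pi_div_two (by linarith) (by linarith) h₁
  have h4 : Real.sin (y - x) ≤ |Real.sin y| + |Real.sin x| := by
    rw [Real.sin_sub]
    have e1 : Real.sin y * Real.cos x ≤ |Real.sin y| := by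
      refine (le_abs_self _).trans ?_
      rw [abs_mul]
      exact mul_le_of_le_one_right (abs_nonneg _) (Real.abs_cos_le_one x)
    have e2 : -(Real.cos y * Real.sin x) ≤ |Real.sin x| := by
      refine (neg_le_abs _).trans ?_
      rw [abs_mul]
      exact mul_le_of_le_one_left (abs_nonneg _) (Real.abs_cos_le_one y)
    linarith
  linarith

/-- Pigeonhole in t = 1/√ε. Among N + 1 equally spaced large values of t, each of the N phases can
be nearly resonant at most once, so one value is good for all of them. -/
theorem exists_nonresonant {N : ℕ} {ε₁ : ℝ} (hε₁ : 0 < ε₁) {g : Fin N → ℝ → ℝ} {a b L : ℝ}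
    (ha : 0 < a) (hL : 0 ≤ L) (hg₁ : ∀ n, ∀ ε ∈ Ioo 0 ε₁, a ≤ g n ε)
    (hg₂ : ∀ n, ∀ ε ∈ Ioo 0 ε₁, g n ε ≤ b)
    (hg : ∀ n, ∀ ε ∈ Ioo 0 ε₁, ∀ ε' ∈ Ioo 0 ε₁,
      |g n ε - g n ε'| ≤ L * |Real.sqrt ε - Real.sqrt ε'|) :
    ∃ c > 0, ∀ η > 0, ∃ ε ∈ Ioo 0 ε₁, ε < η ∧ ∀ n, c ≤ |Real.sin (g n ε / Real.sqrt ε)| := by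
  set τ : ℝ := ((a + |b|) * (N + 1) * 2)⁻¹ with hτ
  have hτ0 : 0 < τ := by positivity
  have hτ1 : (a + |b|) * (N + 1) * 2 * τ = 1 := mul_inv_cancel₀ (by positivity)
  have hd0 : 0 < a / 2 * τ := by positivity
  have hd1 : a / 2 * τ ≤ 1 := by
    rw [← hτ1]
    gcongr
    nlinarith [abs_nonneg b, (Nat.cast_nonneg N : (0 : ℝ) ≤ N)]
  refine ⟨Real.sin (a / 2 * τ) / 2,
    half_pos (Real.sin_pos_of_pos_of_lt_pi hd0 (by linarith [Real.pi_gt_three])), fun η hη => ?_⟩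
  -- Beyond 2L/a the variation of g with √ε cancels at most half of the growth rate a of the phase;
  -- beyond 1/η and 1/ε₁ the sampled ε are small enough.
  obtain ⟨T, hT⟩ : ∃ T : ℝ, 1 + 2 * L / a + 1 / η + 1 / ε₁ ≤ T := ⟨_, le_rfl⟩
  have hLa : 0 ≤ 2 * L / a := by positivity
  have hη' : 0 < 1 / η := by positivity
  have hε₁' : 0 < 1 / ε₁ := by positivity
  have hT1 : 1 ≤ T := by linarith
  set t : Fin (N + 1) → ℝ := fun i => T + i * τ with ht
  have htT : ∀ i, T ≤ t i := fun i => le_add_of_nonneg_right (by positivity)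
  have ht0 : ∀ i, 0 < t i := fun i => by linarith [htT i]
  set e : Fin (N + 1) → ℝ := fun i => (t i ^ 2)⁻¹ with he
  have hsq : ∀ i, Real.sqrt (e i) = (t i)⁻¹ := fun i => by
    rw [he]; simp only [Real.sqrt_inv, Real.sqrt_sq (ht0 i).le]
  have hsmall : ∀ i, ∀ y > 0, 1 / y < T → e i < y := by
    intro i y hy hyT
    have h1 : T ≤ t i ^ 2 := by nlinarith [htT i]
    rw [he]
    rw [inv_lt_comm₀ (by have := ht0 i; positivity) hy, ← one_div]
    linarith
  have hemem : ∀ i, e i ∈ Ioo 0 ε₁ := fun i =>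
    ⟨by have := ht0 i; simp only [he]; positivity, hsmall i ε₁ hε₁ (by linarith)⟩
  by_contra! hbad
  have hbad' : ∀ i, ∃ n, |Real.sin (g n (e i) / Real.sqrt (e i))| < Real.sin (a / 2 * τ) / 2 :=
    fun i => hbad (e i) (hemem i) (hsmall i η hη (by linarith))
  choose f hf using hbad'
  obtain ⟨i, k, hik, hfik⟩ : ∃ i k : Fin (N + 1), i < k ∧ f i = f k := by
    obtain ⟨i, k, hne, h⟩ := Fintype.exists_ne_map_eq_of_card_lt f (by simp)
    rcases lt_or_gt_of_ne hne with h' | h'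
    · exact ⟨i, k, h', h⟩
    · exact ⟨k, i, h', h.symm⟩
  have hik' : (i : ℝ) + 1 ≤ k := by exact_mod_cast hik
  have hkN : (k : ℝ) ≤ N := by exact_mod_cast Nat.lt_succ_iff.1 k.2
  have hdt : t k - t i = ((k : ℝ) - i) * τ := by simp only [ht]; ring
  have hdt1 : τ ≤ t k - t i := by rw [hdt]; nlinarith
  have hdt2 : t k - t i ≤ N * τ := by
    rw [hdt]
    have : (0 : ℝ) ≤ (i : ℝ) := Nat.cast_nonneg _
    gcongr
    linarith
  set n := f k with hn
  have hdiff : |t i * (g n (e k) - g n (e i))| ≤ a / 2 * (t k - t i) := by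
    rw [abs_mul, abs_of_pos (ht0 i)]
    have h1 := hg n _ (hemem k) _ (hemem i)
    have h2 : |(t k)⁻¹ - (t i)⁻¹| = (t k - t i) / (t k * t i) := by
      rw [inv_sub_inv (ht0 k).ne' (ht0 i).ne', abs_div, abs_of_pos (mul_pos (ht0 k) (ht0 i)),
        abs_sub_comm, abs_of_nonneg (by linarith)]
    rw [hsq, hsq, h2] at h1
    calc t i * |g n (e k) - g n (e i)| ≤ t i * (L * ((t k - t i) / (t k * t i))) := by
          have := ht0 i
          gcongr
      _ = L / t k * (t k - t i) := by
          have := (ht0 i).ne'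
          have := (ht0 k).ne'
          field_simp
      _ ≤ _ := by
          have h3 : L / t k ≤ a / 2 := by
            rw [div_le_iff₀ (ht0 k)]
            have h4 : 2 * L / a ≤ t k := by linarith [htT k]
            rw [div_le_iff₀ ha] at h4
            linarith
          gcongr
          linarith
  have hga := hg₁ n _ (hemem k)
  have hgb := hg₂ n _ (hemem k)
  have hsplit : g n (e k) / Real.sqrt (e k) - g n (e i) / Real.sqrt (e i)
      = (t k - t i) * g n (e k) + t i * (g n (e k) - g n (e i)) := by
    rw [hsq, hsq, div_inv_eq_mul, div_inv_eq_mul]; ring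
  have hdiff' := abs_le.1 hdiff
  rcases abs_sin_ge_or (x := g n (e i) / Real.sqrt (e i)) (y := g n (e k) / Real.sqrt (e k)) hd0
    (by rw [hsplit]; nlinarith) (by
      rw [hsplit]
      calc _ ≤ (t k - t i) * (|b| + a) := by nlinarith [le_abs_self b]
        _ ≤ (N * τ) * (|b| + a) := by gcongr
        _ ≤ 1 := by
          rw [← hτ1]
          nlinarith [mul_pos (show 0 < a + |b| by positivity) hτ0,
            mul_nonneg (Nat.cast_nonneg N : (0 : ℝ) ≤ N)
              (mul_pos (show 0 < a + |b| by positivity) hτ0).le]) with h | h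
  · have := hf i
    rw [hfik] at this
    linarith
  · linarith [hf k]

theorem Tame.sqrt {I : Set ℝ} {ℓ : ℝ} {f : ℝ → ℝ → ℝ} (hf : Tame I ℓ f) (h : UnifPos I f) :
    Tame I ℓ fun ε θ => Real.sqrt (f ε θ) := by
  refine ⟨hf.uc.sqrt h, ?_, fun ε hε θ => congrArg _ (hf.per ε hε θ)⟩
  obtain ⟨L, hL0, hL⟩ := hf.lip
  obtain ⟨c, hc, hs⟩ := h.sqrt
  refine ⟨L / c, by positivity, fun ε hε ε' hε' θ => ?_⟩
  have h1 := h.pos hε θ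
  have h2 := h.pos hε' θ
  have h3 : |Real.sqrt (f ε θ) - Real.sqrt (f ε' θ)| * (Real.sqrt (f ε θ) + Real.sqrt (f ε' θ))
      = |f ε θ - f ε' θ| := by
    rw [← abs_of_nonneg (add_nonneg (Real.sqrt_nonneg (f ε θ)) (Real.sqrt_nonneg (f ε' θ))),
      ← abs_mul]
    congr 1
    linear_combination Real.sq_sqrt h1.le - Real.sq_sqrt h2.le
  rw [div_mul_eq_mul_div, le_div_iff₀ hc]
  refine le_trans ?_ (hL ε hε ε' hε' θ)
  rw [← h3]
  gcongr
  linarith [hs ε hε θ, Real.sqrt_nonneg (f ε' θ)]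

theorem exists_nonresonant_family {N : ℕ} {ε₁ ℓ : ℝ} (hε₁ : 0 < ε₁) (hℓ : 0 < ℓ)
    {ϖ : Fin N → ℝ → ℝ → ℝ} (hϖ : ∀ n, Tame (Ioo 0 ε₁) ℓ (ϖ n))
    (hpos : ∀ n, UnifPos (Ioo 0 ε₁) (ϖ n)) :
    ∃ c > 0, ∀ η > 0, ∃ ε ∈ Ioo 0 ε₁, ε < η ∧
      ∀ n, c ≤ |Real.sin (∫ t in (0 : ℝ)..ℓ, ϖ n ε t / Real.sqrt ε)| := by
  rcases Nat.eq_zero_or_pos N with rfl | hN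
  · refine ⟨1, one_pos, fun η hη => ⟨min ε₁ η / 2, ⟨by positivity, ?_⟩, ?_, fun n => n.elim0⟩⟩
    · linarith [min_le_left ε₁ η, lt_min hε₁ hη]
    · linarith [min_le_right ε₁ η, lt_min hε₁ hη]
  have hne : (Finset.univ : Finset (Fin N)).Nonempty := ⟨⟨0, hN⟩, Finset.mem_univ _⟩
  choose a ha hlo using hpos
  choose b hb using fun n => (hϖ n).uc.bdd
  choose L hL0 hL using fun n => (hϖ n).lip
  have hinteg : ∀ n, ∀ ε ∈ Ioo 0 ε₁, IntervalIntegrable (ϖ n ε) volume 0 ℓ := fun n ε hε =>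
    ((hϖ n).uc.cont ε hε).intervalIntegrable _ _
  have hlow : ∃ A > 0, ∀ n, A ≤ a n := by
    obtain ⟨i, -, hi⟩ := Finset.exists_min_image Finset.univ a hne
    exact ⟨a i, ha i, fun n => hi n (Finset.mem_univ n)⟩
  obtain ⟨A, hA, hAa⟩ := hlow
  have hup : ∃ B, ∀ n, b n ≤ B := by
    obtain ⟨i, -, hi⟩ := Finset.exists_max_image Finset.univ b hne
    exact ⟨b i, fun n => hi n (Finset.mem_univ n)⟩
  obtain ⟨B, hB⟩ := hup
  have hupL : ∃ B, 0 ≤ B ∧ ∀ n, L n ≤ B := by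
    obtain ⟨i, -, hi⟩ := Finset.exists_max_image Finset.univ L hne
    exact ⟨L i, hL0 i, fun n => hi n (Finset.mem_univ n)⟩
  obtain ⟨Λ, hΛ0, hΛ⟩ := hupL
  have hconst : ∀ y : ℝ, ∫ _ in (0 : ℝ)..ℓ, y = ℓ * y := fun y => by simp
  obtain ⟨c, hc, H⟩ := exists_nonresonant hε₁ (g := fun n ε => ∫ t in (0 : ℝ)..ℓ, ϖ n ε t)
    (a := ℓ * A) (b := ℓ * B) (L := ℓ * Λ) (by positivity) (by positivity)
    (fun n ε hε => by
      rw [← hconst]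
      exact intervalIntegral.integral_mono_on hℓ.le (by simp) (hinteg n ε hε)
        fun t _ => (hAa n).trans (hlo n ε hε t))
    (fun n ε hε => by
      rw [← hconst]
      exact intervalIntegral.integral_mono_on hℓ.le (hinteg n ε hε) (by simp)
        fun t _ => ((le_abs_self _).trans (hb n ε hε t)).trans (hB n))
    (fun n ε hε ε' hε' => by
      rw [← intervalIntegral.integral_sub (hinteg n ε hε) (hinteg n ε' hε')]
      have := intervalIntegral.norm_integral_le_of_norm_le_const (a := 0) (b := ℓ)
        (f := fun t => ϖ n ε t - ϖ n ε' t) (C := Λ * |Real.sqrt ε - Real.sqrt ε'|)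
        fun t _ => (hL n ε hε ε' hε' t).trans
          (mul_le_mul_of_nonneg_right (hΛ n) (abs_nonneg _))
      rw [sub_zero, abs_of_pos hℓ, Real.norm_eq_abs] at this
      linarith)
  refine ⟨c, hc, fun η hη => ?_⟩
  obtain ⟨ε, hε, hεη, h⟩ := H η hη
  refine ⟨ε, hε, hεη, fun n => ?_⟩
  rw [intervalIntegral.integral_div]
  exact h n

end Nonresonance

/-! ### The solver for the eigenframe system -/

section LinearSolver

variable {N : ℕ}

/-- With small Lipschitz data, the periodic problem
`ε u'' + ε M u' + diag(κ) u = F(t, u) + g` is solvable on `[0, ℓ]`, with estimates. -/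
def PeriodicSolvable (ℓ ε C : ℝ) (κ : Fin N → ℝ → ℝ) (M : Fin N → Fin N → ℝ → ℝ) : Prop :=
  ∀ (F : ℝ → (Fin N → ℝ) → Fin N → ℝ) (g : Fin N → ℝ → ℝ) (η L R : ℝ),
    Continuous (fun x : ℝ × (Fin N → ℝ) => F x.1 x.2) →
    (∀ n, IntervalIntegrable (g n) volume 0 ℓ) →
    0 ≤ η → 0 ≤ L → (∀ t ∈ Icc 0 ℓ, ‖F t 0‖ ≤ η) → (∀ n, ∫ t in (0 : ℝ)..ℓ, |g n t| ≤ η) →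
    (∀ t ∈ Icc 0 ℓ, ∀ x y, ‖x‖ ≤ R → ‖y‖ ≤ R → ‖F t x - F t y‖ ≤ L * ‖x - y‖) →
    C * L ≤ Real.sqrt ε → C * η ≤ Real.sqrt ε * R →
    ∃ u u' u'' : ℝ → Fin N → ℝ, Continuous u ∧ Continuous u' ∧ u 0 = u ℓ ∧ u' 0 = u' ℓ ∧
      (∀ n, IntervalIntegrable (fun t => u'' t n) volume 0 ℓ) ∧
      (∀ θ ∈ Icc 0 ℓ, ∀ n, u θ n = u 0 n + ∫ t in (0 : ℝ)..θ, u' t n) ∧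
      (∀ θ ∈ Icc 0 ℓ, ∀ n, u' θ n = u' 0 n + ∫ t in (0 : ℝ)..θ, u'' t n) ∧
      (∀ t n, ε * u'' t n + ε * ∑ m, M n m t * u' t m + κ n t * u t n = F t (u t) n + g n t) ∧
      (∀ t, ‖u t‖ ≤ C * η / Real.sqrt ε) ∧ ∀ t, Real.sqrt ε * ‖u' t‖ ≤ C * η / Real.sqrt ε

theorem exists_unifBdd_forall {κ : Type*} [Finite κ] {I : Set ℝ} {f : κ → ℝ → ℝ → ℝ}
    (h : ∀ k, UnifBdd I (f k)) : ∃ K, 0 ≤ K ∧ ∀ k, ∀ ε ∈ I, ∀ θ, |f k ε θ| ≤ K := by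
  cases nonempty_fintype κ
  choose K hK using h
  refine ⟨∑ k, |K k|, Finset.sum_nonneg fun k _ => abs_nonneg _, fun k ε hε θ => ?_⟩
  refine ((hK k ε hε θ).trans (le_abs_self _)).trans ?_
  exact Finset.single_le_sum (f := fun k => |K k|) (fun i _ => abs_nonneg _) (Finset.mem_univ k)

theorem exists_unifPos_forall {κ : Type*} [Finite κ] {I : Set ℝ} {f : κ → ℝ → ℝ → ℝ}
    (h : ∀ k, UnifPos I (f k)) : ∃ c > 0, ∀ k, ∀ ε ∈ I, ∀ θ, c ≤ f k ε θ := by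
  cases isEmpty_or_nonempty κ
  · exact ⟨1, one_pos, fun k => isEmptyElim k⟩
  · choose a ha hlo using h
    obtain ⟨i, hi⟩ := Finite.exists_min a
    exact ⟨a i, ha i, fun k ε hε θ => (hi k).trans (hlo k ε hε θ)⟩

namespace FrameFamily

variable {ε₁ ℓ c₀ c₁ : ℝ} {c d : ℕ → ℝ → ℝ → ℝ}
  {P : ℝ → ℝ → Matrix (Fin N) (Fin N) ℝ} {ρ : ℝ → ℝ → Fin N → ℝ}

/-- The frequencies `√(ρ / γ₀)`. -/
def freq (ρ : ℝ → ℝ → Fin N → ℝ) (n : Fin N) (ε θ : ℝ) : ℝ := Real.sqrt (ρ ε θ n / γ₀)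

theorem unifPos_eigenvalue_div {I : Set ℝ} (h : FrameFamily I ℓ N c₀ c₁ c d P ρ) (n : Fin N) :
    UnifPos I fun ε θ => ρ ε θ n / γ₀ :=
  (h.unifPos_eigenvalue n).div (UnifPos.const γ₀_pos) (UC.const (n := 0) γ₀).bdd

theorem tame_freq {I : Set ℝ} (h : FrameFamily I ℓ N c₀ c₁ c d P ρ) (n : Fin N) :
    Tame I ℓ (freq ρ n) :=
  ((h.tame_eigenvalue n).div (Tame.const γ₀) (UnifPos.const γ₀_pos)).sqrt
    (h.unifPos_eigenvalue_div n)

theorem unifPos_freq {I : Set ℝ} (h : FrameFamily I ℓ N c₀ c₁ c d P ρ) (n : Fin N) :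
    UnifPos I (freq ρ n) := (h.unifPos_eigenvalue_div n).sqrt

theorem freq_sq {I : Set ℝ} (h : FrameFamily I ℓ N c₀ c₁ c d P ρ) (n : Fin N) {ε : ℝ} (hε : ε ∈ I)
    (θ : ℝ) : freq ρ n ε θ ^ 2 = ρ ε θ n / γ₀ :=
  Real.sq_sqrt ((h.unifPos_eigenvalue_div n).pos hε θ).le

theorem exists_freq_gap {I : Set ℝ} (h : FrameFamily I ℓ N c₀ c₁ c d P ρ) {n m : Fin N}
    (hnm : m ≠ n) : ∃ g > 0, ∀ ε ∈ I, ∀ θ, g ≤ |freq ρ m ε θ - freq ρ n ε θ| := by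
  obtain ⟨g, hg, hgap⟩ := h.exists_gap
  obtain ⟨B, hB0, hB⟩ := exists_unifBdd_forall fun n => (h.tame_freq n).uc.bdd
  have hγ := γ₀_pos
  refine ⟨g / γ₀ / (2 * B + 1), by positivity, fun ε hε θ => ?_⟩
  have h1 := (h.unifPos_freq m).pos hε θ
  have h2 := (h.unifPos_freq n).pos hε θ
  have h3 : |freq ρ m ε θ - freq ρ n ε θ| * (freq ρ m ε θ + freq ρ n ε θ)
      = |ρ ε θ m - ρ ε θ n| / γ₀ := by
    rw [← abs_of_pos (add_pos h1 h2), ← abs_mul, ← abs_of_pos hγ, ← abs_div, sub_div,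
      ← h.freq_sq m hε, ← h.freq_sq n hε]
    congr 1; ring
  rw [div_le_iff₀ (by positivity)]
  calc g / γ₀ ≤ |ρ ε θ m - ρ ε θ n| / γ₀ := by
        gcongr
        exact hgap ε hε θ m n hnm
    _ ≤ _ := by
        rw [← h3]
        refine mul_le_mul_of_nonneg_left ?_ (abs_nonneg _)
        linarith [le_abs_self (freq ρ m ε θ), le_abs_self (freq ρ n ε θ), hB m ε hε θ, hB n ε hε θ]

/-- This is the second order theorem with s = √ε, ϖ = √(ρ/γ₀) and M = 2 P⁻¹P'. The gaps allow `a` to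
be written as a C¹ function times ϖ_m - ϖ_n, and positivity of the frequencies does the same for `b`
and -ϖ_m - ϖ_n. All bounds are uniform in ε, so C is fixed before ε is chosen. -/
theorem exists_periodicSolvable (h : FrameFamily (Ioo 0 ε₁) ℓ N c₀ c₁ c d P ρ) (hε₁ : 0 < ε₁)
    (hℓ : 0 < ℓ) : ∃ C > 0, ∀ δ > 0, ∃ ε ∈ Ioo 0 ε₁, ε < δ ∧
      PeriodicSolvable ℓ ε C (fun n θ => ρ ε θ n / γ₀)
        (fun n m θ => 2 * logDer P ε θ n m) := by
  set I := Ioo 0 ε₁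
  have hϖ := h.tame_freq
  have hϖp := h.unifPos_freq
  have hM : ∀ n m, UC I 1 fun ε θ => 2 * logDer P ε θ n m := fun n m =>
    (UC.const 2).mul (h.uc_logDer_one n m)
  have hq : ∀ n, UC I 1 fun ε θ => deriv (freq ρ n ε) θ / (2 * freq ρ n ε θ) := fun n =>
    (hϖ n).uc.deriv.div ((UC.const 2).mul (hϖ n).uc.of_succ)
      ((UnifPos.const two_pos).mul (hϖp n))
  have hr : ∀ n, UC I 1 fun ε θ => deriv (freq ρ n ε) θ / (2 * freq ρ n ε θ)
      - 2 * logDer P ε θ n n / 2 := fun n =>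
    (hq n).sub ((hM n n).div (UC.const 2) (UnifPos.const two_pos))
  have ha : ∀ n m, UC I 1 fun ε θ => if m = n then 0 else -(2 * logDer P ε θ n m / 2) := by
    intro n m
    split_ifs
    · exact UC.const 0
    · exact ((hM n m).div (UC.const 2) (UnifPos.const two_pos)).neg
  have hb : ∀ n m, UC I 1 fun ε θ => 2 * logDer P ε θ n m / 2
      + if m = n then deriv (freq ρ n ε) θ / (2 * freq ρ n ε θ) else 0 := by
    intro n m
    refine ((hM n m).div (UC.const 2) (UnifPos.const two_pos)).add ?_
    split_ifs
    · exact hq n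
    · exact UC.const 0
  have hqa : ∀ n m, UC I 1 fun ε θ => (if m = n then 0 else -(2 * logDer P ε θ n m / 2))
      * (freq ρ m ε θ - freq ρ n ε θ)⁻¹ := by
    intro n m
    by_cases hnm : m = n
    · simpa [hnm] using UC.const 0
    · obtain ⟨g, hg, hgap⟩ := h.exists_freq_gap hnm
      exact (ha n m).mul (.inv_of_abs hg hgap ((hϖ m).uc.of_succ.sub (hϖ n).uc.of_succ))
  have hsum : ∀ n m, UC I 1 fun ε θ => (-freq ρ m ε θ - freq ρ n ε θ)⁻¹ := by
    intro n m
    obtain ⟨g, hg, hgap⟩ := (hϖp m)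
    refine .inv_of_abs hg (fun ε hε θ => ?_) ((hϖ m).uc.of_succ.neg.sub (hϖ n).uc.of_succ)
    have h1 := (hϖp n).pos hε θ
    have h2 := hgap ε hε θ
    rw [abs_of_neg (by linarith)]
    linarith
  have hqb := fun n m => (hb n m).mul (hsum n m)
  obtain ⟨Λ₁, h₁, hΛ₁⟩ := exists_unifBdd_forall fun n => (hr n).bdd
  obtain ⟨Λ₂, h₂, hΛ₂⟩ := exists_unifBdd_forall fun x : Fin N × Fin N => (ha x.1 x.2).bdd
  obtain ⟨Λ₃, h₃, hΛ₃⟩ := exists_unifBdd_forall fun x : Fin N × Fin N => (hb x.1 x.2).bdd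
  obtain ⟨Λ₄, h₄, hΛ₄⟩ := exists_unifBdd_forall fun x : Fin N × Fin N => (hqa x.1 x.2).bdd
  obtain ⟨Λ₅, h₅, hΛ₅⟩ := exists_unifBdd_forall fun x : Fin N × Fin N => (hqb x.1 x.2).bdd
  obtain ⟨Λ₆, h₆, hΛ₆⟩ := exists_unifBdd_forall fun x : Fin N × Fin N => (hqa x.1 x.2).deriv.bdd
  obtain ⟨Λ₇, h₇, hΛ₇⟩ := exists_unifBdd_forall fun x : Fin N × Fin N => (hqb x.1 x.2).deriv.bdd
  obtain ⟨w₀, hw₀, hw⟩ := exists_unifPos_forall hϖp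
  obtain ⟨a, ha0, hres⟩ := exists_nonresonant_family hε₁ hℓ hϖ hϖp
  obtain ⟨C, hC, H⟩ := exists_periodic_second_order (ι := Fin N) (ℓ := ℓ)
    (Λ := Λ₁ + Λ₂ + Λ₃ + Λ₄ + Λ₅ + Λ₆ + Λ₇) hℓ (by positivity) ha0 hw₀
  refine ⟨C, hC, fun δ hδ => ?_⟩
  -- The second threshold ensures C √ε ≤ 1.
  obtain ⟨ε, hε, hεδ, hεr⟩ := hres (min δ ((1 / C) ^ 2)) (lt_min hδ (by positivity))
  refine ⟨ε, hε, hεδ.trans_le (min_le_left _ _), ?_⟩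
  have hs : 0 < Real.sqrt ε := Real.sqrt_pos.2 hε.1
  have hCs : C * Real.sqrt ε ≤ 1 := by
    have : Real.sqrt ε ≤ 1 / C :=
      Real.sqrt_le_iff.2 ⟨by positivity, (hεδ.trans_le (min_le_right _ _)).le⟩
    rwa [le_div_iff₀' hC] at this
  have hH := H (Real.sqrt ε) (fun n => freq ρ n ε) (fun n => deriv (freq ρ n ε))
    (fun n θ => deriv (freq ρ n ε) θ / (2 * freq ρ n ε θ) - 2 * logDer P ε θ n n / 2)
    (fun n m θ => 2 * logDer P ε θ n m)
    (fun n m θ => if m = n then 0 else -(2 * logDer P ε θ n m / 2))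
    (fun n m θ => 2 * logDer P ε θ n m / 2
      + if m = n then deriv (freq ρ n ε) θ / (2 * freq ρ n ε θ) else 0)
    (fun n m θ => (if m = n then 0 else -(2 * logDer P ε θ n m / 2))
      * (freq ρ m ε θ - freq ρ n ε θ)⁻¹)
    (fun n m => deriv fun θ => (if m = n then 0 else -(2 * logDer P ε θ n m / 2))
      * (freq ρ m ε θ - freq ρ n ε θ)⁻¹)
    (fun n m θ => (2 * logDer P ε θ n m / 2
      + if m = n then deriv (freq ρ n ε) θ / (2 * freq ρ n ε θ) else 0)
      * (-freq ρ m ε θ - freq ρ n ε θ)⁻¹)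
    (fun n m => deriv fun θ => (2 * logDer P ε θ n m / 2
      + if m = n then deriv (freq ρ n ε) θ / (2 * freq ρ n ε θ) else 0)
      * (-freq ρ m ε θ - freq ρ n ε θ)⁻¹) hs hCs
    { ϖ_cont := fun n => (hϖ n).uc.cont ε hε
      r_cont := fun n => (hr n).cont ε hε
      r_le := fun n t => (hΛ₁ n ε hε t).trans (by linarith)
      a_le := fun n m t => (hΛ₂ (n, m) ε hε t).trans (by linarith)
      b_le := fun n m t => (hΛ₃ (n, m) ε hε t).trans (by linarith)
      a_eq := fun n m t => by
        by_cases hnm : m = n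
        · simp [hnm]
        · obtain ⟨g, hg, hgap⟩ := h.exists_freq_gap hnm
          have := abs_pos.1 (hg.trans_le (hgap ε hε t))
          rw [mul_assoc, inv_mul_cancel₀ this, mul_one]
      b_eq := fun n m t => by
        have h1 := (hϖp n).pos hε t
        have h2 := (hϖp m).pos hε t
        rw [mul_assoc, inv_mul_cancel₀ (by linarith), mul_one]
      qa_deriv := fun n m t => (hqa n m).hasDerivAt hε t
      qb_deriv := fun n m t => (hqb n m).hasDerivAt hε t
      qa'_cont := fun n m => (hqa n m).deriv.cont ε hε
      qb'_cont := fun n m => (hqb n m).deriv.cont ε hε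
      qa_le := fun n m t => (hΛ₄ (n, m) ε hε t).trans (by linarith)
      qb_le := fun n m t => (hΛ₅ (n, m) ε hε t).trans (by linarith)
      qa'_le := fun n m t => (hΛ₆ (n, m) ε hε t).trans (by linarith)
      qb'_le := fun n m t => (hΛ₇ (n, m) ε hε t).trans (by linarith)
      nonres := hεr }
    (fun n t => (hϖ n).uc.hasDerivAt hε t) (fun n => (hϖ n).uc.deriv.cont ε hε)
    (fun n t => hw n ε hε t)
    (fun n => by simpa using ((hϖ n).per ε hε 0).symm)
    (fun n m => (hM n m).cont ε hε) (fun _ _ => rfl) (fun _ _ _ => rfl) (fun _ _ _ => rfl)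
  simp only [Real.sq_sqrt hε.1.le, h.freq_sq _ hε] at hH
  exact hH

end FrameFamily

end LinearSolver

/-! ### Quadratic smallness of the nonlinearity -/

section Nonlinearity

/-- The function e^z - z is critical at 0, so its derivative is O(m) on [-m, m]; the nonlinearity
owes its quadratic character to this. -/
theorem abs_exp_sub_self_le {x y m : ℝ} (hx : |x| ≤ m) (hy : |y| ≤ m) :
    |(Real.exp x - x) - (Real.exp y - y)| ≤ Real.exp m * m * |x - y| := by
  have hm : 0 ≤ m := (abs_nonneg x).trans hx
  have hd : ∀ z ∈ Icc (-m) m, HasDerivWithinAt (fun z => Real.exp z - z) (Real.exp z - 1)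
      (Icc (-m) m) z := fun z _ =>
    ((Real.hasDerivAt_exp z).sub (hasDerivAt_id z)).hasDerivWithinAt
  have hb : ∀ z ∈ Icc (-m) m, ‖Real.exp z - 1‖ ≤ Real.exp m * m := by
    intro z hz
    have h1 := abs_exp_sub_exp_le (K := m) hz.2 hm
    rw [Real.exp_zero, sub_zero] at h1
    refine h1.trans ?_
    gcongr
    exact abs_le.2 hz
  exact (convex_Icc (-m) m).norm_image_sub_le_of_norm_hasDerivWithin_le hd hb
    (abs_le.1 hy) (abs_le.1 hx)

variable {N : ℕ}

theorem comp_sub (v w : Fin N → ℝ) (j : ℕ) : comp (v - w) j = comp v j - comp w j := by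
  simp only [comp, reflect]
  split_ifs <;> simp
  ring

theorem abs_comp_le (v : Fin N → ℝ) (j : ℕ) : |comp v j| ≤ ‖v‖ := by
  simp only [comp, reflect]
  split_ifs <;> try simp only [abs_neg, neg_zero, abs_zero]
  · exact norm_le_pi_norm v _
  · exact norm_nonneg v
  · exact norm_le_pi_norm v _
  · exact norm_nonneg v

theorem comp_zero (j : ℕ) : comp (0 : Fin N → ℝ) j = 0 := by
  simpa using comp_sub (0 : Fin N → ℝ) 0 j

theorem continuous_comp (j : ℕ) : Continuous fun v : Fin N → ℝ => comp v j := by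
  simp only [comp, reflect]
  split_ifs <;> fun_prop

theorem norm_mulVec_le {A : Matrix (Fin N) (Fin N) ℝ} {B : ℝ} (hB : 0 ≤ B)
    (hA : ∀ i j, |A i j| ≤ B) (v : Fin N → ℝ) : ‖A.mulVec v‖ ≤ N * B * ‖v‖ := by
  rw [pi_norm_le_iff_of_nonneg (by positivity)]
  intro i
  calc ‖∑ j, A i j * v j‖ ≤ ∑ _j : Fin N, B * ‖v‖ := by
        refine norm_sum_le_of_le _ fun j _ => ?_
        rw [norm_mul]
        exact mul_le_mul (hA i j) (norm_le_pi_norm v j) (norm_nonneg _) hB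
    _ = N * B * ‖v‖ := by simp [mul_assoc]

variable {S : Setting} {p : Params} {ε₀ δ₀ δ K : ℝ}

theorem expRem_zero (θ : ℝ) : expRem S θ 0 = 0 := by simp [expRem]

theorem abs_expRem_sub_le {b m θ t t' : ℝ} (hb : S.β θ ≤ b) (ht : |t| ≤ m) (ht' : |t'| ≤ m) :
    |expRem S θ t - expRem S θ t'| ≤
      Real.exp (Real.sqrt 2 * b * m) * (Real.sqrt 2 * b) ^ 2 * m * |t - t'| := by
  have hβ := S.β_pos θ
  have hm : 0 ≤ m := (abs_nonneg t).trans ht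
  set κ := Real.sqrt 2 * S.β θ with hκ
  have hκ0 : 0 ≤ κ := by positivity
  have hκb : κ ≤ Real.sqrt 2 * b := by rw [hκ]; gcongr
  have hle : ∀ t, |t| ≤ m → |-(κ * t)| ≤ κ * m := fun t ht => by
    rw [abs_neg, abs_mul, abs_of_nonneg hκ0]; gcongr
  have h1 := abs_exp_sub_self_le (hle t ht) (hle t' ht')
  have e1 : expRem S θ t - expRem S θ t' =
      (Real.exp (-(κ * t)) - -(κ * t)) - (Real.exp (-(κ * t')) - -(κ * t')) := by
    rw [expRem, expRem, ← hκ]; ring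
  have e2 : |-(κ * t) - -(κ * t')| = κ * |t - t'| := by
    rw [← abs_of_nonneg hκ0, ← abs_mul, abs_of_nonneg hκ0, ← abs_neg]; congr 1; ring
  rw [e1]
  refine h1.trans ?_
  rw [e2]
  calc Real.exp (κ * m) * (κ * m) * (κ * |t - t'|)
      = Real.exp (κ * m) * κ ^ 2 * m * |t - t'| := by ring
    _ ≤ _ := by gcongr

theorem J_zero (ε θ : ℝ) : J S p ε θ (0 : Fin N → ℝ) = 0 := by
  funext i
  simp [J, comp_zero, expRem_zero]

theorem tame_six_β : Tame (Ioo 0 ε₀) S.ℓ fun _ θ => 6 * Real.sqrt 2 * S.β θ :=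
  (Tame.const _).mul (tame_β S _)

theorem tame_J_fst (hS : ∀ θ, 0 < S.meanCurv θ) (hp : p.Admissible S N ε₀ δ₀ δ K) (i : Fin N) :
    Tame (Ioo 0 ε₀) S.ℓ fun ε θ => 6 * Real.sqrt 2 * S.β θ * γ₁ S N p ε (i + 1) θ
      * kCoef S N p ε (i + 1) θ :=
  (tame_six_β.mul (tame_γ₁ hp (Finset.mem_Icc.2 ⟨by omega, by omega⟩))).mul
    (tame_kCoef hS hp (by omega))

theorem tame_J_snd (hS : ∀ θ, 0 < S.meanCurv θ) (hp : p.Admissible S N ε₀ δ₀ δ K) (i : Fin N) :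
    Tame (Ioo 0 ε₀) S.ℓ fun ε θ => 6 * Real.sqrt 2 * S.β θ * γ₂ S N p ε (i + 1) θ
      * kCoef S N p ε (i + 2) θ :=
  (tame_six_β.mul (tame_γ₂ hp (Finset.mem_Icc.2 ⟨by omega, by omega⟩))).mul
    (tame_kCoef hS hp (by omega))

/-- The Lipschitz constant on a ball is proportional to its radius m; the cap `A` on m only keeps
the exponential factor bounded. -/
theorem exists_norm_J_sub_le (hS : ∀ θ, 0 < S.meanCurv θ) (hp : p.Admissible S N ε₀ δ₀ δ K)
    (A : ℝ) : ∃ B, 0 ≤ B ∧ ∀ ε ∈ Ioo 0 ε₀, ∀ θ, ∀ v w : Fin N → ℝ, ∀ m ≤ A, ‖v‖ ≤ m → ‖w‖ ≤ m →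
      ‖J S p ε θ v - J S p ε θ w‖ ≤ B * m * ‖v - w‖ := by
  obtain ⟨b, hb⟩ := (tame_β S {0}).uc.bdd
  obtain ⟨B₁, hB₁, h₁⟩ := exists_unifBdd_forall fun i : Fin N => (tame_J_fst hS hp i).uc.bdd
  obtain ⟨B₂, hB₂, h₂⟩ := exists_unifBdd_forall fun i : Fin N => (tame_J_snd hS hp i).uc.bdd
  have hβb : ∀ θ, S.β θ ≤ b := fun θ => (le_abs_self _).trans (hb 0 rfl θ)
  have hb0 : 0 ≤ b := (S.β_pos 0).le.trans (hβb 0)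
  set E := Real.exp (Real.sqrt 2 * b * (2 * A)) * (Real.sqrt 2 * b) ^ 2 with hE
  have hE0 : 0 ≤ E := by positivity
  refine ⟨(B₁ + B₂) * (4 * E), by positivity, fun ε hε θ v w m hmA hv hw => ?_⟩
  have hm : 0 ≤ m := (norm_nonneg v).trans hv
  have hdiff : ∀ z : Fin N → ℝ, ∀ i j : ℕ, |comp z i - comp z j| ≤ 2 * ‖z‖ := fun z i j => by
    linarith [abs_sub (comp z i) (comp z j), abs_comp_le z i, abs_comp_le z j]
  have hexp : ∀ i j : ℕ, |expRem S θ (comp v i - comp v j) - expRem S θ (comp w i - comp w j)|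
      ≤ 4 * E * m * ‖v - w‖ := by
    intro i j
    refine (abs_expRem_sub_le (m := 2 * m) (hβb θ) ((hdiff v i j).trans (by linarith))
      ((hdiff w i j).trans (by linarith))).trans ?_
    have e : comp v i - comp v j - (comp w i - comp w j) = comp (v - w) i - comp (v - w) j := by
      rw [comp_sub, comp_sub]; ring
    rw [e]
    calc _ ≤ E * (2 * m) * (2 * ‖v - w‖) := by
          rw [hE]
          gcongr
          exact hdiff _ i j
      _ = _ := by ring
  rw [pi_norm_le_iff_of_nonneg (by positivity)]
  intro i
  have e : (J S p ε θ v - J S p ε θ w) i =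
      -(6 * Real.sqrt 2 * S.β θ * γ₁ S N p ε (i + 1) θ * kCoef S N p ε (i + 1) θ
        * (expRem S θ (comp v (i + 1) - comp v i) - expRem S θ (comp w (i + 1) - comp w i)))
      + 6 * Real.sqrt 2 * S.β θ * γ₂ S N p ε (i + 1) θ * kCoef S N p ε (i + 2) θ
        * (expRem S θ (comp v (i + 2) - comp v (i + 1))
          - expRem S θ (comp w (i + 2) - comp w (i + 1))) := by
    simp only [Pi.sub_apply, J]; ring
  rw [e, Real.norm_eq_abs]
  refine (abs_add_le _ _).trans ?_
  rw [abs_neg, abs_mul, abs_mul _ (expRem S θ (comp v (i + 2) - comp v (i + 1)) - _)]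
  calc _ ≤ B₁ * (4 * E * m * ‖v - w‖) + B₂ * (4 * E * m * ‖v - w‖) :=
        add_le_add (mul_le_mul (h₁ i ε hε θ) (hexp _ _) (abs_nonneg _) hB₁)
          (mul_le_mul (h₂ i ε hε θ) (hexp _ _) (abs_nonneg _) hB₂)
    _ = _ := by ring

theorem continuous_J (hS : ∀ θ, 0 < S.meanCurv θ) (hp : p.Admissible S N ε₀ δ₀ δ K) {ε : ℝ}
    (hε : ε ∈ Ioo 0 ε₀) : Continuous fun x : ℝ × (Fin N → ℝ) => J S p ε x.1 x.2 := by
  have hβ : Continuous S.β := S.contDiff_β.continuous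
  have hexp : ∀ i j : ℕ, Continuous fun x : ℝ × (Fin N → ℝ) =>
      expRem S x.1 (comp x.2 i - comp x.2 j) := by
    intro i j
    have h1 := continuous_comp (N := N) i
    have h2 := continuous_comp (N := N) j
    unfold expRem
    fun_prop
  refine continuous_pi fun i => ?_
  unfold J
  exact ((((tame_J_fst hS hp i).uc.cont ε hε).comp continuous_fst).mul (hexp _ _)).neg.add
    ((((tame_J_snd hS hp i).uc.cont ε hε).comp continuous_fst).mul (hexp _ _))

end Nonlinearity

/-! ### Size and Lipschitz constant of the right-hand side -/

section RightHandSide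

variable {N : ℕ} {S : Setting} {p : Params} {ε₀ δ₀ δ K : ℝ}
  {P : ℝ → ℝ → Matrix (Fin N) (Fin N) ℝ} {ρ : ℝ → ℝ → Fin N → ℝ}
  {ε₁ c₀ c₁ : ℝ} {c d : ℕ → ℝ → ℝ → ℝ}

theorem uc_frakC (hp : p.Admissible S N ε₀ δ₀ δ K) (hε₁ : ε₁ ≤ ε₀)
    (h : FrameFamily (Ioo 0 ε₁) S.ℓ N c₀ c₁ c d P ρ) (n : Fin N) :
    UC (Ioo 0 ε₁) 2 fun ε => frakC p ε (P ε) (ρ ε) n := by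
  refine UC.div (f := fun ε θ => ∑ j, (P ε θ)⁻¹ n j * p.D ε (j + 1) θ)
    (UC.sum _ fun j _ => (h.uc_inv le_rfl h.uc n j).mul ?_) (h.tame_eigenvalue n).uc
    (h.unifPos_eigenvalue n)
  exact (hp.D_C2 (j + 1) (Finset.mem_Icc.2 ⟨by omega, by omega⟩)).uc.mono
    (Ioo_subset_Ioo_right hε₁)

theorem matDeriv_one_apply (Q : ℝ → Matrix (Fin N) (Fin N) ℝ) (θ : ℝ) (i j : Fin N) :
    matDeriv 1 Q θ i j = deriv (fun t => Q t i j) θ := by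
  simp [matDeriv, iteratedDeriv_one]

theorem matDeriv_two_apply (Q : ℝ → Matrix (Fin N) (Fin N) ℝ) (θ : ℝ) (i j : Fin N) :
    matDeriv 2 Q θ i j = deriv (deriv fun t => Q t i j) θ := by
  simp [matDeriv, iteratedDeriv_succ]

theorem uc_inv_mul_matDeriv_two {I : Set ℝ} {ℓ : ℝ} (h : FrameFamily I ℓ N c₀ c₁ c d P ρ)
    (i j : Fin N) : UC I 0 fun ε θ => ((P ε θ)⁻¹ * matDeriv 2 (P ε) θ) i j := by
  simp only [Matrix.mul_apply, matDeriv_two_apply]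
  exact UC.sum _ fun k _ => ((h.uc_inv le_rfl h.uc i k).of_le (by omega)).mul (h.uc k j).deriv.deriv

theorem inv_mul_matDeriv_one (ε θ : ℝ) :
    (P ε θ)⁻¹ * matDeriv 1 (P ε) θ = FrameFamily.logDer P ε θ := by
  rw [FrameFamily.logDer]
  congr 1
  ext i j
  rw [matDeriv_one_apply]
  rfl

/-- The coefficient of y' is twice P⁻¹P', the matrix `M` of the solver, so this part of `W` can be
moved to the linear side. -/
theorem W_eq (ε θ : ℝ) (y y' : Fin N → ℝ) :
    W (P ε) θ y y' = ((P ε θ)⁻¹ * matDeriv 2 (P ε) θ).mulVec y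
      + (2 : ℝ) • (FrameFamily.logDer P ε θ).mulVec y' := by
  rw [W, Matrix.mulVec_mulVec, Matrix.mulVec_mulVec, inv_mul_matDeriv_one]

/-- The logarithmic amplitude `ε |ln ε|`. -/
def logAmp (ε : ℝ) : ℝ := ε * |Real.log ε|

/-- The right-hand side of the problem in the form `ε u'' + 2 ε P⁻¹ P' u' + (ρ / γ₀) u = F(θ, u)`,
without the forcing term. -/
def rhs (S : Setting) (p : Params) (P : ℝ → ℝ → Matrix (Fin N) (Fin N) ℝ) (ρ : ℝ → ℝ → Fin N → ℝ)
    (ε θ : ℝ) (x : Fin N → ℝ) : Fin N → ℝ :=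
  -(γ₀⁻¹ • Jtilde S p ε (P ε) θ (x + logAmp ε • fun j => frakC p ε (P ε) (ρ ε) j θ)
    + ε • W (P ε) θ (x + logAmp ε • fun j => frakC p ε (P ε) (ρ ε) j θ)
      (logAmp ε • fun j => deriv (frakC p ε (P ε) (ρ ε) j) θ)
    + (ε * logAmp ε) • fun j => deriv (deriv (frakC p ε (P ε) (ρ ε) j)) θ)

theorem continuous_rhs (hS : ∀ θ, 0 < S.meanCurv θ) (hp : p.Admissible S N ε₀ δ₀ δ K)
    (hε₁ : ε₁ ≤ ε₀) (h : FrameFamily (Ioo 0 ε₁) S.ℓ N c₀ c₁ c d P ρ) {ε : ℝ}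
    (hε : ε ∈ Ioo 0 ε₁) : Continuous fun x : ℝ × (Fin N → ℝ) => rhs S p P ρ ε x.1 x.2 := by
  have hC := uc_frakC hp hε₁ h
  have h0 : Continuous fun θ : ℝ => fun j => frakC p ε (P ε) (ρ ε) j θ :=
    continuous_pi fun j => (hC j).cont ε hε
  have h1 : Continuous fun θ : ℝ => fun j => deriv (frakC p ε (P ε) (ρ ε) j) θ :=
    continuous_pi fun j => (hC j).deriv.cont ε hε
  have h2 : Continuous fun θ : ℝ => fun j => deriv (deriv (frakC p ε (P ε) (ρ ε) j)) θ :=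
    continuous_pi fun j => (hC j).deriv.deriv.cont ε hε
  have hP : Continuous fun θ : ℝ => P ε θ := continuous_matrix fun i j => (h.uc i j).cont ε hε
  have hPi : Continuous fun θ : ℝ => (P ε θ)⁻¹ :=
    continuous_matrix fun i j => (h.uc_inv le_rfl h.uc i j).cont ε hε
  have hP2 : Continuous fun θ : ℝ => (P ε θ)⁻¹ * matDeriv 2 (P ε) θ :=
    continuous_matrix fun i j => (uc_inv_mul_matDeriv_two h i j).cont ε hε
  have hPl : Continuous fun θ : ℝ => FrameFamily.logDer P ε θ :=
    continuous_matrix fun i j => (h.uc_logDer_one i j).cont ε hε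
  have hy : Continuous fun x : ℝ × (Fin N → ℝ) =>
      x.2 + logAmp ε • fun j => frakC p ε (P ε) (ρ ε) j x.1 :=
    continuous_snd.add ((h0.comp continuous_fst).fun_const_smul _)
  have hJ : Continuous fun x : ℝ × (Fin N → ℝ) => Jtilde S p ε (P ε) x.1
      (x.2 + logAmp ε • fun j => frakC p ε (P ε) (ρ ε) j x.1) := by
    unfold Jtilde
    refine (hPi.comp continuous_fst).matrix_mulVec ?_
    exact (continuous_J hS hp ⟨hε.1, hε.2.trans_le hε₁⟩).comp
      (continuous_fst.prodMk ((hP.comp continuous_fst).matrix_mulVec hy))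
  unfold rhs
  simp only [W_eq]
  exact (((hJ.fun_const_smul _).add ((((hP2.comp continuous_fst).matrix_mulVec hy).add
    (((hPl.comp continuous_fst).matrix_mulVec
      ((h1.comp continuous_fst).fun_const_smul _)).fun_const_smul _)).fun_const_smul _)).add
    ((h2.comp continuous_fst).fun_const_smul _)).neg

/-- Write a = ε|ln ε|. At x = 0 the quadratic term acts on a shift of size a and gives a², while `W`
and the second derivative of ℭ give ε a. The Lipschitz constant is R + a from the quadratic term and
ε from the zeroth order part of `W`; u' does not occur in `rhs`. -/
theorem exists_rhs_bounds (hS : ∀ θ, 0 < S.meanCurv θ) (hp : p.Admissible S N ε₀ δ₀ δ K)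
    (hε₁ : ε₁ ≤ ε₀) (h : FrameFamily (Ioo 0 ε₁) S.ℓ N c₀ c₁ c d P ρ) :
    ∃ A > 0, ∀ ε ∈ Ioo 0 ε₁, logAmp ε ≤ 1 →
      (∀ θ, ‖rhs S p P ρ ε θ 0‖ ≤ A * (logAmp ε ^ 2 + ε * logAmp ε)) ∧
      ∀ R ≤ 1, ∀ θ x y, ‖x‖ ≤ R → ‖y‖ ≤ R →
        ‖rhs S p P ρ ε θ x - rhs S p P ρ ε θ y‖ ≤ A * (R + logAmp ε + ε) * ‖x - y‖ := by
  have hC := uc_frakC hp hε₁ h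
  obtain ⟨C₀, hC₀, b₀⟩ := exists_unifBdd_forall fun j => (hC j).bdd
  obtain ⟨C₁, hC₁, b₁⟩ := exists_unifBdd_forall fun j => (hC j).deriv.bdd
  obtain ⟨C₂, hC₂, b₂⟩ := exists_unifBdd_forall fun j => (hC j).deriv.deriv.bdd
  obtain ⟨B₁, hB₁, p₁⟩ := exists_unifBdd_forall fun x : Fin N × Fin N => (h.uc x.1 x.2).bdd
  obtain ⟨B₂, hB₂, p₂⟩ := exists_unifBdd_forall fun x : Fin N × Fin N =>
    (h.uc_inv le_rfl h.uc x.1 x.2).bdd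
  obtain ⟨B₃, hB₃, p₃⟩ := exists_unifBdd_forall fun x : Fin N × Fin N =>
    (uc_inv_mul_matDeriv_two h x.1 x.2).bdd
  obtain ⟨B₄, hB₄, p₄⟩ := exists_unifBdd_forall fun x : Fin N × Fin N =>
    (h.uc_logDer_one x.1 x.2).bdd
  obtain ⟨B, hB, hJ⟩ := exists_norm_J_sub_le (N := N) hS hp (N * B₁ * (1 + C₀))
  have hγ := γ₀_pos
  set D := γ₀⁻¹ * (N * B₂ * (B * (N * B₁) * (N * B₁))) with hD
  have hD0 : 0 ≤ D := by positivity
  refine ⟨D * (1 + C₀) ^ 2 + N * B₃ * (1 + C₀) + 2 * (N * B₄ * C₁) + C₂ + 1, by positivity,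
    fun ε hε hc1 => ?_⟩
  set a := logAmp ε with ha
  have ha0 : 0 ≤ a := mul_nonneg hε.1.le (abs_nonneg _)
  have hε0 := hε.1
  have hε' : ε ∈ Ioo 0 ε₀ := ⟨hε.1, hε.2.trans_le hε₁⟩
  have hv : ∀ {f : Fin N → ℝ → ℝ → ℝ} {A : ℝ}, 0 ≤ A → (∀ k, ∀ ε ∈ Ioo 0 ε₁, ∀ θ, |f k ε θ| ≤ A) →
      ∀ θ, ‖fun j => f j ε θ‖ ≤ A := fun hA hf θ =>
    (pi_norm_le_iff_of_nonneg hA).2 fun j => hf j ε hε θ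
  have hn₀ := hv hC₀ b₀
  have hn₁ := hv hC₁ b₁
  have hn₂ := hv hC₂ b₂
  have hP := fun θ => norm_mulVec_le (A := P ε θ) hB₁ fun i j => p₁ (i, j) ε hε θ
  have hPi := fun θ => norm_mulVec_le (A := (P ε θ)⁻¹) hB₂ fun i j => p₂ (i, j) ε hε θ
  have hP2 := fun θ => norm_mulVec_le (A := (P ε θ)⁻¹ * matDeriv 2 (P ε) θ) hB₃
    fun i j => p₃ (i, j) ε hε θ
  have hPl := fun θ => norm_mulVec_le (A := FrameFamily.logDer P ε θ) hB₄
    fun i j => p₄ (i, j) ε hε θ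
  have hJt : ∀ θ (v w : Fin N → ℝ) m, m ≤ 1 + C₀ → ‖v‖ ≤ m → ‖w‖ ≤ m →
      ‖γ₀⁻¹ • (Jtilde S p ε (P ε) θ v - Jtilde S p ε (P ε) θ w)‖ ≤ D * m * ‖v - w‖ := by
    intro θ v w m hm hv hw
    have h1 : ‖J S p ε θ ((P ε θ).mulVec v) - J S p ε θ ((P ε θ).mulVec w)‖
        ≤ B * (N * B₁ * m) * (N * B₁ * ‖v - w‖) := by
      refine (hJ ε hε' θ _ _ (N * B₁ * m) (by gcongr) ((hP θ v).trans (by gcongr))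
        ((hP θ w).trans (by gcongr))).trans ?_
      rw [← Matrix.mulVec_sub]
      have hm0 := (norm_nonneg v).trans hv
      exact mul_le_mul_of_nonneg_left (hP θ _) (by positivity)
    rw [norm_smul, Real.norm_of_nonneg (inv_nonneg.2 hγ.le), Jtilde, Jtilde, ← Matrix.mulVec_sub]
    calc _ ≤ γ₀⁻¹ * (N * B₂ * (B * (N * B₁ * m) * (N * B₁ * ‖v - w‖))) := by
          gcongr
          exact (hPi θ _).trans (by gcongr)
      _ = _ := by rw [hD]; ring
  have hJ0 : ∀ θ, Jtilde S p ε (P ε) θ 0 = 0 := fun θ => by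
    rw [Jtilde, Matrix.mulVec_zero, J_zero, Matrix.mulVec_zero]
  have hshift : ∀ θ, ‖a • fun j => frakC p ε (P ε) (ρ ε) j θ‖ ≤ a * C₀ := fun θ => by
    rw [norm_smul, Real.norm_of_nonneg ha0]; gcongr; exact hn₀ θ
  have haC : a * C₀ ≤ C₀ := mul_le_of_le_one_left hC₀ hc1
  constructor
  · intro θ
    rw [rhs, norm_neg, zero_add, W_eq]
    have t1 : ‖γ₀⁻¹ • Jtilde S p ε (P ε) θ (a • fun j => frakC p ε (P ε) (ρ ε) j θ)‖
        ≤ D * (a * C₀) * (a * C₀) := by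
      have := hJt θ (a • fun j => frakC p ε (P ε) (ρ ε) j θ) 0 (a * C₀) (by linarith) (hshift θ)
        (by simpa using (by positivity : (0:ℝ) ≤ a * C₀))
      rw [hJ0, sub_zero, sub_zero] at this
      refine this.trans ?_
      gcongr
      exact hshift θ
    have t2 : ‖((P ε θ)⁻¹ * matDeriv 2 (P ε) θ).mulVec (a • fun j => frakC p ε (P ε) (ρ ε) j θ)‖
        ≤ N * B₃ * (a * C₀) := (hP2 θ _).trans (by gcongr; exact hshift θ)
    have t3 : ‖(2 : ℝ) • (FrameFamily.logDer P ε θ).mulVec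
        (a • fun j => deriv (frakC p ε (P ε) (ρ ε) j) θ)‖ ≤ 2 * (N * B₄ * (a * C₁)) := by
      rw [norm_smul, Real.norm_two]
      gcongr
      refine (hPl θ _).trans ?_
      gcongr
      rw [norm_smul, Real.norm_of_nonneg ha0]; gcongr; exact hn₁ θ
    have t4 : ‖(ε * a) • fun j => deriv (deriv (frakC p ε (P ε) (ρ ε) j)) θ‖ ≤ ε * a * C₂ := by
      rw [norm_smul, Real.norm_of_nonneg (by positivity)]; gcongr; exact hn₂ θ
    refine (norm_add₃_le).trans ?_
    rw [norm_smul ε, Real.norm_of_nonneg hε0.le]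
    refine (add_le_add (add_le_add t1 (mul_le_mul_of_nonneg_left
      ((norm_add_le _ _).trans (add_le_add t2 t3)) hε0.le)) t4).trans ?_
    have q1 : D * (a * C₀) * (a * C₀) ≤ D * (1 + C₀) ^ 2 * (a ^ 2 + ε * a) := by
      have : D * (a * C₀) * (a * C₀) = D * C₀ ^ 2 * a ^ 2 := by ring
      rw [this]
      gcongr
      · linarith
      · nlinarith [mul_nonneg hε0.le ha0]
    have q2 : ε * (N * B₃ * (a * C₀) + 2 * (N * B₄ * (a * C₁))) + ε * a * C₂
        = (N * B₃ * C₀ + 2 * (N * B₄ * C₁) + C₂) * (ε * a) := by ring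
    have q3 : (N * B₃ * C₀ + 2 * (N * B₄ * C₁) + C₂) * (ε * a)
        ≤ (N * B₃ * (1 + C₀) + 2 * (N * B₄ * C₁) + C₂ + 1) * (a ^ 2 + ε * a) := by
      have e1 : 0 ≤ ε * a := by positivity
      have e2 : 0 ≤ N * B₃ := by positivity
      exact mul_le_mul (by linarith) (by nlinarith) e1 (by positivity)
    linarith
  · intro R hR θ x y hx hy
    have hR0 := (norm_nonneg x).trans hx
    set s := a • fun j => frakC p ε (P ε) (ρ ε) j θ with hs
    have hxs : ‖x + s‖ ≤ R + a * C₀ := (norm_add_le _ _).trans (add_le_add hx (hshift θ))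
    have hys : ‖y + s‖ ≤ R + a * C₀ := (norm_add_le _ _).trans (add_le_add hy (hshift θ))
    have exy : x + s - (y + s) = x - y := by abel
    have t1 := hJt θ (x + s) (y + s) (R + a * C₀) (by linarith) hxs hys
    have t2 := hP2 θ (x - y)
    rw [exy] at t1
    have e : rhs S p P ρ ε θ x - rhs S p P ρ ε θ y =
        -(γ₀⁻¹ • (Jtilde S p ε (P ε) θ (x + s) - Jtilde S p ε (P ε) θ (y + s))
        + ε • ((P ε θ)⁻¹ * matDeriv 2 (P ε) θ).mulVec (x - y)) := by
      rw [← exy, Matrix.mulVec_sub]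
      simp only [rhs, W_eq, ← ha, ← hs, smul_sub, smul_add]
      abel
    rw [e, norm_neg]
    refine (norm_add_le _ _).trans ?_
    rw [norm_smul ε, Real.norm_of_nonneg hε0.le]
    refine (add_le_add t1 (mul_le_mul_of_nonneg_left t2 hε0.le)).trans ?_
    have q : D * (R + a * C₀) + ε * (N * B₃) ≤ (D * (1 + C₀) ^ 2 + N * B₃ * (1 + C₀)
        + 2 * (N * B₄ * C₁) + C₂ + 1) * (R + a + ε) := by
      have e1 : D * (R + a * C₀) ≤ D * (1 + C₀) ^ 2 * (R + a + ε) := by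
        rw [mul_assoc D]
        refine mul_le_mul_of_nonneg_left ?_ hD0
        nlinarith [mul_nonneg hC₀ hR0, mul_nonneg hC₀ ha0, mul_nonneg (sq_nonneg C₀) hR0,
          mul_nonneg (sq_nonneg C₀) ha0, mul_nonneg hC₀ hε0.le, mul_nonneg (sq_nonneg C₀) hε0.le]
      have e2 : ε * (N * B₃) ≤ N * B₃ * (1 + C₀) * (R + a + ε) := by
        have : N * B₃ ≤ N * B₃ * (1 + C₀) :=
          le_mul_of_one_le_right (by positivity) (by linarith)
        rw [mul_comm]
        exact mul_le_mul this (by linarith) hε0.le (by positivity)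
      have e3 : 0 ≤ (2 * (N * B₄ * C₁) + C₂ + 1) * (R + a + ε) := by positivity
      linarith
    calc _ = (D * (R + a * C₀) + ε * (N * B₃)) * ‖x - y‖ := by ring
      _ ≤ _ := mul_le_mul_of_nonneg_right q (norm_nonneg _)

end RightHandSide

/-! ### Comparison of norms -/

section Norms

variable {N : ℕ} {ℓ : ℝ}

theorem norm_toLp_le (v : Fin N → ℝ) :
    ‖(WithLp.toLp 2 v : EuclideanSpace ℝ (Fin N))‖ ≤ N * ‖v‖ := by
  rw [EuclideanSpace.norm_eq, Real.sqrt_le_iff]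
  refine ⟨by positivity, ?_⟩
  calc ∑ i, ‖v i‖ ^ 2 ≤ ∑ _i : Fin N, ‖v‖ ^ 2 := by
        gcongr with i; exact norm_le_pi_norm v i
    _ = N * ‖v‖ ^ 2 := by simp
    _ ≤ (N : ℝ) ^ 2 * ‖v‖ ^ 2 := by
        gcongr
        exact_mod_cast Nat.le_self_pow two_ne_zero N
    _ = _ := by ring

theorem lpNorm_two_le_of_bound (hℓ : 0 < ℓ) {g : ℝ → EuclideanSpace ℝ (Fin N)} {B : ℝ}
    (hB : 0 ≤ B) (hg : ∀ t, ‖g t‖ ≤ B) : lpNorm 2 ℓ g ≤ Real.sqrt ℓ * B := by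
  have h := eLpNorm_le_of_ae_bound (p := 2) (μ := volume.restrict (Ioo 0 ℓ))
    (Eventually.of_forall hg)
  rw [Measure.restrict_apply_univ, Real.volume_Ioo, sub_zero] at h
  have h2 := ENNReal.toReal_mono (by finiteness) h
  refine h2.trans (le_of_eq ?_)
  rw [ENNReal.toReal_mul, ← ENNReal.toReal_rpow, ENNReal.toReal_ofReal hℓ.le,
    ENNReal.toReal_ofReal hB, Real.sqrt_eq_rpow]
  norm_num

theorem lpNorm_top_le_of_bound {g : ℝ → EuclideanSpace ℝ (Fin N)} {B : ℝ}
    (hB : 0 ≤ B) (hg : ∀ t, ‖g t‖ ≤ B) : lpNorm ⊤ ℓ g ≤ B := by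
  have h := eLpNorm_le_of_ae_bound (p := ⊤) (μ := volume.restrict (Ioo 0 ℓ))
    (Eventually.of_forall hg)
  simp only [ENNReal.toReal_top, inv_zero, ENNReal.rpow_zero, one_mul] at h
  exact (ENNReal.toReal_mono (by finiteness) h).trans_eq (ENNReal.toReal_ofReal hB)

theorem lpNorm_const_smul (a : ℝ) (g : ℝ → EuclideanSpace ℝ (Fin N)) :
    lpNorm 2 ℓ (fun t => a • g t) = |a| * lpNorm 2 ℓ g := by
  have h := eLpNorm_const_smul a g 2 (volume.restrict (Ioo 0 ℓ))
  change (eLpNorm (a • g) 2 _).toReal = _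
  rw [h, ENNReal.toReal_mul, toReal_enorm, Real.norm_eq_abs]
  rfl

theorem lpNorm_sub_le {f g : ℝ → EuclideanSpace ℝ (Fin N)}
    (hf : MemLp f 2 (volume.restrict (Ioo 0 ℓ))) (hg : MemLp g 2 (volume.restrict (Ioo 0 ℓ))) :
    lpNorm 2 ℓ (fun t => f t - g t) ≤ lpNorm 2 ℓ f + lpNorm 2 ℓ g := by
  have h := eLpNorm_sub_le (p := 2) hf.1 hg.1 (by norm_num)
  refine (ENNReal.toReal_mono (ENNReal.add_ne_top.2 ⟨hf.2.ne, hg.2.ne⟩) h).trans_eq ?_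
  exact ENNReal.toReal_add hf.2.ne hg.2.ne

theorem intervalIntegrable_of_memLp (hℓ : 0 < ℓ) {h : ℝ → EuclideanSpace ℝ (Fin N)}
    (hh : MemLp h 2 (volume.restrict (Ioo 0 ℓ))) : IntervalIntegrable h volume 0 ℓ :=
  (intervalIntegrable_iff_integrableOn_Ioo_of_le hℓ.le).2 (hh.integrable (by norm_num))

/-- Cauchy–Schwarz on an interval of length ℓ; the solver sees only the L¹ size of the forcing. -/
theorem integral_abs_apply_le (hℓ : 0 < ℓ) {h : ℝ → EuclideanSpace ℝ (Fin N)}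
    (hh : MemLp h 2 (volume.restrict (Ioo 0 ℓ))) (n : Fin N) :
    ∫ t in (0 : ℝ)..ℓ, |h t n| ≤ Real.sqrt ℓ * lpNorm 2 ℓ h := by
  have hinteg := intervalIntegrable_of_memLp hℓ hh
  have hn : IntervalIntegrable (fun t => h t n) volume 0 ℓ :=
    (intervalIntegrable_iff.2
      ((EuclideanSpace.proj (𝕜 := ℝ) n).integrable_comp (intervalIntegrable_iff.1 hinteg)))
  have h1 : ∫ t in (0 : ℝ)..ℓ, |h t n| ≤ ∫ t in (0 : ℝ)..ℓ, ‖h t‖ :=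
    intervalIntegral.integral_mono_on hℓ.le hn.abs hinteg.norm fun t _ =>
      PiLp.norm_apply_le (h t) n
  refine h1.trans ?_
  rw [intervalIntegral.integral_of_le hℓ.le, integral_Ioc_eq_integral_Ioo,
    integral_norm_eq_lintegral_enorm hh.1, ← eLpNorm_one_eq_lintegral_enorm]
  have h2 := eLpNorm_le_eLpNorm_mul_rpow_measure_univ (p := 1) (q := 2) (by norm_num) hh.1
  rw [Measure.restrict_apply_univ, Real.volume_Ioo, sub_zero] at h2
  have hexp : (1 / (1 : ENNReal).toReal - 1 / (2 : ENNReal).toReal) = 1 / 2 := by norm_num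
  rw [hexp] at h2
  refine (ENNReal.toReal_mono (ENNReal.mul_ne_top hh.2.ne (by finiteness)) h2).trans_eq ?_
  rw [ENNReal.toReal_mul, ← ENNReal.toReal_rpow, ENNReal.toReal_ofReal hℓ.le, Real.sqrt_eq_rpow,
    mul_comm]
  rfl

theorem isH2_toLp (hℓ : 0 < ℓ) {u u' u'' : ℝ → Fin N → ℝ} (hu' : Continuous u')
    (hm : MemLp (fun t => (WithLp.toLp 2 (u'' t) : EuclideanSpace ℝ (Fin N))) 2
      (volume.restrict (Ioo 0 ℓ)))
    (h1 : ∀ θ ∈ Icc 0 ℓ, ∀ n, u θ n = u 0 n + ∫ t in (0 : ℝ)..θ, u' t n)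
    (h2 : ∀ θ ∈ Icc 0 ℓ, ∀ n, u' θ n = u' 0 n + ∫ t in (0 : ℝ)..θ, u'' t n) :
    IsH2 ℓ (fun t => (WithLp.toLp 2 (u t) : EuclideanSpace ℝ (Fin N)))
      (fun t => WithLp.toLp 2 (u' t)) fun t => WithLp.toLp 2 (u'' t) := by
  have key : ∀ (v : ℝ → Fin N → ℝ) (θ : ℝ) (n : Fin N), IntervalIntegrable
      (fun t => (WithLp.toLp 2 (v t) : EuclideanSpace ℝ (Fin N))) volume 0 θ →
      (∫ t in (0 : ℝ)..θ, (WithLp.toLp 2 (v t) : EuclideanSpace ℝ (Fin N))) n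
        = ∫ t in (0 : ℝ)..θ, v t n := fun v θ n hv =>
    ((EuclideanSpace.proj (𝕜 := ℝ) n).intervalIntegral_comp_comm hv).symm
  refine ⟨hm, fun θ hθ => ?_, fun θ hθ => ?_⟩
  · ext n
    have hi := (intervalIntegrable_of_memLp hℓ hm).mono_set
      (uIcc_subset_uIcc left_mem_uIcc (by rw [uIcc_of_le hℓ.le]; exact hθ))
    rw [PiLp.add_apply, key u'' θ n hi]
    exact h2 θ hθ n
  · ext n
    have hi := ((PiLp.continuous_toLp 2 fun _ : Fin N => ℝ).comp hu').intervalIntegrable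
      (μ := volume) 0 θ
    rw [PiLp.add_apply, key u' θ n hi]
    exact h1 θ hθ n

end Norms

/-! ### Smallness conditions on ε -/

section SmallParameter

/-- Divided by ε^(1+σ), the first quantity is ε^(1-σ) times powers of the logarithm, which vanishes
because σ < 1. Divided by √ε, the second is ε^σ plus vanishing terms, which needs σ > 0. -/
theorem eventually_smallness {σ : ℝ} (hσ₀ : 0 < σ) (hσ₁ : σ < 1) (K : ℝ) :
    ∀ᶠ ε in 𝓝[>] (0 : ℝ), ε ≤ 1 ∧ logAmp ε ≤ 1 ∧
      K * (logAmp ε ^ 2 + ε * logAmp ε) ≤ ε ^ (1 + σ) ∧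
      K * (ε ^ (1 / 2 + σ) + logAmp ε + ε) ≤ Real.sqrt ε := by
  have hlog : ∀ r : ℝ, 0 < r → Tendsto (fun ε : ℝ => |Real.log ε * ε ^ r|) (𝓝[>] 0) (𝓝 0) :=
    fun r hr => by simpa using (tendsto_log_mul_rpow_nhdsGT_zero hr).abs
  have hpow : ∀ r : ℝ, 0 < r → Tendsto (fun ε : ℝ => ε ^ r) (𝓝[>] 0) (𝓝 0) := fun r hr => by
    have := (Real.continuousAt_rpow_const 0 r (Or.inr hr.le)).tendsto
    rw [Real.zero_rpow hr.ne'] at this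
    exact this.mono_left nhdsWithin_le_nhds
  have t1 : Tendsto (fun ε : ℝ => K * (|Real.log ε * ε ^ ((1 - σ) / 2)| ^ 2
      + |Real.log ε * ε ^ (1 - σ)|)) (𝓝[>] 0) (𝓝 0) := by
    simpa using (((hlog _ (by linarith)).pow 2).add (hlog _ (by linarith))).const_mul K
  have t2 : Tendsto (fun ε : ℝ => K * (ε ^ σ + |Real.log ε * ε ^ (1 / 2 : ℝ)| + ε ^ (1 / 2 : ℝ)))
      (𝓝[>] 0) (𝓝 0) := by
    simpa using (((hpow σ hσ₀).add (hlog _ (by norm_num))).add (hpow (1 / 2)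
      (by norm_num))).const_mul K
  have t3 := hpow 1 one_pos
  have t4 := hlog 1 one_pos
  filter_upwards [t1.eventually_le_const one_pos, t2.eventually_le_const one_pos,
    t3.eventually_le_const one_pos, t4.eventually_le_const one_pos, self_mem_nhdsWithin]
    with ε h1 h2 h3 h4 h0
  have h0 : 0 < ε := h0
  rw [Real.rpow_one] at h3
  have habs : ∀ r : ℝ, |Real.log ε * ε ^ r| = |Real.log ε| * ε ^ r := fun r => by
    rw [abs_mul, abs_of_pos (Real.rpow_pos_of_pos h0 r)]
  refine ⟨h3, ?_, ?_, ?_⟩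
  · rw [habs, Real.rpow_one] at h4
    rw [logAmp]; linarith
  · rw [habs, habs] at h1
    have e1 : ε ^ 2 = ε ^ (1 + σ) * (ε ^ ((1 - σ) / 2)) ^ 2 := by
      rw [← Real.rpow_natCast (ε ^ ((1 - σ) / 2)), ← Real.rpow_mul h0.le, ← Real.rpow_add h0,
        ← Real.rpow_natCast]
      congr 1; push_cast; ring
    have e2 : ε ^ 2 = ε ^ (1 + σ) * ε ^ (1 - σ) := by
      rw [← Real.rpow_add h0, ← Real.rpow_natCast]
      congr 1; push_cast; ring
    have e3 : K * (logAmp ε ^ 2 + ε * logAmp ε) = ε ^ (1 + σ) *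
        (K * ((|Real.log ε| * ε ^ ((1 - σ) / 2)) ^ 2 + |Real.log ε| * ε ^ (1 - σ))) := by
      rw [logAmp]
      linear_combination K * |Real.log ε| ^ 2 * e1 + K * |Real.log ε| * e2
    rw [e3]
    exact mul_le_of_le_one_right (Real.rpow_nonneg h0.le _) h1
  · rw [habs] at h2
    have e1 : ε = ε ^ (1 / 2 : ℝ) * ε ^ (1 / 2 : ℝ) := by
      rw [← Real.rpow_add h0]; norm_num
    have e2 : K * (ε ^ (1 / 2 + σ) + logAmp ε + ε) = ε ^ (1 / 2 : ℝ) *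
        (K * (ε ^ σ + |Real.log ε| * ε ^ (1 / 2 : ℝ) + ε ^ (1 / 2 : ℝ))) := by
      rw [Real.rpow_add h0, logAmp]
      linear_combination (K * |Real.log ε| + K) * e1
    rw [e2, Real.sqrt_eq_rpow]
    exact mul_le_of_le_one_right (Real.rpow_nonneg h0.le _) h2

end SmallParameter

/-! ### Solutions of the nonlinear periodic problem -/

section Solution

variable {N : ℕ} {S : Setting} {p : Params} {P : ℝ → ℝ → Matrix (Fin N) (Fin N) ℝ}
  {ρ : ℝ → ℝ → Fin N → ℝ}

/-- The reduced equation is equivalent to the original one. -/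
theorem equation_of_rhs {ε θ f : ℝ} {y y' y'' : Fin N → ℝ} {n : Fin N}
    (h : ε * y'' n + ε * ∑ m, 2 * FrameFamily.logDer P ε θ n m * y' m + ρ ε θ n / γ₀ * y n
      = rhs S p P ρ ε θ y n + -(γ₀⁻¹ * f)) :
    -(ε * γ₀ * y'' n) - ρ ε θ n * y n =
      Jtilde S p ε (P ε) θ (fun j => y j + ε * |Real.log ε| * frakC p ε (P ε) (ρ ε) j θ) n
      + ε * γ₀ * W (P ε) θ (fun j => y j + ε * |Real.log ε| * frakC p ε (P ε) (ρ ε) j θ)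
          (fun j => y' j + ε * |Real.log ε| * deriv (frakC p ε (P ε) (ρ ε) j) θ) n
      + ε ^ 2 * |Real.log ε| * γ₀ * iteratedDeriv 2 (frakC p ε (P ε) (ρ ε) n) θ + f := by
  have hγ := γ₀_pos.ne'
  set z : Fin N → ℝ := fun j => y j + ε * |Real.log ε| * frakC p ε (P ε) (ρ ε) j θ with hz
  set z' : Fin N → ℝ := fun j => ε * |Real.log ε| * deriv (frakC p ε (P ε) (ρ ε) j) θ with hz'
  have e1 : W (P ε) θ z (fun j => y' j + ε * |Real.log ε| * deriv (frakC p ε (P ε) (ρ ε) j) θ) n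
      = W (P ε) θ z z' n + ∑ m, 2 * FrameFamily.logDer P ε θ n m * y' m := by
    have : (fun j => y' j + ε * |Real.log ε| * deriv (frakC p ε (P ε) (ρ ε) j) θ) = y' + z' := rfl
    rw [this, W_eq, W_eq, Matrix.mulVec_add]
    simp only [Pi.add_apply, Pi.smul_apply, smul_eq_mul, Matrix.mulVec, dotProduct, mul_assoc,
      ← Finset.mul_sum]
    ring
  have e2 : iteratedDeriv 2 (frakC p ε (P ε) (ρ ε) n) θ
      = deriv (deriv (frakC p ε (P ε) (ρ ε) n)) θ := by
    simp only [iteratedDeriv_succ, iteratedDeriv_zero]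
  have e3 : rhs S p P ρ ε θ y n = -(γ₀⁻¹ * Jtilde S p ε (P ε) θ z n + ε * W (P ε) θ z z' n
      + ε * (ε * |Real.log ε|) * deriv (deriv (frakC p ε (P ε) (ρ ε) n)) θ) := rfl
  rw [e3] at h
  rw [e1, e2]
  have g₁ : γ₀ * (ρ ε θ n / γ₀) = ρ ε θ n := mul_div_cancel₀ _ hγ
  have g₂ : γ₀ * γ₀⁻¹ = 1 := mul_inv_cancel₀ hγ
  linear_combination -γ₀ * h + y n * g₁ + (Jtilde S p ε (P ε) θ z n + f) * g₂

variable {ε₀ δ₀ δ K ε₁ c₀ c₁ : ℝ} {c d : ℕ → ℝ → ℝ → ℝ}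

/-- The solver bounds u and √ε u' by Z = Cη/√ε in the sup norm; u'' is then read off from the
equation. `D` is the Cauchy–Schwarz factor that passes from the L² norm of f to the L¹ size of f/γ₀,
and `Q` collects the constants of the three norms. -/
theorem exists_isSolution (hS : ∀ θ, 0 < S.meanCurv θ) (hp : p.Admissible S N ε₀ δ₀ δ K)
    (hε₁₀ : ε₁ ≤ ε₀) (h : FrameFamily (Ioo 0 ε₁) S.ℓ N c₀ c₁ c d P ρ) {C A B₁ B₂ σ : ℝ}
    (hC : 0 < C) (hA : 0 < A) (hB₁ : 0 ≤ B₁) (hB₂ : 0 ≤ B₂)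
    (hbρ : ∀ n, ∀ ε ∈ Ioo 0 ε₁, ∀ θ, |ρ ε θ n / γ₀| ≤ B₁)
    (hbM : ∀ n m, ∀ ε ∈ Ioo 0 ε₁, ∀ θ, |2 * FrameFamily.logDer P ε θ n m| ≤ B₂)
    {ε : ℝ} (hε : ε ∈ Ioo 0 ε₁) (hε1 : ε ≤ 1)
    (hrhs0 : ∀ θ, ‖rhs S p P ρ ε θ 0‖ ≤ A * (logAmp ε ^ 2 + ε * logAmp ε))
    (hrhs : ∀ R ≤ 1, ∀ θ x y, ‖x‖ ≤ R → ‖y‖ ≤ R →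
      ‖rhs S p P ρ ε θ x - rhs S p P ρ ε θ y‖ ≤ A * (R + logAmp ε + ε) * ‖x - y‖)
    (hsol : PeriodicSolvable S.ℓ ε C (fun n θ => ρ ε θ n / γ₀)
      (fun n m θ => 2 * FrameFamily.logDer P ε θ n m))
    {D Q : ℝ} (hD : D = Real.sqrt S.ℓ / γ₀)
    (hQ : Q = N * (1 + Real.sqrt S.ℓ * (1 + (2 / C + N * B₂ + B₁))))
    (hs₁ : A * (logAmp ε ^ 2 + ε * logAmp ε) ≤ ε ^ (1 + σ))
    (hs₂ : Q * C * A * (logAmp ε ^ 2 + ε * logAmp ε) ≤ ε ^ (1 + σ))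
    (hR1 : C * (1 + D) * ε ^ (1 / 2 + σ) ≤ 1)
    (hL : C * (A * (C * (1 + D) * ε ^ (1 / 2 + σ) + logAmp ε + ε)) ≤ Real.sqrt ε)
    {f : ℝ → EuclideanSpace ℝ (Fin N)} (hf : MemLp f 2 (volume.restrict (Ioo 0 S.ℓ)))
    (hfε : lpNorm 2 S.ℓ f ≤ ε ^ (1 + σ)) :
    ∃ u u' u'' : ℝ → EuclideanSpace ℝ (Fin N), IsSolution S p ε (P ε) (ρ ε) f u u' u'' ∧
      ε * lpNorm 2 S.ℓ u'' + Real.sqrt ε * lpNorm 2 S.ℓ u' + lpNorm ⊤ S.ℓ u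
        ≤ (Q * C * D + γ₀⁻¹) * ε ^ (-(1 / 2) : ℝ) * lpNorm 2 S.ℓ f + ε ^ (1 / 2 + σ) := by
  have hγ := γ₀_pos
  have hℓ := S.ℓ_pos
  have hε0 := hε.1
  set s := Real.sqrt ε with hs
  have hs0 : 0 < s := Real.sqrt_pos.2 hε0
  have hs1 : s ≤ 1 := Real.sqrt_le_one.2 hε1
  have hss : s * s = ε := Real.mul_self_sqrt hε0.le
  have hD0 : 0 ≤ D := by rw [hD]; positivity
  have hQ0 : 0 ≤ Q := by rw [hQ]; positivity
  set F := lpNorm 2 S.ℓ f with hF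
  have hF0 : 0 ≤ F := ENNReal.toReal_nonneg
  have ha0 : 0 ≤ logAmp ε := mul_nonneg hε0.le (abs_nonneg _)
  set q := logAmp ε ^ 2 + ε * logAmp ε with hq
  have hq0 : 0 ≤ q := by positivity
  have hpow : s * ε ^ (1 / 2 + σ) = ε ^ (1 + σ) := by
    rw [hs, Real.sqrt_eq_rpow, ← Real.rpow_add hε0]; congr 1; ring
  have hpow0 : 0 ≤ ε ^ (1 / 2 + σ) := Real.rpow_nonneg hε0.le _
  set η := A * q + D * F with hη
  have hη0 : 0 ≤ η := by positivity
  -- Since η ≤ (1 + D) ε^(1+σ), this is the radius for which the solver's a priori bound Cη/√ε stays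
  -- inside the ball.
  set R := C * (1 + D) * ε ^ (1 / 2 + σ) with hR
  have hR0 : 0 ≤ R := by positivity
  have hηR : C * η ≤ s * R := by
    have : η ≤ (1 + D) * ε ^ (1 + σ) := by
      have := mul_le_mul_of_nonneg_left hfε hD0
      rw [hη]; linarith
    calc C * η ≤ C * ((1 + D) * ε ^ (1 + σ)) := by gcongr
      _ = s * R := by rw [hR, ← hpow]; ring
  have hfi := intervalIntegrable_of_memLp hℓ hf
  have hfn : ∀ n, IntervalIntegrable (fun t => f t n) volume 0 S.ℓ := fun n =>
    intervalIntegrable_iff.2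
      ((EuclideanSpace.proj (𝕜 := ℝ) n).integrable_comp (intervalIntegrable_iff.1 hfi))
  have hgη : ∀ n, ∫ t in (0 : ℝ)..S.ℓ, |-(γ₀⁻¹ * f t n)| ≤ η := by
    intro n
    simp only [abs_neg, abs_mul, abs_of_pos (inv_pos.2 hγ), intervalIntegral.integral_const_mul]
    calc γ₀⁻¹ * ∫ t in (0 : ℝ)..S.ℓ, |f t n| ≤ γ₀⁻¹ * (Real.sqrt S.ℓ * F) := by
          gcongr; exact integral_abs_apply_le hℓ hf n
      _ = D * F := by rw [hD]; ring
      _ ≤ η := by rw [hη]; linarith [mul_nonneg hA.le hq0]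
  have hFc := continuous_rhs hS hp hε₁₀ h hε
  obtain ⟨u, u', u'', huc, hu'c, hper, hper', hu''i, hu_eq, hu'_eq, heq, hub, hu'b⟩ :=
    hsol (rhs S p P ρ ε) (fun n t => -(γ₀⁻¹ * f t n)) η (A * (R + logAmp ε + ε)) R hFc
      (fun n => ((hfn n).const_mul _).neg) hη0 (by positivity)
      (fun t _ => (hrhs0 t).trans (by rw [hη]; linarith [mul_nonneg hD0 hF0])) hgη
      (fun t _ x y hx hy => hrhs R hR1 t x y hx hy) hL hηR
  set Z := C * η / s with hZ
  have hZ0 : 0 ≤ Z := by positivity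
  have hZR : Z ≤ R := by rw [hZ, div_le_iff₀ hs0]; linarith
  -- The equation is ε u'' = G - f/γ₀, where G is continuous and O(Z). So u'' is square integrable
  -- even though f is only in L².
  set G : ℝ → Fin N → ℝ := fun t n => rhs S p P ρ ε t (u t) n
    - ε * ∑ m, 2 * FrameFamily.logDer P ε t n m * u' t m - ρ ε t n / γ₀ * u t n with hG
  have hFu : Continuous fun t => rhs S p P ρ ε t (u t) :=
    Continuous.comp (g := fun x : ℝ × (Fin N → ℝ) => rhs S p P ρ ε x.1 x.2)
      (f := fun t => (t, u t)) hFc (continuous_id.prodMk huc)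
  have hGc : Continuous G := by
    refine continuous_pi fun n => ?_
    have h1 : Continuous fun t => rhs S p P ρ ε t (u t) n :=
      continuous_pi_iff.1 hFu n
    have h2 : Continuous fun t => ∑ m, 2 * FrameFamily.logDer P ε t n m * u' t m :=
      continuous_finsetSum _ fun m _ => (continuous_const.mul
        ((h.uc_logDer_one n m).cont ε hε)).mul ((continuous_apply m).comp hu'c)
    have h3 : Continuous fun t => ρ ε t n / γ₀ * u t n :=
      (((h.tame_eigenvalue n).uc.cont ε hε).div_const _).mul ((continuous_apply n).comp huc)
    exact (h1.sub (continuous_const.mul h2)).sub h3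
  have hGb : ∀ t, ‖G t‖ ≤ (2 / C + N * B₂ + B₁) * Z := by
    intro t
    rw [pi_norm_le_iff_of_nonneg (by positivity)]
    intro n
    have h1 : |rhs S p P ρ ε t (u t) n| ≤ 2 / C * Z := by
      have e1 := hrhs R hR1 t (u t) 0 ((hub t).trans hZR) (by simpa using hR0)
      have e2 := hrhs0 t
      have e3 : ‖rhs S p P ρ ε t (u t)‖ ≤ η + A * (R + logAmp ε + ε) * Z := by
        have e4 := norm_add_le (rhs S p P ρ ε t (u t) - rhs S p P ρ ε t 0) (rhs S p P ρ ε t 0)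
        rw [sub_add_cancel] at e4
        rw [sub_zero] at e1
        have e5 : A * (R + logAmp ε + ε) * ‖u t‖ ≤ A * (R + logAmp ε + ε) * Z := by
          gcongr
          exact hub t
        linarith [mul_nonneg hD0 hF0]
      refine (norm_le_pi_norm (rhs S p P ρ ε t (u t)) n).trans (e3.trans ?_)
      -- Both contributions to the right-hand side are at most Z/C by the smallness already required
      -- for the solver, because √ε ≤ 1.
      have e6 : A * (R + logAmp ε + ε) ≤ 1 / C := by
        rw [le_div_iff₀' hC]; linarith
      have e7 : η ≤ 1 / C * Z := by
        rw [hZ]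
        have : 1 / C * (C * η / s) = η / s := by field_simp
        rw [this, le_div_iff₀ hs0]
        exact mul_le_of_le_one_right hη0 hs1
      calc _ ≤ 1 / C * Z + 1 / C * Z := by gcongr
        _ = _ := by ring
    have h2 : |ε * ∑ m, 2 * FrameFamily.logDer P ε t n m * u' t m| ≤ N * B₂ * Z := by
      have e1 : |∑ m, 2 * FrameFamily.logDer P ε t n m * u' t m| ≤ N * B₂ * ‖u' t‖ := by
        calc _ ≤ ∑ _m : Fin N, B₂ * ‖u' t‖ := by
              refine (Finset.abs_sum_le_sum_abs _ _).trans (Finset.sum_le_sum fun m _ => ?_)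
              rw [abs_mul]
              exact mul_le_mul (hbM n m ε hε t) (norm_le_pi_norm (u' t) m) (abs_nonneg _) hB₂
          _ = _ := by simp [mul_assoc]
      rw [abs_mul, abs_of_pos hε0]
      calc ε * |∑ m, 2 * FrameFamily.logDer P ε t n m * u' t m|
          ≤ ε * (N * B₂ * ‖u' t‖) := by gcongr
        _ = N * B₂ * (s * (s * ‖u' t‖)) := by linear_combination -(N * B₂ * ‖u' t‖) * hss
        _ ≤ N * B₂ * Z := by
            gcongr
            have := hu'b t
            calc s * (s * ‖u' t‖) ≤ 1 * Z := by gcongr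
              _ = Z := one_mul Z
    have h3 : |ρ ε t n / γ₀ * u t n| ≤ B₁ * Z := by
      rw [abs_mul]
      exact mul_le_mul (hbρ n ε hε t) ((norm_le_pi_norm (u t) n).trans (hub t)) (abs_nonneg _) hB₁
    rw [Real.norm_eq_abs]
    calc |G t n| ≤ |rhs S p P ρ ε t (u t) n|
          + |ε * ∑ m, 2 * FrameFamily.logDer P ε t n m * u' t m| + |ρ ε t n / γ₀ * u t n| :=
          (abs_sub _ _).trans (add_le_add_left (abs_sub _ _) _)
      _ ≤ _ := by linarith
  set U'' : ℝ → EuclideanSpace ℝ (Fin N) := fun t => WithLp.toLp 2 (u'' t) with hU''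
  have hGLc : Continuous fun t => (WithLp.toLp 2 (G t) : EuclideanSpace ℝ (Fin N)) :=
    (PiLp.continuous_toLp 2 fun _ : Fin N => ℝ).comp hGc
  have hGLb : ∀ t, ‖(WithLp.toLp 2 (G t) : EuclideanSpace ℝ (Fin N))‖
      ≤ N * ((2 / C + N * B₂ + B₁) * Z) := fun t =>
    (norm_toLp_le _).trans (by gcongr; exact hGb t)
  have hGm : MemLp (fun t => (WithLp.toLp 2 (G t) : EuclideanSpace ℝ (Fin N))) 2
      (volume.restrict (Ioo 0 S.ℓ)) :=
    MemLp.of_bound hGLc.aestronglyMeasurable _ (Eventually.of_forall hGLb)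
  have hfm : MemLp (fun t => γ₀⁻¹ • f t) 2 (volume.restrict (Ioo 0 S.ℓ)) := hf.const_smul γ₀⁻¹
  have hkey : (fun t => ε • U'' t) = fun t =>
      (WithLp.toLp 2 (G t) : EuclideanSpace ℝ (Fin N)) - γ₀⁻¹ • f t := by
    funext t
    ext n
    have := heq t n
    simp only [hU'', hG, PiLp.smul_apply, PiLp.sub_apply, smul_eq_mul] at this ⊢
    linarith
  have hU''m : MemLp U'' 2 (volume.restrict (Ioo 0 S.ℓ)) := by
    have h1 : MemLp (fun t => ε • U'' t) 2 (volume.restrict (Ioo 0 S.ℓ)) := by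
      rw [hkey]; exact hGm.sub hfm
    have h2 : U'' = fun t => ε⁻¹ • (ε • U'' t) := by
      funext t; rw [smul_smul, inv_mul_cancel₀ hε0.ne', one_smul]
    rw [h2]
    exact h1.const_smul ε⁻¹
  refine ⟨fun t => WithLp.toLp 2 (u t), fun t => WithLp.toLp 2 (u' t), U'', ⟨?_, ?_, ?_, ?_⟩, ?_⟩
  · exact isH2_toLp hℓ hu'c hU''m hu_eq hu'_eq
  · exact Eventually.of_forall fun θ n => equation_of_rhs (heq θ n)
  · exact congrArg (WithLp.toLp 2) hper
  · exact congrArg (WithLp.toLp 2) hper'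
  · have b1 : ε * lpNorm 2 S.ℓ U'' ≤ Real.sqrt S.ℓ * (N * ((2 / C + N * B₂ + B₁) * Z))
        + γ₀⁻¹ * F := by
      have e1 := lpNorm_const_smul (ℓ := S.ℓ) ε U''
      rw [abs_of_pos hε0] at e1
      rw [← e1, hkey]
      refine (lpNorm_sub_le hGm hfm).trans (add_le_add ?_ ?_)
      · exact lpNorm_two_le_of_bound hℓ (by positivity) hGLb
      · rw [lpNorm_const_smul, abs_of_pos (inv_pos.2 hγ)]
    have b2 : s * lpNorm 2 S.ℓ (fun t => (WithLp.toLp 2 (u' t) : EuclideanSpace ℝ (Fin N)))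
        ≤ Real.sqrt S.ℓ * (N * Z) := by
      have e1 := lpNorm_const_smul (ℓ := S.ℓ) s
        (fun t => (WithLp.toLp 2 (u' t) : EuclideanSpace ℝ (Fin N)))
      rw [abs_of_pos hs0] at e1
      rw [← e1]
      refine lpNorm_two_le_of_bound hℓ (by positivity) fun t => ?_
      rw [norm_smul, Real.norm_of_nonneg hs0.le]
      calc s * ‖(WithLp.toLp 2 (u' t) : EuclideanSpace ℝ (Fin N))‖ ≤ s * (N * ‖u' t‖) := by
            gcongr; exact norm_toLp_le _
        _ = N * (s * ‖u' t‖) := by ring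
        _ ≤ N * Z := by gcongr; exact hu'b t
    have b3 : lpNorm ⊤ S.ℓ (fun t => (WithLp.toLp 2 (u t) : EuclideanSpace ℝ (Fin N))) ≤ N * Z :=
      lpNorm_top_le_of_bound (by positivity) fun t =>
        (norm_toLp_le _).trans (by gcongr; exact hub t)
    have hinv : ε ^ (-(1 / 2) : ℝ) = s⁻¹ := by
      rw [Real.rpow_neg hε0.le, hs, Real.sqrt_eq_rpow]
    have hsum : Real.sqrt S.ℓ * (N * ((2 / C + N * B₂ + B₁) * Z)) + Real.sqrt S.ℓ * (N * Z) + N * Z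
        = Q * Z := by rw [hQ]; ring
    have hQZ : Q * Z = Q * C * A * q / s + Q * C * D * s⁻¹ * F := by
      rw [hZ, hη]; field_simp
    have c1 : Q * C * A * q / s ≤ ε ^ (1 / 2 + σ) := by
      rw [div_le_iff₀ hs0]; linarith
    -- The forcing enters ε u'' directly, without the loss ε^(-1/2); it is weakened to the common
    -- form since ε ≤ 1.
    have c2 : γ₀⁻¹ * F ≤ γ₀⁻¹ * s⁻¹ * F := by
      have : 1 ≤ s⁻¹ := (one_le_inv₀ hs0).2 hs1
      gcongr
      exact le_mul_of_one_le_right (by positivity) this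
    rw [hinv]
    linarith

theorem exists_periodic_solutions (hS : ∀ θ, 0 < S.meanCurv θ) (hN : 1 ≤ N) (hε₀ : 0 < ε₀)
    (hδ₀ : 0 < δ₀) (hp : p.Admissible S N ε₀ δ₀ δ K)
    (hP : ∀ ε ∈ Ioo 0 ε₀, IsEigenframe S N p ε (P ε) (ρ ε)) {σ : ℝ} (hσ₀ : 0 < σ) (hσ₁ : σ < 1) :
    ∃ C > 0, ∀ τ > 0, ∃ ε ∈ Ioo 0 ε₀, ε < τ ∧ ∀ f : ℝ → EuclideanSpace ℝ (Fin N),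
      MemLp f 2 (volume.restrict (Ioo 0 S.ℓ)) → lpNorm 2 S.ℓ f ≤ ε ^ (1 + σ) →
      ∃ u u' u'' : ℝ → EuclideanSpace ℝ (Fin N), IsSolution S p ε (P ε) (ρ ε) f u u' u'' ∧
        ε * lpNorm 2 S.ℓ u'' + Real.sqrt ε * lpNorm 2 S.ℓ u' + lpNorm ⊤ S.ℓ u
          ≤ C * ε ^ (-(1 / 2) : ℝ) * lpNorm 2 S.ℓ f + ε ^ (1 / 2 + σ) := by
  obtain ⟨ε₁, hε₁, c₀, c₁, h⟩ := exists_frameFamily hS hN hδ₀ hε₀ hp hP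
  obtain ⟨C, hC, hsol⟩ := h.exists_periodicSolvable hε₁.1 S.ℓ_pos
  obtain ⟨A, hA, hrhs⟩ := exists_rhs_bounds hS hp hε₁.2 h
  obtain ⟨B₁, hB₁, hbρ⟩ := exists_unifBdd_forall fun n =>
    ((h.tame_eigenvalue n).div (Tame.const γ₀) (UnifPos.const γ₀_pos)).uc.bdd
  obtain ⟨B₂, hB₂, hbM⟩ := exists_unifBdd_forall fun x : Fin N × Fin N =>
    ((UC.const (n := 1) 2).mul (h.uc_logDer_one x.1 x.2)).bdd
  have hγ := γ₀_pos
  obtain ⟨D, hD⟩ : ∃ D, D = Real.sqrt S.ℓ / γ₀ := ⟨_, rfl⟩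
  obtain ⟨Q, hQ⟩ : ∃ Q, Q = N * (1 + Real.sqrt S.ℓ * (1 + (2 / C + N * B₂ + B₁))) := ⟨_, rfl⟩
  have hD0 : 0 ≤ D := by rw [hD]; positivity
  have hQ0 : 0 ≤ Q := by rw [hQ]; positivity
  refine ⟨Q * C * D + γ₀⁻¹, by positivity, fun τ hτ => ?_⟩
  -- `k₁` covers the two requirements that compare the error from ℭ with ε^(1+σ). `k₂` covers the
  -- radius being at most 1 and the Lipschitz condition of the solver. Both depend only on constants
  -- fixed before ε.
  set k₁ := A + Q * C * A with hk₁
  set k₂ := (C * A + 1) * (C * (1 + D) + 1) with hk₂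
  obtain ⟨ε₂, hε₂, hsmall⟩ := mem_nhdsGT_iff_exists_Ioo_subset.1
    (eventually_smallness hσ₀ hσ₁ (k₁ + k₂))
  obtain ⟨ε, hε, hετ, hper⟩ := hsol (min τ ε₂) (lt_min hτ hε₂)
  have hε0 := hε.1
  obtain ⟨hε1, ha1, hs1, hs2⟩ := hsmall ⟨hε0, hετ.trans_le (min_le_right _ _)⟩
  obtain ⟨hr0, hr⟩ := hrhs ε hε ha1
  have ha0 : 0 ≤ logAmp ε := mul_nonneg hε0.le (abs_nonneg _)
  have hq0 : 0 ≤ logAmp ε ^ 2 + ε * logAmp ε := by positivity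
  have hw0 : 0 ≤ ε ^ (1 / 2 + σ) := Real.rpow_nonneg hε0.le _
  have hk₁0 : 0 ≤ k₁ := by positivity
  have hk₂0 : 0 ≤ k₂ := by positivity
  have hs2' : k₂ * (ε ^ (1 / 2 + σ) + logAmp ε + ε) ≤ Real.sqrt ε := by
    refine le_trans ?_ hs2
    gcongr
    linarith
  have hsqrt1 : Real.sqrt ε ≤ 1 := Real.sqrt_le_one.2 hε1
  refine ⟨ε, ⟨hε0, hε.2.trans_le hε₁.2⟩, hετ.trans_le (min_le_left _ _), fun f hf hfε => ?_⟩
  refine exists_isSolution hS hp hε₁.2 h hC hA hB₁ hB₂ hbρ (fun n m => hbM (n, m)) hε hε1 hr0 hr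
    hper hD hQ ?_ ?_ ?_ ?_ hf hfε
  · refine le_trans ?_ hs1
    gcongr
    have : 0 ≤ Q * C * A := by positivity
    linarith
  · refine le_trans ?_ hs1
    gcongr
    linarith
  · refine le_trans ?_ (hs2'.trans hsqrt1)
    refine mul_le_mul ?_ (by linarith) hw0 hk₂0
    have : 0 ≤ C * A * (C * (1 + D) + 1) := by positivity
    rw [hk₂]
    linarith
  · refine le_trans ?_ hs2'
    have e1 : C * (1 + D) * ε ^ (1 / 2 + σ) + logAmp ε + ε
        ≤ (C * (1 + D) + 1) * (ε ^ (1 / 2 + σ) + logAmp ε + ε) := by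
      have : 0 ≤ C * (1 + D) * (logAmp ε + ε) := by positivity
      linarith
    calc _ = C * A * (C * (1 + D) * ε ^ (1 / 2 + σ) + logAmp ε + ε) := by ring
      _ ≤ (C * A + 1) * ((C * (1 + D) + 1) * (ε ^ (1 / 2 + σ) + logAmp ε + ε)) := by
          refine mul_le_mul (by linarith) e1 (by positivity) (by positivity)
      _ = _ := by rw [hk₂]; ring

end Solution

end BoundaryLayers

end

theorem mainTheorem5 (S : BoundaryLayers.Setting) (hS : ∀ θ, 0 < S.meanCurv θ)
    (N : ℕ) (hN : 1 ≤ N) (p : BoundaryLayers.Params) (ε₀ δ₀ δ K : ℝ)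
    (hε₀ : 0 < ε₀) (hδ₀ : 0 < δ₀) (hδ : 0 < δ)
    (hp : p.Admissible S N ε₀ δ₀ δ K)
    (P : ℝ → ℝ → Matrix (Fin N) (Fin N) ℝ) (ρ : ℝ → ℝ → Fin N → ℝ)
    (hP : ∀ ε ∈ Set.Ioo 0 ε₀, BoundaryLayers.IsEigenframe S N p ε (P ε) (ρ ε))
    (σ : ℝ) (hσ₀ : 0 < σ) (hσ₁ : σ < 1) :
    ∃ C : ℝ, 0 < C ∧ ∃ e : ℕ → ℝ,
      (∀ l, e l ∈ Set.Ioo 0 ε₀) ∧ Filter.Tendsto e Filter.atTop (nhds 0) ∧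
      ∀ l, ∀ h : ℝ → EuclideanSpace ℝ (Fin N),
        MeasureTheory.MemLp h 2 (MeasureTheory.volume.restrict (Set.Ioo 0 S.ℓ)) →
        BoundaryLayers.lpNorm 2 S.ℓ h ≤ e l ^ (1 + σ) →
        ∃ u u' u'' : ℝ → EuclideanSpace ℝ (Fin N),
          BoundaryLayers.IsSolution S p (e l) (P (e l)) (ρ (e l)) h u u' u'' ∧
          e l * BoundaryLayers.lpNorm 2 S.ℓ u'' + Real.sqrt (e l) * BoundaryLayers.lpNorm 2 S.ℓ u'
              + BoundaryLayers.lpNorm ⊤ S.ℓ u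
            ≤ C * e l ^ (-(1 / 2) : ℝ) * BoundaryLayers.lpNorm 2 S.ℓ h
              + e l ^ (1 / 2 + σ) := by
  obtain ⟨C, hC, H⟩ := BoundaryLayers.exists_periodic_solutions hS hN hε₀ hδ₀ hp hP hσ₀ hσ₁
  choose e he hlt hsol using fun l : ℕ => H (1 / ((l : ℝ) + 1)) (by positivity)
  refine ⟨C, hC, e, he, ?_, hsol⟩
  exact squeeze_zero (fun l => (he l).1.le) (fun l => (hlt l).le)
    tendsto_one_div_add_atTop_nhds_zero_nat
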